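/- Let $(M,g)$ be a smooth ($C^\infty$) Riemannian manifold of dimension $n\ge 2$ with Riemannian distance $d_g$, and let $\mathbb D\subset\mathbb C$ be the open unit disc, with boundary circle $b\mathbb D$. A *conformal harmonic disc* is a smooth map $u:\mathbb D\to M$ which is harmonic, i.e. in local coordinates $$\Delta u^k+\sum_{i,j}\Gamma^k_{ij}(u)\,\bigl(\partial_xu^i\,\partial_xu^j+\partial_yu^i\,\partial_yu^j\bigr)=0$$ with $\Gamma^k_{ij}$ the Christoffel symbols of $g$, and conformal, i.e. $u^*g=\lambda\,(dx^2+dy^2)$ for some function $\lambda\ge 0$; it is *immersed* if $du$ is injective at every point of $\mathbb D$. A function $f:U\to[-\infty,+\infty)$ on an open set $U\subset M$ is *minimal plurisubharmonic (MPSH)* on $U$ if it is upper semicontinuous and $f\circ u$ is subharmonic on $\mathbb D$ for every conformal harmonic immersed disc $u:\mathbb D\to U$. A function $\rho:M\to\mathbb R$ of class $C^2$ is *strictly MPSH* if for every $p\in M$ there are normal coordinates $x$ centered at $p$ and $\varepsilon>0$ such that $\rho-\varepsilon|x|^2$ is MPSH in a neighborhood of $p$. For $a\in b\mathbb D$, the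 *cluster set* $C(u,a)\subset M$ is the set of all limits in $M$ of sequences $u(z_k)$ with $z_k\in\mathbb D$, $z_k\to a$. **Statement.** Let $\rho$ be a strictly MPSH function on $M$, let $u:\mathbb D\to\{\rho>0\}$ be a conformal harmonic disc, and let $\gamma\subset b\mathbb D$ be a non-empty open arc such that for every $a\in\gamma$ the cluster set $C(u,a)$ is non-empty and contained in $\{\rho=0\}$. Then $u$ extends to a continuous map $\hat u:\mathbb D\cup\gamma\to M$ which is Hölder-$1/2$ continuous on every compact subset of $\mathbb D\cup\gamma$: for every compact $K\subset\mathbb D\cup\gamma$ there is a constant $C$ with $d_g(\hat u(z),\hat u(w))\le C\,|z-w|^{1/2}$ for all $z,w\in K$. -/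

import Mathlib

open Set Filter Topology Metric Manifold Bundle Laplacian InnerProductSpace
open scoped ContDiff NNReal ENNReal

noncomputable section

/-! ### The metric, the Christoffel symbols and normal coordinates in a chart -/

section Coordinates

variable {n : ℕ} {M : Type*} [TopologicalSpace M] [ChartedSpace (EuclideanSpace ℝ (Fin n)) M]
  [RiemannianBundle (fun p : M ↦ TangentSpace (𝓡 n) p)]

/-- The coordinate vector field `∂/∂xᵢ` of the chart `x`, at the point with coordinates `y`. -/
def coordVector (x : OpenPartialHomeomorph M (EuclideanSpace ℝ (Fin n)))
    (y : EuclideanSpace ℝ (Fin n)) (i : Fin n) : TangentSpace (𝓡 n) (x.symm y) :=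
  mfderiv (𝓡 n) (𝓡 n) x.symm y (EuclideanSpace.single i (1 : ℝ))

/-- The matrix `(g_ij)` of the Riemannian metric in the chart `x`, as a function of the
coordinates. -/
def chartMetric (x : OpenPartialHomeomorph M (EuclideanSpace ℝ (Fin n)))
    (y : EuclideanSpace ℝ (Fin n)) : Matrix (Fin n) (Fin n) ℝ :=
  Matrix.of fun i j ↦ inner ℝ (coordVector x y i) (coordVector x y j)

/-- The partial derivative `∂ g_ij / ∂x_l` in the chart `x`. -/
def chartMetricDeriv (x : OpenPartialHomeomorph M (EuclideanSpace ℝ (Fin n)))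
    (y : EuclideanSpace ℝ (Fin n)) (l i j : Fin n) : ℝ :=
  fderiv ℝ (fun y' ↦ chartMetric x y' i j) y (EuclideanSpace.single l (1 : ℝ))

/-- The Christoffel symbol
`Γᵏ_ij = (1/2) ∑_l gᵏˡ (∂_i g_jl + ∂_j g_il - ∂_l g_ij)` in the chart `x`. -/
def christoffel (x : OpenPartialHomeomorph M (EuclideanSpace ℝ (Fin n)))
    (y : EuclideanSpace ℝ (Fin n)) (k i j : Fin n) : ℝ :=
  (1 / 2) * ∑ l, (chartMetric x y)⁻¹ k l *
    (chartMetricDeriv x y i j l + chartMetricDeriv x y j i l - chartMetricDeriv x y l i j)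

/-- `x` is a system of (smooth) normal coordinates centered at `p`: the coordinates of `p` are `0`,
the coordinate vectors are orthonormal at `p`, and the coordinate image is star-shaped about `0`
with all its radial segments `t ↦ t y` being geodesics (the geodesic equation for `t ↦ t y` reads
`∑ Γᵏ_ij(t y) y_i y_j = 0`). In other words, `x⁻¹` is the exponential map at `p`, read in an
orthonormal basis of the tangent space. -/
structure IsNormalChart (x : OpenPartialHomeomorph M (EuclideanSpace ℝ (Fin n))) (p : M) :
    Prop where
  mem_atlas : x ∈ IsManifold.maximalAtlas (𝓡 n) ∞ M
  mem_source : p ∈ x.source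
  map_center : x p = 0
  starConvex : StarConvex ℝ 0 x.target
  metric_center : chartMetric x 0 = 1
  radial_geodesic : ∀ y ∈ x.target, ∀ k : Fin n,
    ∑ i, ∑ j, christoffel x y k i j * y i * y j = 0

/-! ### Conformal harmonic discs -/

/-- The map `u` is smooth on the unit disc and satisfies there the Euler-Lagrange equations of the
energy, i.e. in every smooth chart
`Δuᵏ + ∑ Γᵏ_ij(u) (∂_x uⁱ ∂_x uʲ + ∂_y uⁱ ∂_y uʲ) = 0`. -/
def IsHarmonicDisc (u : ℂ → M) : Prop :=
  ContMDiffOn 𝓘(ℝ, ℂ) (𝓡 n) ∞ u (ball 0 1) ∧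
  ∀ x ∈ IsManifold.maximalAtlas (𝓡 n) ∞ M, ∀ z ∈ ball (0 : ℂ) 1, u z ∈ x.source →
    ∀ k : Fin n,
      Δ (fun w : ℂ ↦ x (u w) k) z +
        ∑ i, ∑ j, christoffel x (x (u z)) k i j *
          (fderiv ℝ (fun w : ℂ ↦ x (u w) i) z 1 * fderiv ℝ (fun w : ℂ ↦ x (u w) j) z 1 +
            fderiv ℝ (fun w : ℂ ↦ x (u w) i) z Complex.I *
              fderiv ℝ (fun w : ℂ ↦ x (u w) j) z Complex.I) = 0

/-- The pull-back of the metric by `u` is, at each point of the unit disc, a multiple of the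
Euclidean metric (the multiple may vanish, at the singular points of `u`). -/
def IsConformalDisc (u : ℂ → M) : Prop :=
  ∀ z ∈ ball (0 : ℂ) 1, ∃ c : ℝ, ∀ v w : ℂ,
    inner ℝ (mfderiv 𝓘(ℝ, ℂ) (𝓡 n) u z v : TangentSpace (𝓡 n) (u z))
      (mfderiv 𝓘(ℝ, ℂ) (𝓡 n) u z w : TangentSpace (𝓡 n) (u z)) = c * inner ℝ v w

/-- Conformal harmonic discs (only the values on the unit disc matter). -/
def IsConformalHarmonicDisc (u : ℂ → M) : Prop :=
  IsHarmonicDisc (n := n) u ∧ IsConformalDisc (n := n) u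

/-- Conformal harmonic immersed discs. -/
def IsConformalHarmonicImmersedDisc (u : ℂ → M) : Prop :=
  IsConformalHarmonicDisc (n := n) u ∧
  ∀ z ∈ ball (0 : ℂ) 1, Function.Injective (mfderiv 𝓘(ℝ, ℂ) (𝓡 n) u z)

/-! ### Minimal plurisubharmonic functions -/

/-- Subharmonic functions with values in `[-∞, ∞)` on an open subset `s` of the plane: upper
semicontinuous functions which, on each closed disc in `s`, lie below every harmonic function
that dominates them on the boundary circle. -/
def SubharmonicOn (f : ℂ → EReal) (s : Set ℂ) : Prop :=
  UpperSemicontinuousOn f s ∧ (∀ z ∈ s, f z ≠ ⊤) ∧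
  ∀ (c : ℂ) (r : ℝ), 0 < r → closedBall c r ⊆ s →
    ∀ h : ℂ → ℝ, ContinuousOn h (closedBall c r) → HarmonicOnNhd h (ball c r) →
      (∀ z ∈ sphere c r, f z ≤ (h z : EReal)) → ∀ z ∈ ball c r, f z ≤ (h z : EReal)

variable (n) in
/-- `f` is minimal plurisubharmonic (MPSH) on the open set `U`: it is upper semicontinuous with
values in `[-∞, ∞)`, and its composition with every conformal harmonic immersed disc in `U` is
subharmonic on the unit disc. -/
def IsMPSHOn (f : M → EReal) (U : Set M) : Prop :=
  UpperSemicontinuousOn f U ∧ (∀ q ∈ U, f q ≠ ⊤) ∧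
  ∀ u : ℂ → M, IsConformalHarmonicImmersedDisc (n := n) u → MapsTo u (ball 0 1) U →
    SubharmonicOn (f ∘ u) (ball 0 1)

variable (n) in
/-- `ρ` is strictly MPSH on `M`: it is of class `C²` and each point `p` is the center of normal
coordinates `x` such that `ρ - ε |x|²` is MPSH near `p` for some `ε > 0`. -/
def IsStrictlyMPSH (ρ : M → ℝ) : Prop :=
  ContMDiff (𝓡 n) 𝓘(ℝ, ℝ) 2 ρ ∧
  ∀ p : M, ∃ x : OpenPartialHomeomorph M (EuclideanSpace ℝ (Fin n)), IsNormalChart x p ∧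
    ∃ ε : ℝ, 0 < ε ∧ ∃ U : Set M, IsOpen U ∧ p ∈ U ∧ U ⊆ x.source ∧
      IsMPSHOn n (fun q ↦ ((ρ q - ε * ‖x q‖ ^ 2 : ℝ) : EReal)) U

end Coordinates

/-! ### Boundary arcs and cluster sets -/

/-- The open arc of the unit circle swept by the angles in `(α, β)`. -/
def openArc (α β : ℝ) : Set ℂ :=
  (fun θ : ℝ ↦ Complex.exp (θ * Complex.I)) '' Ioo α β

/-- The cluster set of `u` at the boundary point `a` of the unit disc: all limits of `u z_k` along
sequences `z_k → a` in the disc. -/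
def clusterSet {M : Type*} [TopologicalSpace M] (u : ℂ → M) (a : ℂ) : Set M :=
  {q : M | ∃ z : ℕ → ℂ, (∀ k, z k ∈ ball (0 : ℂ) 1) ∧ Tendsto z atTop (𝓝 a) ∧
    Tendsto (fun k ↦ u (z k)) atTop (𝓝 q)}

end

/-! Fix a point a of the arc and a cluster point q of u at a. In a normal chart at q, let y be u in
coordinates and s = ρ ∘ u > 0. Strict MPSH, tested on small affine reparametrizations of u, gives Δs
≥ ε|∇y|² as long as u is near q; harmonicity gives |Δy| ≤ C|∇y|²; and y is conformal for the metric
G at the point y (`IsStrictlyMPSH.exists_isAdaptedChart`). Everything else near the boundary is a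
planar argument from these inequalities, abstracted in `IsPlanarData`. The main difficulty is that u
is not known beforehand to remain in the chart.

Two maximum principles carry the proof. One is a Hopf-type comparison: with p = y(z₀) and N = G_p(y
- p, y - p), the function s - ε'N is subharmonic, and comparing it with a linear function vanishing
at z₀/|z₀| gives s ≤ K(1 - |z|) near a (`IsPlanarData.exists_le_mul_boundary_dist`).

The other is a gradient bound. Put d = 1 - |z₀|. Conformality makes log N subharmonic up to errors:
log N + 48C√N has Laplacian at least -192C²|∇y|². The term (A/d)(s - ε'N) absorbs this defect, and
on |z - z₀| ≤ d/2 it is bounded above by the Hopf estimate. The weight (r/|z - z₀|)² has a pole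
cancelling the zero of N at z₀, so the maximum principle yields N ≤ const · |z - z₀|²/d, that is,
|∇y| of order d^(-1/2). To cope with discs that leave the chart, this barrier is glued to a multiple
of the weight alone, which is defined everywhere and takes over where N lies between d and Kd. The
same estimate then shows that a disc of radius comparable to d about z₀ stays in the chart
(`IsPlanarData.barrier_estimate`, `IsPlanarData.exists_norm_sub_sq_le`).

A gradient bound d^(-1/2) integrates to Hölder continuity of exponent 1/2 along paths that go
radially inward to depth |z - w|, across, and outward again (`IsPlanarData.propagate`,
`IsPlanarData.holder_of_local`). Such paths start at a point of the disc mapped close to q, so a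
whole half-neighbourhood of a is mapped into the chart. The Hölder bound produces the limit at a,
and compactness globalizes the local bounds (`exists_extension_holderOnWith`). -/

/-! ### Second-order jets along lines and the Laplacian in the plane -/

section Jets

variable {F : Type*} [NormedAddCommGroup F] [NormedSpace ℝ F]
  {G : Type*} [NormedAddCommGroup G] [NormedSpace ℝ G]

/-- The curve `f` is differentiable near `0`, twice differentiable at `0`, with first and second
derivatives `a` and `b` there. -/
def HasJet (f : ℝ → F) (a b : F) : Prop :=
  ∃ f' : ℝ → F, (∀ᶠ t in 𝓝 (0 : ℝ), HasDerivAt f (f' t) t) ∧ f' 0 = a ∧ HasDerivAt f' b 0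

/-- At `z`, the map `f` has partial derivatives `a₁`, `a₂` and Laplacian `L`, all second
derivatives being taken along the two coordinate lines. -/
def HasLap (f : ℂ → F) (z : ℂ) (a₁ a₂ L : F) : Prop :=
  ∃ b₁ b₂ : F, HasJet (fun t : ℝ ↦ f (z + t • (1 : ℂ))) a₁ b₁ ∧
    HasJet (fun t : ℝ ↦ f (z + t • Complex.I)) a₂ b₂ ∧ b₁ + b₂ = L

namespace HasJet

theorem hasDerivAt {f : ℝ → F} {a b : F} (h : HasJet f a b) : HasDerivAt f a 0 := by
  obtain ⟨f', h1, h2, -⟩ := h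
  exact h2 ▸ h1.self_of_nhds

theorem congr {f g : ℝ → F} {a b : F} (h : HasJet f a b) (hfg : g =ᶠ[𝓝 0] f) :
    HasJet g a b := by
  obtain ⟨f', h1, h2, h3⟩ := h
  refine ⟨f', ?_, h2, h3⟩
  filter_upwards [h1, hfg.eventuallyEq_nhds] with t ht ht'
  exact ht.congr_of_eventuallyEq ht'

theorem unique {f : ℝ → F} {a b a' b' : F} (h : HasJet f a b) (h' : HasJet f a' b') :
    a = a' ∧ b = b' := by
  refine ⟨h.hasDerivAt.unique h'.hasDerivAt, ?_⟩
  obtain ⟨f', h1, h2, h3⟩ := h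
  obtain ⟨g', h1', h2', h3'⟩ := h'
  have : f' =ᶠ[𝓝 0] g' := by
    filter_upwards [h1, h1'] with t ht ht'
    exact ht.unique ht'
  exact h3.unique (h3'.congr_of_eventuallyEq this)

theorem const (c : F) : HasJet (fun _ ↦ c) 0 0 :=
  ⟨fun _ ↦ 0, Eventually.of_forall fun t ↦ hasDerivAt_const t c, rfl, hasDerivAt_const _ _⟩

theorem add {f g : ℝ → F} {a b a' b' : F} (h : HasJet f a b) (h' : HasJet g a' b') :
    HasJet (fun t ↦ f t + g t) (a + a') (b + b') := by
  obtain ⟨f', h1, h2, h3⟩ := h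
  obtain ⟨g', h1', h2', h3'⟩ := h'
  refine ⟨fun t ↦ f' t + g' t, ?_, by simp [h2, h2'], h3.add h3'⟩
  filter_upwards [h1, h1'] with t ht ht'
  exact ht.add ht'

theorem const_smul {f : ℝ → F} {a b : F} (c : ℝ) (h : HasJet f a b) :
    HasJet (fun t ↦ c • f t) (c • a) (c • b) := by
  obtain ⟨f', h1, h2, h3⟩ := h
  refine ⟨fun t ↦ c • f' t, ?_, by simp [h2], h3.const_smul c⟩
  filter_upwards [h1] with t ht
  exact ht.const_smul c

theorem clm {f : ℝ → F} {a b : F} (l : F →L[ℝ] G) (h : HasJet f a b) :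
    HasJet (fun t ↦ l (f t)) (l a) (l b) := by
  obtain ⟨f', h1, h2, h3⟩ := h
  refine ⟨fun t ↦ l (f' t), ?_, by simp [h2], l.hasFDerivAt.comp_hasDerivAt _ h3⟩
  filter_upwards [h1] with t ht
  exact l.hasFDerivAt.comp_hasDerivAt _ ht

theorem bilin {f : ℝ → F} {a b : F} (Q : F →L[ℝ] F →L[ℝ] ℝ) (hQ : ∀ v w, Q v w = Q w v)
    (h : HasJet f a b) :
    HasJet (fun t ↦ Q (f t) (f t)) (2 * Q (f 0) a) (2 * Q a a + 2 * Q (f 0) b) := by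
  have h0 := h.hasDerivAt
  obtain ⟨f', h1, h2, h3⟩ := h
  refine ⟨fun t ↦ 2 * Q (f t) (f' t), ?_, by simp [h2], ?_⟩
  · filter_upwards [h1] with t ht
    have := (Q.hasFDerivAt.comp_hasDerivAt t ht).clm_apply ht
    refine this.congr_deriv ?_
    simp only [Function.comp]
    rw [hQ (f' t) (f t)]; ring
  · have := ((Q.hasFDerivAt.comp_hasDerivAt (0 : ℝ) h0).clm_apply h3).const_mul 2
    refine this.congr_deriv ?_
    simp only [Function.comp, h2]
    ring

theorem comp_real {f : ℝ → ℝ} {a b : ℝ} (h : HasJet f a b) {φ φ' : ℝ → ℝ} {φ'' : ℝ}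
    (h₁ : ∀ᶠ s in 𝓝 (f 0), HasDerivAt φ (φ' s) s) (h₂ : HasDerivAt φ' φ'' (f 0)) :
    HasJet (fun t ↦ φ (f t)) (φ' (f 0) * a) (φ'' * a ^ 2 + φ' (f 0) * b) := by
  have h0 := h.hasDerivAt
  obtain ⟨f', h1, h2, h3⟩ := h
  refine ⟨fun t ↦ φ' (f t) * f' t, ?_, by simp [h2], ?_⟩
  · filter_upwards [h1, h0.continuousAt.eventually h₁] with t ht ht'
    exact ht'.comp t ht
  · refine ((h₂.comp (0 : ℝ) h0).mul h3).congr_deriv ?_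
    simp only [h2, Function.comp]; ring

theorem comp_smul {f : ℝ → F} {a b : F} (c : ℝ) (h : HasJet f a b) :
    HasJet (fun t ↦ f (c * t)) (c • a) (c ^ 2 • b) := by
  obtain ⟨f', h1, h2, h3⟩ := h
  have hc : Tendsto (fun t : ℝ ↦ c * t) (𝓝 0) (𝓝 0) := by
    have : ContinuousAt (fun t : ℝ ↦ c * t) 0 := by fun_prop
    simpa [ContinuousAt] using this
  have hd : ∀ t, HasDerivAt (fun t : ℝ ↦ c * t) c t := fun t ↦ by
    simpa using (hasDerivAt_id t).const_mul c
  refine ⟨fun t ↦ c • f' (c * t), ?_, by simp [h2], ?_⟩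
  · filter_upwards [hc.eventually h1] with t ht
    exact HasDerivAt.scomp t ht (hd t)
  · have h3' : HasDerivAt f' b (c * 0) := by simpa using h3
    have := (HasDerivAt.scomp (0 : ℝ) h3' (hd 0)).const_smul c
    refine this.congr_deriv ?_
    rw [smul_smul, pow_two]

theorem comp_contDiffAt {f : ℝ → F} {a b : F} (h : HasJet f a b) {φ : F → G}
    (hφ : ContDiffAt ℝ 2 φ (f 0)) :
    HasJet (fun t ↦ φ (f t)) (fderiv ℝ φ (f 0) a)
      (fderiv ℝ (fderiv ℝ φ) (f 0) a a + fderiv ℝ φ (f 0) b) := by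
  have h0 := h.hasDerivAt
  obtain ⟨f', h1, h2, h3⟩ := h
  refine ⟨fun t ↦ fderiv ℝ φ (f t) (f' t), ?_, by simp [h2], ?_⟩
  · have : ∀ᶠ y in 𝓝 (f 0), DifferentiableAt ℝ φ y :=
      (hφ.eventually (by simp)).mono fun y hy ↦ hy.differentiableAt (by simp)
    filter_upwards [h1, h0.continuousAt.eventually this] with t ht ht'
    exact ht'.hasFDerivAt.comp_hasDerivAt t ht
  · have hd : DifferentiableAt ℝ (fderiv ℝ φ) (f 0) :=
      (hφ.fderiv_right (m := 1) (by norm_num)).differentiableAt (by simp)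
    refine ((hd.hasFDerivAt.comp_hasDerivAt (0 : ℝ) h0).clm_apply h3).congr_deriv ?_
    simp [h2]

/-- If b were positive, the second derivative test would make 0 a local minimum as well, so f would
be locally constant and b would vanish. -/
theorem nonpos_of_isLocalMax {f : ℝ → ℝ} {a b : ℝ} (h : HasJet f a b) (hmax : IsLocalMax f 0) :
    b ≤ 0 := by
  by_contra! hb
  have h0 := h.hasDerivAt
  obtain ⟨f', h1, h2, h3⟩ := h
  have ha : a = 0 := h0.deriv ▸ hmax.deriv_eq_zero
  have hd : deriv f =ᶠ[𝓝 0] f' := h1.mono fun t ht ↦ ht.deriv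
  have hdd : deriv (deriv f) 0 = b := (h3.congr_of_eventuallyEq hd).deriv
  have hmin : IsLocalMin f 0 := isLocalMin_of_deriv_deriv_pos (by rw [hdd]; exact hb)
    (by rw [h0.deriv, ha]) h0.continuousAt
  have hc : f =ᶠ[𝓝 0] fun _ ↦ f 0 := by
    filter_upwards [hmax, hmin] with t ht ht'
    exact le_antisymm ht ht'
  have h5 : deriv f =ᶠ[𝓝 0] fun _ ↦ 0 := by
    filter_upwards [hc.eventuallyEq_nhds] with t ht
    rw [ht.deriv_eq, deriv_const]
  rw [h5.deriv_eq, deriv_const] at hdd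
  exact hb.ne hdd

end HasJet

theorem HasJet.line (z v : F) : HasJet (fun t : ℝ ↦ z + t • v) v 0 :=
  ⟨fun _ ↦ v, Eventually.of_forall fun t ↦ by
    simpa using ((hasDerivAt_id t).smul_const v).const_add z, rfl, hasDerivAt_const _ _⟩

theorem ContDiffAt.hasJet_line {f : ℂ → F} {z : ℂ} (hf : ContDiffAt ℝ 2 f z) (v : ℂ) :
    HasJet (fun t : ℝ ↦ f (z + t • v)) (fderiv ℝ f z v) (iteratedFDeriv ℝ 2 f z ![v, v]) := by
  have h := (HasJet.line z v).comp_contDiffAt (φ := f) (by simpa using hf)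
  simpa [iteratedFDeriv_two_apply] using h

theorem ContDiffAt.hasLap {f : ℂ → F} {z : ℂ} (hf : ContDiffAt ℝ 2 f z) :
    HasLap f z (fderiv ℝ f z 1) (fderiv ℝ f z Complex.I) (Δ f z) :=
  ⟨_, _, hf.hasJet_line 1, hf.hasJet_line Complex.I, by
    rw [laplacian_eq_iteratedFDeriv_complexPlane]⟩

theorem tendsto_add_smul_zero (z v : ℂ) :
    Tendsto (fun t : ℝ ↦ z + t • v) (𝓝 0) (𝓝 z) := by
  have : ContinuousAt (fun t : ℝ ↦ z + t • v) 0 := by fun_prop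
  simpa [ContinuousAt] using this

namespace HasLap

theorem congr {f g : ℂ → F} {z : ℂ} {a₁ a₂ L : F} (h : HasLap f z a₁ a₂ L)
    (hfg : g =ᶠ[𝓝 z] f) : HasLap g z a₁ a₂ L := by
  obtain ⟨b₁, b₂, h1, h2, h3⟩ := h
  exact ⟨b₁, b₂, h1.congr ((tendsto_add_smul_zero z _).eventually hfg),
    h2.congr ((tendsto_add_smul_zero z _).eventually hfg), h3⟩

theorem congr_lap {f : ℂ → F} {z : ℂ} {a₁ a₂ L L' : F} (h : HasLap f z a₁ a₂ L) (e : L = L') :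
    HasLap f z a₁ a₂ L' := e ▸ h

/-- This is how Laplacians are computed: a jet assembled by the calculus rules is compared with the
one supplied by `ContDiffAt.hasLap`. -/
theorem unique {f : ℂ → F} {z : ℂ} {a₁ a₂ L a₁' a₂' L' : F} (h : HasLap f z a₁ a₂ L)
    (h' : HasLap f z a₁' a₂' L') : a₁ = a₁' ∧ a₂ = a₂' ∧ L = L' := by
  obtain ⟨b₁, b₂, h1, h2, rfl⟩ := h
  obtain ⟨b₁', b₂', h1', h2', rfl⟩ := h'
  refine ⟨(h1.unique h1').1, (h2.unique h2').1, ?_⟩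
  rw [(h1.unique h1').2, (h2.unique h2').2]

theorem const (c : F) (z : ℂ) : HasLap (fun _ ↦ c) z 0 0 0 :=
  ⟨0, 0, HasJet.const c, HasJet.const c, by simp⟩

theorem add {f g : ℂ → F} {z : ℂ} {a₁ a₂ L a₁' a₂' L' : F} (h : HasLap f z a₁ a₂ L)
    (h' : HasLap g z a₁' a₂' L') :
    HasLap (fun w ↦ f w + g w) z (a₁ + a₁') (a₂ + a₂') (L + L') := by
  obtain ⟨b₁, b₂, h1, h2, rfl⟩ := h
  obtain ⟨b₁', b₂', h1', h2', rfl⟩ := h'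
  exact ⟨_, _, h1.add h1', h2.add h2', by abel⟩

theorem const_smul {f : ℂ → F} {z : ℂ} {a₁ a₂ L : F} (c : ℝ) (h : HasLap f z a₁ a₂ L) :
    HasLap (fun w ↦ c • f w) z (c • a₁) (c • a₂) (c • L) := by
  obtain ⟨b₁, b₂, h1, h2, rfl⟩ := h
  exact ⟨_, _, h1.const_smul c, h2.const_smul c, by simp⟩

theorem const_mul {f : ℂ → ℝ} {z : ℂ} {a₁ a₂ L : ℝ} (c : ℝ) (h : HasLap f z a₁ a₂ L) :
    HasLap (fun w ↦ c * f w) z (c * a₁) (c * a₂) (c * L) := h.const_smul c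

theorem sub {f g : ℂ → F} {z : ℂ} {a₁ a₂ L a₁' a₂' L' : F} (h : HasLap f z a₁ a₂ L)
    (h' : HasLap g z a₁' a₂' L') :
    HasLap (fun w ↦ f w - g w) z (a₁ - a₁') (a₂ - a₂') (L - L') := by
  simpa [sub_eq_add_neg] using h.add (h'.const_smul (-1))

theorem clm {f : ℂ → F} {z : ℂ} {a₁ a₂ L : F} (l : F →L[ℝ] G) (h : HasLap f z a₁ a₂ L) :
    HasLap (fun w ↦ l (f w)) z (l a₁) (l a₂) (l L) := by
  obtain ⟨b₁, b₂, h1, h2, rfl⟩ := h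
  exact ⟨_, _, h1.clm l, h2.clm l, by simp⟩

theorem bilin {f : ℂ → F} {z : ℂ} {a₁ a₂ L : F} (Q : F →L[ℝ] F →L[ℝ] ℝ)
    (hQ : ∀ v w, Q v w = Q w v) (h : HasLap f z a₁ a₂ L) :
    HasLap (fun w ↦ Q (f w) (f w)) z (2 * Q (f z) a₁) (2 * Q (f z) a₂)
      (2 * (Q a₁ a₁ + Q a₂ a₂) + 2 * Q (f z) L) := by
  obtain ⟨b₁, b₂, h1, h2, rfl⟩ := h
  have h1' := h1.bilin Q hQ
  have h2' := h2.bilin Q hQ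
  simp only [zero_smul, add_zero] at h1' h2'
  exact ⟨_, _, h1', h2', by simp only [map_add]; ring⟩

theorem comp_real {f : ℂ → ℝ} {z : ℂ} {a₁ a₂ L : ℝ} (h : HasLap f z a₁ a₂ L)
    {φ φ' : ℝ → ℝ} {φ'' : ℝ} (h₁ : ∀ᶠ s in 𝓝 (f z), HasDerivAt φ (φ' s) s)
    (h₂ : HasDerivAt φ' φ'' (f z)) :
    HasLap (fun w ↦ φ (f w)) z (φ' (f z) * a₁) (φ' (f z) * a₂)
      (φ'' * (a₁ ^ 2 + a₂ ^ 2) + φ' (f z) * L) := by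
  obtain ⟨b₁, b₂, h1, h2, rfl⟩ := h
  have h1' := h1.comp_real (φ := φ) (φ' := φ') (φ'' := φ'') (by simpa using h₁) (by simpa using h₂)
  have h2' := h2.comp_real (φ := φ) (φ' := φ') (φ'' := φ'') (by simpa using h₁) (by simpa using h₂)
  simp only [zero_smul, add_zero] at h1' h2'
  exact ⟨_, _, h1', h2', by ring⟩

theorem comp_contDiffAt {f : ℂ → F} {z : ℂ} {a₁ a₂ L : F} (h : HasLap f z a₁ a₂ L) {φ : F → G}
    (hφ : ContDiffAt ℝ 2 φ (f z)) :
    HasLap (fun w ↦ φ (f w)) z (fderiv ℝ φ (f z) a₁) (fderiv ℝ φ (f z) a₂)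
      (fderiv ℝ (fderiv ℝ φ) (f z) a₁ a₁ + fderiv ℝ (fderiv ℝ φ) (f z) a₂ a₂ +
        fderiv ℝ φ (f z) L) := by
  obtain ⟨b₁, b₂, h1, h2, rfl⟩ := h
  have h1' := h1.comp_contDiffAt (φ := φ) (by simpa using hφ)
  have h2' := h2.comp_contDiffAt (φ := φ) (by simpa using hφ)
  simp only [zero_smul, add_zero] at h1' h2'
  exact ⟨_, _, h1', h2', by simp only [map_add]; abel⟩

theorem comp_affine {f : ℂ → F} {z c : ℂ} {s : ℝ} {a₁ a₂ L : F}
    (h : HasLap f (c + s • z) a₁ a₂ L) :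
    HasLap (fun w ↦ f (c + s • w)) z (s • a₁) (s • a₂) (s ^ 2 • L) := by
  obtain ⟨b₁, b₂, h1, h2, rfl⟩ := h
  refine ⟨_, _, (h1.comp_smul s).congr ?_, (h2.comp_smul s).congr ?_, by simp⟩ <;>
  · refine Eventually.of_forall fun t ↦ ?_
    simp only [smul_add, mul_smul, add_assoc]

theorem nonpos_of_isLocalMax {f : ℂ → ℝ} {z : ℂ} {a₁ a₂ L : ℝ} (h : HasLap f z a₁ a₂ L)
    (hmax : IsLocalMax f z) : L ≤ 0 := by
  obtain ⟨b₁, b₂, h1, h2, rfl⟩ := h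
  have key : ∀ v : ℂ, IsLocalMax (fun t : ℝ ↦ f (z + t • v)) 0 := fun v ↦ by
    have := (tendsto_add_smul_zero z v).eventually hmax
    simpa [IsLocalMax, IsMaxFilter] using this
  exact add_nonpos (h1.nonpos_of_isLocalMax (key _)) (h2.nonpos_of_isLocalMax (key _))

end HasLap

theorem hasLap_clm (l : ℂ →L[ℝ] F) (z : ℂ) : HasLap (fun w ↦ l w) z (l 1) (l Complex.I) 0 := by
  have h : HasLap (fun w : ℂ ↦ w) z 1 Complex.I 0 :=
    ⟨0, 0, HasJet.line z 1, HasJet.line z Complex.I, add_zero 0⟩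
  simpa using h.clm l

theorem HasLap.norm_sq {E : Type*} [NormedAddCommGroup E] [InnerProductSpace ℝ E] {f : ℂ → E}
    {z : ℂ} {a₁ a₂ L : E} (h : HasLap f z a₁ a₂ L) :
    HasLap (fun w ↦ ‖f w‖ ^ 2) z (2 * inner ℝ (f z) a₁) (2 * inner ℝ (f z) a₂)
      (2 * (‖a₁‖ ^ 2 + ‖a₂‖ ^ 2) + 2 * inner ℝ (f z) L) := by
  let Q : E →L[ℝ] E →L[ℝ] ℝ := innerSL ℝ
  have hQ : ∀ v, Q v v = ‖v‖ ^ 2 := fun v ↦ real_inner_self_eq_norm_sq v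
  have h2 := h.bilin Q (fun v w ↦ real_inner_comm _ _)
  simp only [hQ] at h2
  exact h2

theorem hasLap_mul_norm_sub_sq (c : ℝ) (z₀ z : ℂ) :
    ∃ a₁ a₂, HasLap (fun w : ℂ ↦ c * ‖w - z₀‖ ^ 2) z a₁ a₂ (4 * c) := by
  have h1 := (hasLap_clm (ContinuousLinearMap.id ℝ ℂ) z).sub (HasLap.const z₀ z)
  exact ⟨_, _, (h1.norm_sq.const_mul c).congr_lap (by simp; ring)⟩

theorem hasLap_log_norm_sub {z₀ z : ℂ} (hz : z ≠ z₀) :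
    ∃ a₁ a₂, HasLap (fun w : ℂ ↦ Real.log ‖w - z₀‖) z a₁ a₂ 0 := by
  have h : HarmonicAt (fun w : ℂ ↦ Real.log ‖w - z₀‖) z :=
    AnalyticAt.harmonicAt_log_norm (by fun_prop) (sub_ne_zero.mpr hz)
  have h1 := h.1.hasLap
  rw [h.2.self_of_nhds] at h1
  exact ⟨_, _, h1⟩

theorem HasLap.isHarmonic {f : ℂ → ℝ} (hf : ContDiff ℝ 2 f)
    (h : ∀ z, ∃ a₁ a₂, HasLap f z a₁ a₂ 0) (s : Set ℂ) : HarmonicOnNhd f s := fun z _ ↦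
  ⟨hf.contDiffAt, Eventually.of_forall fun w ↦ by
    obtain ⟨a₁, a₂, hw⟩ := h w
    exact (hf.contDiffAt.hasLap.unique hw).2.2⟩

/-- If L = Δf(0) < 0, subtracting (L/4)|w|² from the second-order Taylor polynomial gives a harmonic
h₀ with h₀(0) = f(0). On a small circle f - h₀ is close to (L/4)r², hence at most (L/8)r², and the
sub-mean inequality at the centre is violated. -/
theorem laplacian_nonneg_of_subharmonicOn {f : ℂ → ℝ} (hf : ContDiffAt ℝ 2 f 0)
    (h : SubharmonicOn (fun z ↦ (f z : EReal)) (ball 0 1)) : 0 ≤ Δ f 0 := by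
  by_contra! hL
  set L := Δ f 0 with hLdef
  set A := fderiv ℝ f 0
  set B := fderiv ℝ (fderiv ℝ f) 0
  have hB : ∀ v w, B v w = B w v := fun v w ↦ (hf.isSymmSndFDerivAt (by simp)).eq v w
  have hBL : B 1 1 + B Complex.I Complex.I = L := by
    rw [hLdef, laplacian_eq_iteratedFDeriv_complexPlane]
    simp [iteratedFDeriv_two_apply, B]
  set h₀ : ℂ → ℝ := fun w ↦ f 0 + A w + (1 / 2) * B w w - (L / 4) * ‖w‖ ^ 2 with hh₀
  have hc : ContDiff ℝ 2 h₀ := by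
    have h1 : ContDiff ℝ 2 (fun w : ℂ ↦ B w w) := B.contDiff.clm_apply contDiff_id
    have h2 : ContDiff ℝ 2 (fun w : ℂ ↦ ‖w‖ ^ 2) := contDiff_id.norm_sq ℝ
    fun_prop
  have hl : ∀ z, ∃ a₁ a₂, HasLap h₀ z a₁ a₂ 0 := fun z ↦ by
    obtain ⟨c₁, c₂, h3⟩ := hasLap_mul_norm_sub_sq (L / 4) 0 z
    have h2 := ((hasLap_clm (ContinuousLinearMap.id ℝ ℂ) z).bilin B hB).const_mul (1 / 2)
    have h4 := (((HasLap.const (f 0) z).add (hasLap_clm A z)).add h2).sub h3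
    exact ⟨_, _, (h4.congr (Eventually.of_forall fun w ↦ by simp [hh₀])).congr_lap (by
      simp only [ContinuousLinearMap.id_apply, map_zero, hBL]; ring)⟩
  have hdiff : HasFDerivAt (fderiv ℝ f) B 0 :=
    ((hf.fderiv_right (m := 1) (by norm_num)).differentiableAt (by simp)).hasFDerivAt
  have hsmall := (hdiff.isLittleO.def (c := -L / 4) (by linarith))
  have hdf : ∀ᶠ w in 𝓝 (0 : ℂ), DifferentiableAt ℝ f w :=
    (hf.eventually (by simp)).mono fun y hy ↦ hy.differentiableAt (by simp)
  obtain ⟨δ, hδ, hball⟩ := Metric.eventually_nhds_iff_ball.1 (hsmall.and hdf)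
  set r := min (δ / 2) (1 / 2) with hr
  have hr0 : 0 < r := by positivity
  have hrδ : r < δ := (min_le_left _ _).trans_lt (by linarith)
  have hr1 : r < 1 := (min_le_right _ _).trans_lt (by norm_num)
  have hsub := h.2.2 0 r hr0 (closedBall_subset_ball hr1) (fun w ↦ h₀ w - (-L / 8) * r ^ 2)
    (hc.continuous.sub continuous_const).continuousOn
    (HasLap.isHarmonic (hc.sub contDiff_const) (fun z ↦ by
      obtain ⟨a₁, a₂, hz⟩ := hl z
      exact ⟨_, _, by simpa using hz.sub (HasLap.const ((-L / 8) * r ^ 2) z)⟩) _) ?_ 0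
    (mem_ball_self hr0)
  · have : f 0 ≤ h₀ 0 - (-L / 8) * r ^ 2 := EReal.coe_le_coe_iff.1 hsub
    simp only [hh₀, map_zero, norm_zero] at this
    nlinarith [pow_pos hr0 2]
  · intro w hw
    have hwr : ‖w‖ = r := by simpa using hw
    refine EReal.coe_le_coe_iff.2 ?_
    have hder : ∀ t ∈ Icc (0 : ℝ) 1, HasDerivAt
        (fun t : ℝ ↦ f (t • w) - h₀ (t • w) + (-L / 8) * (t ^ 2 * r ^ 2))
        (fderiv ℝ f (t • w) w - (A w + t * B w w - (L / 4) * (2 * t * r ^ 2)) +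
          (-L / 8) * (2 * t * r ^ 2)) t := by
      intro t ht
      have hmem : t • w ∈ ball (0 : ℂ) δ := by
        rw [mem_ball_zero_iff, norm_smul, hwr, Real.norm_of_nonneg ht.1]
        nlinarith [ht.2]
      have h1 : HasDerivAt (fun t : ℝ ↦ f (t • w)) (fderiv ℝ f (t • w) w) t := by
        have h1 := ((hball _ hmem).2.hasFDerivAt).comp_hasDerivAt t
          ((hasDerivAt_id t).smul_const w)
        simpa using! h1
      have h2 : HasDerivAt (fun t : ℝ ↦ h₀ (t • w)) (A w + t * B w w - (L / 4) * (2 * t * r ^ 2))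
          t := by
        have e : (fun t : ℝ ↦ h₀ (t • w)) = fun t : ℝ ↦
            f 0 + t * A w + (1 / 2) * (t ^ 2 * B w w) - (L / 4) * (t ^ 2 * r ^ 2) := by
          ext t
          simp only [hh₀, map_smul, _root_.smul_apply, smul_eq_mul, norm_smul, hwr,
            mul_pow, Real.norm_eq_abs, sq_abs]
          ring
        rw [e]
        have h3 : HasDerivAt (fun t : ℝ ↦ t ^ 2) (2 * t) t := by simpa using hasDerivAt_pow 2 t
        have h4 := ((((hasDerivAt_id t).mul_const (A w)).const_add (f 0)).add
          ((h3.mul_const (B w w)).const_mul (1 / 2))).sub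
          ((h3.mul_const (r ^ 2)).const_mul (L / 4))
        refine h4.congr_deriv ?_
        ring
      have h3 : HasDerivAt (fun t : ℝ ↦ t ^ 2) (2 * t) t := by simpa using hasDerivAt_pow 2 t
      exact (h1.sub h2).add ((h3.mul_const (r ^ 2)).const_mul (-L / 8))
    -- Only differentiability of the derivative at 0 is used: the Taylor estimate on the circle
    -- comes from monotonicity along the radius. The tolerance -L/4 in `hsmall` is exactly what
    -- makes the radial derivative nonpositive.
    have hanti : AntitoneOn (fun t : ℝ ↦ f (t • w) - h₀ (t • w) + (-L / 8) * (t ^ 2 * r ^ 2))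
        (Icc 0 1) := by
      refine antitoneOn_of_deriv_nonpos (convex_Icc 0 1)
        (fun t ht ↦ (hder t ht).continuousAt.continuousWithinAt)
        (fun t ht ↦ (hder t (interior_subset ht)).differentiableAt.differentiableWithinAt) ?_
      intro t ht
      have ht' := interior_subset ht
      rw [(hder t ht').deriv]
      have hmem : t • w ∈ ball (0 : ℂ) δ := by
        rw [mem_ball_zero_iff, norm_smul, hwr, Real.norm_of_nonneg ht'.1]
        nlinarith [ht'.2]
      have h5 := (hball _ hmem).1
      rw [sub_zero] at h5
      have h6 := ((fderiv ℝ f (t • w) - A - B (t • w)).le_opNorm w).trans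
        (mul_le_mul_of_nonneg_right h5 (norm_nonneg w))
      have h7 := (le_abs_self _).trans h6
      simp only [_root_.sub_apply, map_smul, _root_.smul_apply,
        smul_eq_mul, norm_smul, hwr, Real.norm_of_nonneg ht'.1] at h7
      nlinarith
    have h8 := hanti (left_mem_Icc.2 zero_le_one) (right_mem_Icc.2 zero_le_one) zero_le_one
    simp only [one_smul, zero_smul] at h8
    have h9 : h₀ 0 = f 0 := by simp [hh₀]
    rw [h9] at h8
    linarith

end Jets

set_option synthInstance.maxHeartbeats 200000

theorem ContDiffOn.sum_smul_const {ι E F : Type*} [Fintype ι] [NormedAddCommGroup E]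
    [NormedSpace ℝ E] [NormedAddCommGroup F] [NormedSpace ℝ F] {f : ι → ι → E → ℝ} {s : Set E}
    {k : ℕ∞ω} (hf : ∀ i j, ContDiffOn ℝ k (f i j) s) (c : ι → ι → F) :
    ContDiffOn ℝ k (fun y ↦ ∑ i, ∑ j, f i j y • c i j) s :=
  ContDiffOn.sum fun i _ ↦ ContDiffOn.sum fun j _ ↦ (hf i j).smul contDiffOn_const

theorem ContinuousAt.eventually_norm_sub_lt {E F : Type*} [TopologicalSpace E]
    [SeminormedAddCommGroup F] {f : E → F} {x : E} (hf : ContinuousAt f x) {ε : ℝ} (hε : 0 < ε) :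
    ∀ᶠ y in 𝓝 x, ‖f y - f x‖ < ε := by
  filter_upwards [hf (Metric.ball_mem_nhds _ hε)] with y hy
  simpa [dist_eq_norm] using hy

/-! ### The metric and Christoffel symbols in a normal chart. -/

section Geometry

variable {n : ℕ} {M : Type*} [TopologicalSpace M] [ChartedSpace (EuclideanSpace ℝ (Fin n)) M]
  [RiemannianBundle (fun p : M ↦ TangentSpace (𝓡 n) p)]

/-- The Riemannian metric read in the chart `x`, as a bilinear form on the coordinate space. -/
noncomputable def chartForm (x : OpenPartialHomeomorph M (EuclideanSpace ℝ (Fin n)))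
    (p : EuclideanSpace ℝ (Fin n)) :
    EuclideanSpace ℝ (Fin n) →L[ℝ] EuclideanSpace ℝ (Fin n) →L[ℝ] ℝ :=
  ∑ i, ∑ j, chartMetric x p i j •
    (EuclideanSpace.proj (𝕜 := ℝ) i).smulRight (EuclideanSpace.proj (𝕜 := ℝ) j)

theorem chartForm_apply (x : OpenPartialHomeomorph M (EuclideanSpace ℝ (Fin n)))
    (p v w : EuclideanSpace ℝ (Fin n)) :
    chartForm x p v w = inner ℝ (mfderiv (𝓡 n) (𝓡 n) x.symm p v : TangentSpace (𝓡 n) (x.symm p))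
      (mfderiv (𝓡 n) (𝓡 n) x.symm p w : TangentSpace (𝓡 n) (x.symm p)) := by
  have key : ∀ v : EuclideanSpace ℝ (Fin n),
      (mfderiv (𝓡 n) (𝓡 n) x.symm p v : TangentSpace (𝓡 n) (x.symm p)) =
        ∑ i, v i • coordVector x p i := fun v ↦ by
    have h : v = ∑ i, v i • EuclideanSpace.single i (1 : ℝ) := by
      ext j; simp [Pi.single_apply]
    conv_lhs => rw [h]
    erw [map_sum]
    refine Finset.sum_congr rfl fun i _ ↦ ?_
    erw [map_smul]
    rfl
  rw [key v, key w, sum_inner]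
  simp only [chartForm, _root_.sum_apply, inner_sum, inner_smul_left,
    inner_smul_right]
  refine Finset.sum_congr rfl fun i _ ↦ Finset.sum_congr rfl fun j _ ↦ ?_
  simp [chartMetric]
  ring

theorem chartForm_symm (x : OpenPartialHomeomorph M (EuclideanSpace ℝ (Fin n)))
    (p v w : EuclideanSpace ℝ (Fin n)) : chartForm x p v w = chartForm x p w v := by
  rw [chartForm_apply, chartForm_apply, real_inner_comm]

theorem IsNormalChart.zero_mem_target {x : OpenPartialHomeomorph M (EuclideanSpace ℝ (Fin n))}
    {p : M} (hx : IsNormalChart x p) : (0 : EuclideanSpace ℝ (Fin n)) ∈ x.target :=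
  hx.map_center ▸ x.map_source hx.mem_source

theorem IsNormalChart.chartForm_zero {x : OpenPartialHomeomorph M (EuclideanSpace ℝ (Fin n))}
    {p : M} (hx : IsNormalChart x p) (v : EuclideanSpace ℝ (Fin n)) :
    chartForm x 0 v v = ‖v‖ ^ 2 := by
  simp only [chartForm, hx.metric_center, _root_.sum_apply, _root_.smul_apply,
    ContinuousLinearMap.smulRight_apply, EuclideanSpace.norm_sq_eq]
  simp [Matrix.one_apply, pow_two]

variable [IsManifold (𝓡 n) ∞ M]
  [IsContMDiffRiemannianBundle (𝓡 n) ∞ (EuclideanSpace ℝ (Fin n))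
      (fun p : M ↦ TangentSpace (𝓡 n) p)]

theorem contDiffOn_chartMetric {x : OpenPartialHomeomorph M (EuclideanSpace ℝ (Fin n))}
    (hx : x ∈ IsManifold.maximalAtlas (𝓡 n) ∞ M) (i j : Fin n) :
    ContDiffOn ℝ ∞ (fun y ↦ chartMetric x y i j) x.target := by
  have h1 : ContMDiffOn (𝓡 n) (𝓡 n) ∞ x.symm x.target := contMDiffOn_symm_of_mem_maximalAtlas hx
  have key : ∀ i : Fin n, ContMDiffOn (𝓡 n) (𝓡 n).tangent ∞
      (fun y ↦ (⟨x.symm y, coordVector x y i⟩ : TangentBundle (𝓡 n) M)) x.target := fun i ↦ by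
    have h2 := h1.contMDiffOn_tangentMapWithin (m := ∞) (by simp)
      x.open_target.uniqueMDiffOn
    have h3 : ContMDiffOn (𝓡 n) (𝓡 n).tangent ∞ (fun y : EuclideanSpace ℝ (Fin n) ↦
        (⟨y, EuclideanSpace.single i (1 : ℝ)⟩ : TangentBundle (𝓡 n) (EuclideanSpace ℝ (Fin n))))
        x.target :=
      contMDiffOn_vectorSpace_iff_contDiffOn.2 contDiffOn_const
    refine (h2.comp h3 fun y hy ↦ hy).congr fun y hy ↦ ?_
    simp only [Function.comp, tangentMapWithin, coordVector]
    rw [mfderivWithin_of_isOpen x.open_target hy]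
  have := ContMDiffOn.inner_bundle (key i) (key j)
  exact contMDiffOn_iff_contDiffOn.1 this

theorem contDiffOn_chartForm {x : OpenPartialHomeomorph M (EuclideanSpace ℝ (Fin n))}
    (hx : x ∈ IsManifold.maximalAtlas (𝓡 n) ∞ M) : ContDiffOn ℝ ∞ (chartForm x) x.target := by
  exact ContDiffOn.sum_smul_const (fun i j ↦ contDiffOn_chartMetric hx i j) _

theorem continuousOn_chartMetricDeriv {x : OpenPartialHomeomorph M (EuclideanSpace ℝ (Fin n))}
    (hx : x ∈ IsManifold.maximalAtlas (𝓡 n) ∞ M) (l i j : Fin n) :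
    ContinuousOn (fun y ↦ chartMetricDeriv x y l i j) x.target :=
  ((contDiffOn_chartMetric hx i j).continuousOn_fderiv_of_isOpen x.open_target
    (by simp)).clm_apply continuousOn_const

theorem IsNormalChart.continuousAt_christoffel
    {x : OpenPartialHomeomorph M (EuclideanSpace ℝ (Fin n))}
    {p : M} (hx : IsNormalChart x p) (k i j : Fin n) :
    ContinuousAt (fun y ↦ christoffel x y k i j) 0 := by
  have h0 := x.open_target.mem_nhds hx.zero_mem_target
  have hM : ContinuousAt (chartMetric x) 0 :=
    continuousAt_pi.2 fun i ↦ continuousAt_pi.2 fun j ↦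
      ((contDiffOn_chartMetric hx.mem_atlas i j).continuousOn.continuousAt h0)
  have hD : ∀ l i j, ContinuousAt (fun y ↦ chartMetricDeriv x y l i j) 0 := fun l i j ↦
    (continuousOn_chartMetricDeriv hx.mem_atlas l i j).continuousAt h0
  -- Inversion is continuous through adjugate over determinant, the determinant being 1 at the
  -- centre.
  have hI : ContinuousAt (fun y ↦ (chartMetric x y)⁻¹) 0 := by
    simp only [Matrix.inv_def, Ring.inverse_eq_inv']
    have hdet : ContinuousAt (fun y ↦ (chartMetric x y).det) 0 :=
      (Continuous.matrix_det continuous_id).continuousAt.comp hM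
    have hadj : ContinuousAt (fun y ↦ (chartMetric x y).adjugate) 0 :=
      (Continuous.matrix_adjugate continuous_id).continuousAt.comp hM
    exact (hdet.inv₀ (by simp [hx.metric_center])).smul hadj
  have hI' : ∀ l, ContinuousAt (fun y ↦ (chartMetric x y)⁻¹ k l) 0 := fun l ↦
    continuousAt_pi.1 (continuousAt_pi.1 hI k) l
  unfold christoffel
  refine continuousAt_const.mul (tendsto_finsetSum _ fun l _ ↦ (hI' l).mul ?_)
  exact ((hD i j l).add (hD j i l)).sub (hD l i j)

/-- All bounds come from regularity at the centre, where the metric is the identity: closeness of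
the forms gives the factor 2, C¹ regularity the Lipschitz bound, and continuity the bound on the
Christoffel symbols. -/
theorem IsNormalChart.exists_metric_bounds
    {x : OpenPartialHomeomorph M (EuclideanSpace ℝ (Fin n))}
    {p : M} (hx : IsNormalChart x p) :
    ∃ C ≥ 0, ∃ R > 0, closedBall 0 R ⊆ x.target ∧
      (∀ y ∈ closedBall 0 R, ∀ v, ‖v‖ ^ 2 / 2 ≤ chartForm x y v v ∧
        chartForm x y v v ≤ 2 * ‖v‖ ^ 2) ∧
      (∀ y ∈ closedBall 0 R, ∀ y' ∈ closedBall 0 R,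
        ‖chartForm x y - chartForm x y'‖ ≤ C * ‖y - y'‖) ∧
      ∀ y ∈ closedBall 0 R, ∀ k i j, |christoffel x y k i j| ≤ C := by
  have h0 := x.open_target.mem_nhds hx.zero_mem_target
  have hG : ContDiffAt ℝ 1 (chartForm x) 0 :=
    ((contDiffOn_chartForm hx.mem_atlas).contDiffAt h0).of_le (by simp)
  obtain ⟨K, t, ht, hK⟩ := hG.exists_lipschitzOnWith
  have h1 : ∀ᶠ y in 𝓝 0, ‖chartForm x y - chartForm x 0‖ < 1 / 2 :=
    hG.continuousAt.eventually_norm_sub_lt (by norm_num)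
  have h2 : ∀ᶠ y in 𝓝 0, ∀ k i j,
      |christoffel x y k i j| < ∑ k, ∑ i, ∑ j, |christoffel x 0 k i j| + 1 := by
    simp only [eventually_all]
    intro k i j
    refine (hx.continuousAt_christoffel k i j).abs.eventually_lt_const ?_
    have e1 : |christoffel x 0 k i j| ≤ ∑ j, |christoffel x 0 k i j| :=
      Finset.single_le_sum (f := fun j ↦ |christoffel x 0 k i j|)
        (fun _ _ ↦ abs_nonneg _) (Finset.mem_univ j)
    have e2 : ∑ j, |christoffel x 0 k i j| ≤ ∑ i, ∑ j, |christoffel x 0 k i j| :=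
      Finset.single_le_sum (f := fun i ↦ ∑ j, |christoffel x 0 k i j|)
        (fun _ _ ↦ Finset.sum_nonneg fun _ _ ↦ abs_nonneg _) (Finset.mem_univ i)
    have e3 : ∑ i, ∑ j, |christoffel x 0 k i j| ≤ ∑ k, ∑ i, ∑ j, |christoffel x 0 k i j| :=
      Finset.single_le_sum (f := fun k ↦ ∑ i, ∑ j, |christoffel x 0 k i j|)
        (fun _ _ ↦ Finset.sum_nonneg fun _ _ ↦ Finset.sum_nonneg fun _ _ ↦ abs_nonneg _)
        (Finset.mem_univ k)
    linarith
  set S := ∑ k, ∑ i, ∑ j, |christoffel x 0 k i j| + 1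
  have hS : 0 ≤ S := by positivity
  obtain ⟨R, hR, hball⟩ := Metric.nhds_basis_closedBall.mem_iff.1
    (Filter.inter_mem (Filter.inter_mem h0 ht) (h1.and h2))
  refine ⟨max K S, le_max_of_le_right hS, R, hR, fun y hy ↦ (hball hy).1.1, fun y hy v ↦ ?_,
    fun y hy y' hy' ↦ ?_, fun y hy k i j ↦ ?_⟩
  · have h3 := (chartForm x y - chartForm x 0).le_opNorm₂ v v
    have h4 := (hball hy).2.1
    rw [_root_.sub_apply, _root_.sub_apply, hx.chartForm_zero, Real.norm_eq_abs] at h3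
    have h5 : |chartForm x y v v - ‖v‖ ^ 2| ≤ 1 / 2 * ‖v‖ ^ 2 := by
      refine h3.trans ?_
      rw [mul_assoc, ← pow_two]
      gcongr
    rw [abs_le] at h5
    constructor <;> nlinarith [sq_nonneg ‖v‖]
  · refine (hK.norm_sub_le (hball hy).1.2 (hball hy').1.2).trans ?_
    gcongr
    exact le_max_left _ _
  · exact ((hball hy).2.2 k i j).le.trans (le_max_right _ _)

end Geometry

/-! ### Differential inequalities for conformal harmonic discs in a chart. -/

section Discs

variable {n : ℕ}

theorem EuclideanSpace.norm_le_of_forall_abs_le {v : EuclideanSpace ℝ (Fin n)} {c : ℝ}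
    (h : ∀ k, |v k| ≤ c) : ‖v‖ ≤ n * c := by
  have h1 : v = ∑ i, v i • EuclideanSpace.single i (1 : ℝ) := by
    ext j; simp [Pi.single_apply]
  calc ‖v‖ ≤ ∑ i, ‖v i • EuclideanSpace.single i (1 : ℝ)‖ := by
        conv_lhs => rw [h1]
        exact norm_sum_le _ _
    _ ≤ ∑ _i : Fin n, c := by
        refine Finset.sum_le_sum fun i _ ↦ ?_
        simpa [norm_smul] using h i
    _ = n * c := by simp

theorem EuclideanSpace.abs_apply_le_norm (v : EuclideanSpace ℝ (Fin n)) (i : Fin n) :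
    |v i| ≤ ‖v‖ := by
  simpa using PiLp.norm_apply_le v i

theorem affine_mem_ball {z₀ ζ : ℂ} {s : ℝ} (hs : 0 < s) (hball : ball z₀ s ⊆ ball 0 1)
    (hζ : ζ ∈ ball (0 : ℂ) 1) : z₀ + s • ζ ∈ ball (0 : ℂ) 1 ∩ ball z₀ s := by
  have : z₀ + s • ζ ∈ ball z₀ s := by
    rw [mem_ball_iff_norm, add_sub_cancel_left, norm_smul, Real.norm_of_nonneg hs.le]
    have := mem_ball_zero_iff.1 hζ
    nlinarith
  exact ⟨hball this, this⟩

theorem laplacian_fderiv_comp_affine {f : ℂ → ℝ} {z₀ ζ : ℂ} {s : ℝ}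
    (hf : ContDiffAt ℝ 2 f (z₀ + s • ζ)) :
    fderiv ℝ (fun w ↦ f (z₀ + s • w)) ζ 1 = s * fderiv ℝ f (z₀ + s • ζ) 1 ∧
    fderiv ℝ (fun w ↦ f (z₀ + s • w)) ζ Complex.I = s * fderiv ℝ f (z₀ + s • ζ) Complex.I ∧
    Δ (fun w ↦ f (z₀ + s • w)) ζ = s ^ 2 * Δ f (z₀ + s • ζ) := by
  have h2 : ContDiffAt ℝ 2 (fun w : ℂ ↦ f (z₀ + s • w)) ζ :=
    ContDiffAt.comp ζ (g := f) (f := fun w : ℂ ↦ z₀ + s • w) hf (by fun_prop)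
  exact h2.hasLap.unique hf.hasLap.comp_affine

variable {M : Type*} [TopologicalSpace M]

theorem fderiv_chart_component {x : OpenPartialHomeomorph M (EuclideanSpace ℝ (Fin n))}
    {u : ℂ → M} {z : ℂ} (hy : ContDiffAt ℝ ∞ (fun w ↦ x (u w)) z) (i : Fin n) (v : ℂ) :
    fderiv ℝ (fun w ↦ x (u w) i) z v = fderiv ℝ (fun w ↦ x (u w)) z v i := by
  have h := ((EuclideanSpace.proj (𝕜 := ℝ) i).hasFDerivAt.comp z
    (hy.differentiableAt (by simp)).hasFDerivAt).fderiv
  exact congrArg (fun l ↦ l v) h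

variable [ChartedSpace (EuclideanSpace ℝ (Fin n)) M]

theorem ContMDiffAt.comp_chart {x : OpenPartialHomeomorph M (EuclideanSpace ℝ (Fin n))}
    (hx : x ∈ IsManifold.maximalAtlas (𝓡 n) ∞ M) {u : ℂ → M} {z : ℂ}
    (hu : ContMDiffAt 𝓘(ℝ, ℂ) (𝓡 n) ∞ u z) (hz : u z ∈ x.source) :
    ContDiffAt ℝ ∞ (fun w ↦ x (u w)) z :=
  contMDiffAt_iff_contDiffAt.1 ((contMDiffAt_of_mem_maximalAtlas hx hz).comp z hu)

theorem mfderiv_comp_affine {u : ℂ → M} {z₀ ζ : ℂ} {s : ℝ}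
    (hu : ContMDiffAt 𝓘(ℝ, ℂ) (𝓡 n) ∞ u (z₀ + s • ζ)) (v : ℂ) :
    mfderiv 𝓘(ℝ, ℂ) (𝓡 n) (fun ζ ↦ u (z₀ + s • ζ)) ζ v =
      s • mfderiv 𝓘(ℝ, ℂ) (𝓡 n) u (z₀ + s • ζ) v := by
  have hd : HasFDerivAt (fun w : ℂ ↦ z₀ + s • w) (s • ContinuousLinearMap.id ℝ ℂ) ζ :=
    ((hasFDerivAt_id ζ).const_smul s).const_add z₀
  have h := (hu.mdifferentiableAt (by simp)).hasMFDerivAt.comp ζ hd.hasMFDerivAt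
  have h' := h.mfderiv
  refine (congrArg (fun l ↦ l v) h').trans ?_
  exact ContinuousLinearMap.map_smul (mfderiv 𝓘(ℝ, ℂ) (𝓡 n) u (z₀ + s • ζ)) s v

variable [RiemannianBundle (fun p : M ↦ TangentSpace (𝓡 n) p)]

theorem inner_tangentSpace_congr {p q : M} (h : p = q) (v w : EuclideanSpace ℝ (Fin n)) :
    @inner ℝ (TangentSpace (𝓡 n) p) _ v w = @inner ℝ (TangentSpace (𝓡 n) q) _ v w := by
  subst h; rfl

theorem inner_mfderiv_eq_chartForm {x : OpenPartialHomeomorph M (EuclideanSpace ℝ (Fin n))}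
    (hx : x ∈ IsManifold.maximalAtlas (𝓡 n) ∞ M) {u : ℂ → M} {z : ℂ}
    (hu : ContMDiffAt 𝓘(ℝ, ℂ) (𝓡 n) ∞ u z) (hz : u z ∈ x.source) (v w : ℂ) :
    inner ℝ (mfderiv 𝓘(ℝ, ℂ) (𝓡 n) u z v : TangentSpace (𝓡 n) (u z))
      (mfderiv 𝓘(ℝ, ℂ) (𝓡 n) u z w : TangentSpace (𝓡 n) (u z)) =
    chartForm x (x (u z)) (fderiv ℝ (fun w ↦ x (u w)) z v) (fderiv ℝ (fun w ↦ x (u w)) z w) := by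
  have hy := hu.comp_chart hx hz
  have heq : u =ᶠ[𝓝 z] x.symm ∘ fun w ↦ x (u w) := by
    filter_upwards [hu.continuousAt (x.open_source.mem_nhds hz)] with w hw
    exact (x.left_inv hw).symm
  have h1 : mfderiv 𝓘(ℝ, ℂ) (𝓡 n) (x.symm ∘ fun w ↦ x (u w)) z =
      (mfderiv (𝓡 n) (𝓡 n) x.symm (x (u z))).comp
        (mfderiv 𝓘(ℝ, ℂ) (𝓡 n) (fun w ↦ x (u w)) z) :=
    mfderiv_comp z
      ((contMDiffAt_symm_of_mem_maximalAtlas hx (x.map_source hz)).mdifferentiableAt (by simp))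
      ((contMDiffAt_iff_contDiffAt.2 hy).mdifferentiableAt (by simp))
  have h2 := heq.mfderiv_eq (I := 𝓘(ℝ, ℂ)) (I' := 𝓡 n)
  rw [chartForm_apply]
  have h3 : ∀ v, (mfderiv 𝓘(ℝ, ℂ) (𝓡 n) u z v : EuclideanSpace ℝ (Fin n)) =
      mfderiv (𝓡 n) (𝓡 n) x.symm (x (u z)) (fderiv ℝ (fun w ↦ x (u w)) z v) := fun v ↦ by
    rw [← mfderiv_eq_fderiv]
    exact congrArg (fun l ↦ l v) (h2.trans h1)
  refine (inner_tangentSpace_congr (x.left_inv hz).symm _ _).trans ?_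
  erw [h3 v, h3 w]

theorem IsHarmonicDisc.contMDiffAt {u : ℂ → M} (hu : IsHarmonicDisc (n := n) u) {z : ℂ}
    (hz : z ∈ ball (0 : ℂ) 1) : ContMDiffAt 𝓘(ℝ, ℂ) (𝓡 n) ∞ u z :=
  hu.1.contMDiffAt (isOpen_ball.mem_nhds hz)

/-- The harmonic map equation expresses the Laplacian as a quadratic form in the gradient with
Christoffel coefficients. The double sum costs n², and passing from components to the norm another
n. -/
theorem IsHarmonicDisc.norm_laplacian_le {u : ℂ → M} (hu : IsHarmonicDisc (n := n) u)
    {x : OpenPartialHomeomorph M (EuclideanSpace ℝ (Fin n))}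
    (hx : x ∈ IsManifold.maximalAtlas (𝓡 n) ∞ M) {z : ℂ} (hz : z ∈ ball (0 : ℂ) 1)
    (hzx : u z ∈ x.source) {C : ℝ} (hC : ∀ k i j, |christoffel x (x (u z)) k i j| ≤ C) :
    ‖Δ (fun w ↦ x (u w)) z‖ ≤ n ^ 3 * C *
      (‖fderiv ℝ (fun w ↦ x (u w)) z 1‖ ^ 2 + ‖fderiv ℝ (fun w ↦ x (u w)) z Complex.I‖ ^ 2) := by
  have hy := (hu.contMDiffAt hz).comp_chart hx hzx
  set a := fderiv ℝ (fun w ↦ x (u w)) z 1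
  set b := fderiv ℝ (fun w ↦ x (u w)) z Complex.I
  have hab : ∀ i j, |a i * a j + b i * b j| ≤ ‖a‖ ^ 2 + ‖b‖ ^ 2 := fun i j ↦ by
    refine (abs_add_le _ _).trans (add_le_add ?_ ?_) <;>
    · rw [abs_mul, pow_two]
      gcongr <;> exact EuclideanSpace.abs_apply_le_norm _ _
  refine (EuclideanSpace.norm_le_of_forall_abs_le (c := n ^ 2 * C * (‖a‖ ^ 2 + ‖b‖ ^ 2))
    fun k ↦ ?_).trans_eq (by ring)
  have h1 := hu.2 x hx z hz hzx k
  have h2 : Δ (fun w ↦ x (u w) k) z = Δ (fun w ↦ x (u w)) z k :=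
    (hy.of_le ENat.LEInfty.out).laplacian_CLM_comp_left (l := EuclideanSpace.proj (𝕜 := ℝ) k)
  have h3 := fderiv_chart_component hy
  simp only [h3] at h1
  rw [h2] at h1
  rw [eq_neg_of_add_eq_zero_left h1, abs_neg]
  refine (Finset.abs_sum_le_sum_abs _ _).trans ?_
  calc _ ≤ ∑ _i : Fin n, ∑ _j : Fin n, C * (‖a‖ ^ 2 + ‖b‖ ^ 2) := by
        refine Finset.sum_le_sum fun i _ ↦ (Finset.abs_sum_le_sum_abs _ _).trans ?_
        refine Finset.sum_le_sum fun j _ ↦ ?_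
        rw [abs_mul]
        exact mul_le_mul (hC k i j) (hab i j) (abs_nonneg _) ((abs_nonneg _).trans (hC k i j))
    _ = _ := by simp; ring

/-- Both terms of the equation scale by s². Affine reparametrization is needed because MPSH
functions are tested only on maps of the whole unit disc. -/
theorem IsHarmonicDisc.comp_affine {u : ℂ → M} (hu : IsHarmonicDisc (n := n) u) {z₀ : ℂ} {s : ℝ}
    (hs : 0 < s) (hball : ball z₀ s ⊆ ball 0 1) :
    IsHarmonicDisc (n := n) fun ζ ↦ u (z₀ + s • ζ) := by
  constructor
  · refine hu.1.comp (t := ball (0 : ℂ) 1) (f := fun ζ : ℂ ↦ z₀ + s • ζ) ?_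
      fun ζ hζ ↦ (affine_mem_ball hs hball hζ).1
    exact ContDiff.contMDiff (by fun_prop) |>.contMDiffOn
  · intro x hx ζ hζ hζx k
    have hmem := (affine_mem_ball hs hball hζ).1
    have hy := (hu.contMDiffAt hmem).comp_chart hx hζx
    have hk : ∀ k, ContDiffAt ℝ 2 (fun w ↦ x (u w) k) (z₀ + s • ζ) := fun k ↦
      (EuclideanSpace.proj (𝕜 := ℝ) k).contDiff.contDiffAt.comp _ (hy.of_le ENat.LEInfty.out)
    have h1 := fun k ↦ (laplacian_fderiv_comp_affine (hk k)).1
    have h2 := fun k ↦ (laplacian_fderiv_comp_affine (hk k)).2.1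
    have h3 := fun k ↦ (laplacian_fderiv_comp_affine (hk k)).2.2
    have h4 := hu.2 x hx _ hmem hζx k
    simp only [h1, h2, h3]
    have h5 := congrArg (fun t ↦ s ^ 2 * t) h4
    simp only [mul_zero, mul_add, Finset.mul_sum] at h5
    rw [← h5]
    congr 1
    refine Finset.sum_congr rfl fun i _ ↦ Finset.sum_congr rfl fun j _ ↦ ?_
    ring

theorem IsConformalHarmonicDisc.comp_affine {u : ℂ → M}
    (hu : IsConformalHarmonicDisc (n := n) u) {z₀ : ℂ} {s : ℝ}
    (hs : 0 < s) (hball : ball z₀ s ⊆ ball 0 1)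
    (himm : ∀ z ∈ ball z₀ s, Function.Injective (mfderiv 𝓘(ℝ, ℂ) (𝓡 n) u z)) :
    IsConformalHarmonicImmersedDisc (n := n) fun ζ ↦ u (z₀ + s • ζ) := by
  refine ⟨⟨hu.1.comp_affine hs hball, fun ζ hζ ↦ ?_⟩, fun ζ hζ ↦ ?_⟩
  · have hmem := (affine_mem_ball hs hball hζ).1
    obtain ⟨c, hc⟩ := hu.2 _ hmem
    refine ⟨s ^ 2 * c, fun v w ↦ ?_⟩
    rw [mfderiv_comp_affine (hu.1.contMDiffAt hmem), mfderiv_comp_affine (hu.1.contMDiffAt hmem)]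
    rw [inner_smul_left, inner_smul_right, hc]
    simp; ring
  · have hmem := affine_mem_ball hs hball hζ
    intro v w hvw
    have hd := mfderiv_comp_affine (hu.1.contMDiffAt hmem.1)
    have hvw' := (hd v).symm.trans (hvw.trans (hd w))
    exact himm _ hmem.2 (smul_right_injective (EuclideanSpace ℝ (Fin n)) hs.ne' hvw')

theorem IsConformalDisc.exists_coeff {u : ℂ → M} (hu : IsConformalHarmonicDisc (n := n) u)
    {x : OpenPartialHomeomorph M (EuclideanSpace ℝ (Fin n))}
    (hx : x ∈ IsManifold.maximalAtlas (𝓡 n) ∞ M) {z : ℂ} (hz : z ∈ ball (0 : ℂ) 1)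
    (hzx : u z ∈ x.source) : ∃ c : ℝ, ∀ v w : ℂ,
    chartForm x (x (u z)) (fderiv ℝ (fun w ↦ x (u w)) z v) (fderiv ℝ (fun w ↦ x (u w)) z w) =
      c * inner ℝ v w := by
  obtain ⟨c, hc⟩ := hu.2 z hz
  refine ⟨c, fun v w ↦ ?_⟩
  rw [← inner_mfderiv_eq_chartForm hx (hu.1.contMDiffAt hz) hzx]
  exact hc v w

/-- A conformal differential is either zero or injective; one nonzero partial derivative makes the
conformal factor positive. -/
theorem IsConformalDisc.injective_mfderiv {u : ℂ → M} (hu : IsConformalHarmonicDisc (n := n) u)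
    {x : OpenPartialHomeomorph M (EuclideanSpace ℝ (Fin n))}
    (hx : x ∈ IsManifold.maximalAtlas (𝓡 n) ∞ M) {z : ℂ} (hz : z ∈ ball (0 : ℂ) 1)
    (hzx : u z ∈ x.source)
    (hpos : 0 < chartForm x (x (u z)) (fderiv ℝ (fun w ↦ x (u w)) z 1)
      (fderiv ℝ (fun w ↦ x (u w)) z 1)) :
    Function.Injective (mfderiv 𝓘(ℝ, ℂ) (𝓡 n) u z) := by
  obtain ⟨c, hc⟩ := exists_coeff hu hx hz hzx
  have hc0 : 0 < c := by
    have := hc 1 1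
    rw [this] at hpos
    simpa using hpos
  refine (injective_iff_map_eq_zero _).2 fun v hv ↦ ?_
  have h1 := (inner_mfderiv_eq_chartForm hx (hu.1.contMDiffAt hz) hzx v v).trans (hc v v)
  erw [hv] at h1
  rw [inner_zero_left] at h1
  have h2 : (inner ℝ (v : ℂ) (v : ℂ) : ℝ) = 0 := by
    rcases mul_eq_zero.1 h1.symm with h | h
    · exact absurd h hc0.ne'
    · exact h
  exact inner_self_eq_zero.1 h2

/-- A small disc around z, rescaled to the unit disc, is immersed and stays in U, so the defining
subharmonicity applies to it; the scaling multiplies the Laplacian by a positive factor. -/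
theorem IsMPSHOn.laplacian_comp_nonneg {U : Set M} (hU : IsOpen U) {f : M → ℝ}
    (hf : IsMPSHOn n (fun q ↦ (f q : EReal)) U) {u : ℂ → M}
    (hu : IsConformalHarmonicDisc (n := n) u) {z : ℂ} (hz : z ∈ ball (0 : ℂ) 1) (hzU : u z ∈ U)
    (himm : ∀ᶠ w in 𝓝 z, Function.Injective (mfderiv 𝓘(ℝ, ℂ) (𝓡 n) u w))
    (hfu : ContDiffAt ℝ 2 (fun w ↦ f (u w)) z) : 0 ≤ Δ (fun w ↦ f (u w)) z := by
  have h1 : ∀ᶠ w in 𝓝 z, w ∈ ball (0 : ℂ) 1 := isOpen_ball.mem_nhds hz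
  have h2 : ∀ᶠ w in 𝓝 z, u w ∈ U := (hu.1.contMDiffAt hz).continuousAt (hU.mem_nhds hzU)
  obtain ⟨s, hs, hball⟩ := Metric.eventually_nhds_iff_ball.1 (h1.and (h2.and himm))
  have hdisc := hu.comp_affine hs (fun w hw ↦ (hball w hw).1) fun w hw ↦ (hball w hw).2.2
  have hsub := hf.2.2 _ hdisc fun ζ hζ ↦
    (hball _ (affine_mem_ball hs (fun w hw ↦ (hball w hw).1) hζ).2).2.1
  have hfu' : ContDiffAt ℝ 2 (fun w ↦ f (u w)) (z + s • (0 : ℂ)) := by simpa using hfu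
  have hC : ContDiffAt ℝ 2 (fun w : ℂ ↦ f (u (z + s • w))) 0 :=
    ContDiffAt.comp 0 (g := fun w ↦ f (u w)) (f := fun w : ℂ ↦ z + s • w) hfu' (by fun_prop)
  have h3 := laplacian_nonneg_of_subharmonicOn hC hsub
  rw [(laplacian_fderiv_comp_affine hfu').2.2] at h3
  have h4 : Δ (fun w ↦ f (u w)) (z + s • (0 : ℂ)) = Δ (fun w ↦ f (u w)) z := by simp
  rw [h4] at h3
  exact nonneg_of_mul_nonneg_right h3 (by positivity)

theorem IsStrictlyMPSH.contDiffAt_comp {ρ : M → ℝ} (hρ : IsStrictlyMPSH n ρ) {u : ℂ → M} {z : ℂ}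
    (hu : ContMDiffAt 𝓘(ℝ, ℂ) (𝓡 n) ∞ u z) : ContDiffAt ℝ 2 (fun w ↦ ρ (u w)) z :=
  contMDiffAt_iff_contDiffAt.1 (hρ.1.contMDiffAt.comp z (hu.of_le ENat.LEInfty.out))

variable [IsManifold (𝓡 n) ∞ M]
  [IsContMDiffRiemannianBundle (𝓡 n) ∞ (EuclideanSpace ℝ (Fin n))
      (fun p : M ↦ TangentSpace (𝓡 n) p)]

/-- The properties of a chart `x` around `q` in which the metric has uniform bounds on the
coordinate ball of radius `R`, and in which conformal harmonic discs satisfy uniform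
differential inequalities. -/
structure IsAdaptedChart (ρ : M → ℝ) (x : OpenPartialHomeomorph M (EuclideanSpace ℝ (Fin n)))
    (q : M) (R C ε : ℝ) : Prop where
  mem_atlas : x ∈ IsManifold.maximalAtlas (𝓡 n) ∞ M
  mem_source : q ∈ x.source
  map_center : x q = 0
  R_pos : 0 < R
  C_nonneg : 0 ≤ C
  ε_pos : 0 < ε
  subset_target : closedBall 0 R ⊆ x.target
  form_bounds : ∀ y ∈ closedBall (0 : EuclideanSpace ℝ (Fin n)) R, ∀ v,
    ‖v‖ ^ 2 / 2 ≤ chartForm x y v v ∧ chartForm x y v v ≤ 2 * ‖v‖ ^ 2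
  form_lipschitz : ∀ y ∈ closedBall (0 : EuclideanSpace ℝ (Fin n)) R,
    ∀ y' ∈ closedBall (0 : EuclideanSpace ℝ (Fin n)) R,
    ‖chartForm x y - chartForm x y'‖ ≤ C * ‖y - y'‖
  conformal : ∀ u : ℂ → M, IsConformalHarmonicDisc (n := n) u → ∀ z ∈ ball (0 : ℂ) 1,
    u z ∈ x.source → ∃ c : ℝ, ∀ v w : ℂ,
    chartForm x (x (u z)) (fderiv ℝ (fun w ↦ x (u w)) z v) (fderiv ℝ (fun w ↦ x (u w)) z w) =
      c * inner ℝ v w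
  norm_laplacian_le : ∀ u : ℂ → M, IsConformalHarmonicDisc (n := n) u → ∀ z ∈ ball (0 : ℂ) 1,
    u z ∈ x.source → ‖x (u z)‖ ≤ R → ‖Δ (fun w ↦ x (u w)) z‖ ≤ C *
      (‖fderiv ℝ (fun w ↦ x (u w)) z 1‖ ^ 2 + ‖fderiv ℝ (fun w ↦ x (u w)) z Complex.I‖ ^ 2)
  le_laplacian : ∀ u : ℂ → M, IsConformalHarmonicDisc (n := n) u → ∀ z ∈ ball (0 : ℂ) 1,
    u z ∈ x.source → ‖x (u z)‖ < R → ε *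
      (‖fderiv ℝ (fun w ↦ x (u w)) z 1‖ ^ 2 + ‖fderiv ℝ (fun w ↦ x (u w)) z Complex.I‖ ^ 2) ≤
      Δ (fun w ↦ ρ (u w)) z

/-- The MPSH condition speaks only of immersed discs, while u may have branch points. There
conformality kills the whole differential, and the inequality reduces to 0 ≤ 0. -/
theorem IsStrictlyMPSH.exists_isAdaptedChart {ρ : M → ℝ} (hρ : IsStrictlyMPSH n ρ) (q : M) :
    ∃ (x : OpenPartialHomeomorph M (EuclideanSpace ℝ (Fin n))) (R C ε : ℝ),
      IsAdaptedChart ρ x q R C ε := by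
  obtain ⟨x, hx, ε, hε, U, hU, hqU, hUx, hmpsh⟩ := hρ.2 q
  obtain ⟨C, hC, R, hR, hball, hform, hlip, hchr⟩ := hx.exists_metric_bounds
  set K : ℝ := n ^ 3 * C with hK
  have hK0 : 0 ≤ K := by positivity
  have hnhds : x.symm ⁻¹' U ∈ 𝓝 (0 : EuclideanSpace ℝ (Fin n)) := by
    refine (x.continuousAt_symm hx.zero_mem_target).preimage_mem_nhds (hU.mem_nhds ?_)
    rw [← hx.map_center, x.left_inv hx.mem_source]
    exact hqU
  obtain ⟨R₁, hR₁, hball₁⟩ := Metric.nhds_basis_closedBall.mem_iff.1 hnhds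
  -- The bound 1/(2K + 1) makes |⟨y, Δy⟩| at most half of the energy density e, so that Δ|y|² = 2e +
  -- 2⟨y, Δy⟩ ≥ e.
  set R₂ := min (min R R₁) (1 / (2 * K + 1)) with hR₂
  have hR₂0 : 0 < R₂ := by positivity
  have hle : R₂ ≤ R := (min_le_left _ _).trans (min_le_left _ _)
  have hsub : closedBall (0 : EuclideanSpace ℝ (Fin n)) R₂ ⊆ closedBall 0 R :=
    closedBall_subset_closedBall hle
  have hnorm : ∀ u : ℂ → M, IsConformalHarmonicDisc (n := n) u → ∀ z ∈ ball (0 : ℂ) 1,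
      u z ∈ x.source → ‖x (u z)‖ ≤ R₂ → ‖Δ (fun w ↦ x (u w)) z‖ ≤ K *
      (‖fderiv ℝ (fun w ↦ x (u w)) z 1‖ ^ 2 + ‖fderiv ℝ (fun w ↦ x (u w)) z Complex.I‖ ^ 2) :=
    fun u hu z hz hzx hzR ↦ hu.1.norm_laplacian_le hx.mem_atlas hz hzx
      (hchr _ (mem_closedBall_zero_iff.2 (hzR.trans hle)))
  refine ⟨x, R₂, max C K, ε, hx.mem_atlas, hx.mem_source, hx.map_center, hR₂0,
    le_max_of_le_left hC, hε, hsub.trans hball, fun y hy v ↦ hform y (hsub hy) v,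
    fun y hy y' hy' ↦ (hlip y (hsub hy) y' (hsub hy')).trans ?_,
    fun u hu z hz hzx ↦ IsConformalDisc.exists_coeff hu hx.mem_atlas hz hzx,
    fun u hu z hz hzx hzR ↦ (hnorm u hu z hz hzx hzR).trans ?_, ?_⟩
  · gcongr; exact le_max_left _ _
  · gcongr; exact le_max_right _ _
  intro u hu z hz hzx hzR
  have hum := hu.1.contMDiffAt hz
  have hy := hum.comp_chart hx.mem_atlas hzx
  have hy2 := hy.of_le (m := 2) ENat.LEInfty.out
  have hs := hρ.contDiffAt_comp hum
  have hyR : ‖x (u z)‖ ≤ R := hzR.le.trans hle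
  obtain ⟨c, hc⟩ := IsConformalDisc.exists_coeff hu hx.mem_atlas hz hzx
  have hΔ := hnorm u hu z hz hzx hzR.le
  set a := fderiv ℝ (fun w ↦ x (u w)) z 1 with ha
  set b := fderiv ℝ (fun w ↦ x (u w)) z Complex.I with hb
  -- Either the differential is nonzero at z, hence injective nearby, or both partial derivatives
  -- vanish at z.
  by_cases hpos : 0 < chartForm x (x (u z)) a a
  · have hzU : u z ∈ U := by
      have := hball₁ (mem_closedBall_zero_iff.2
        (hzR.le.trans ((min_le_left _ _).trans (min_le_right _ _))))
      rwa [mem_preimage, x.left_inv hzx] at this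
    have himm : ∀ᶠ w in 𝓝 z, Function.Injective (mfderiv 𝓘(ℝ, ℂ) (𝓡 n) u w) := by
      have ha0 : a ≠ 0 := fun h ↦ by simp [h] at hpos
      have hd : ContinuousAt (fun w ↦ fderiv ℝ (fun w ↦ x (u w)) w 1) z :=
        (hy.fderiv_right (m := 0) (by simp)).continuousAt.clm_apply continuousAt_const
      filter_upwards [hd.eventually_ne ha0, hum.continuousAt (x.open_source.mem_nhds hzx),
        isOpen_ball.mem_nhds hz, hy.continuousAt.norm.eventually_lt_const hzR]
        with w hw1 hw2 hw3 hw4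
      refine IsConformalDisc.injective_mfderiv hu hx.mem_atlas hw3 hw2 ?_
      have := (hform (x (u w)) (mem_closedBall_zero_iff.2 (hw4.le.trans hle))
        (fderiv ℝ (fun w ↦ x (u w)) w 1)).1
      have h2 := norm_pos_iff.2 hw1
      exact lt_of_lt_of_le (by positivity) this
    have hlap := hs.hasLap.sub (hy2.hasLap.norm_sq.const_mul ε)
    have hcd : ContDiffAt ℝ 2 (fun w ↦ ρ (u w) - ε * ‖x (u w)‖ ^ 2) z :=
      hs.sub (contDiffAt_const.mul (hy2.norm_sq ℝ))
    have h1 := hmpsh.laplacian_comp_nonneg (f := fun q ↦ ρ q - ε * ‖x q‖ ^ 2) hU hu hz hzU himm hcd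
    rw [(hcd.hasLap.unique hlap).2.2] at h1
    have h2 : |inner ℝ (x (u z)) (Δ (fun w ↦ x (u w)) z)| ≤ (‖a‖ ^ 2 + ‖b‖ ^ 2) / 2 := by
      refine (abs_real_inner_le_norm _ _).trans ?_
      have h3 : ‖x (u z)‖ ≤ 1 / (2 * K + 1) := hzR.le.trans (min_le_right _ _)
      calc _ ≤ 1 / (2 * K + 1) * (K * (‖a‖ ^ 2 + ‖b‖ ^ 2)) := by gcongr
        _ = (K / (2 * K + 1)) * (‖a‖ ^ 2 + ‖b‖ ^ 2) := by ring
        _ ≤ (1 / 2) * (‖a‖ ^ 2 + ‖b‖ ^ 2) := by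
          refine mul_le_mul_of_nonneg_right ?_ (by positivity)
          rw [div_le_div_iff₀ (by positivity) (by norm_num)]
          linarith
        _ = _ := by ring
    have h4 := (abs_le.1 h2).1
    nlinarith
  · have haa := (hform _ (mem_closedBall_zero_iff.2 hyR) a).1
    have hbb := (hform _ (mem_closedBall_zero_iff.2 hyR) b).1
    have e1 := hc 1 1
    have e2 := hc Complex.I Complex.I
    rw [← ha] at e1
    rw [← hb] at e2
    have ha0 : a = 0 := by
      have : ‖a‖ ^ 2 = 0 := le_antisymm (by linarith) (sq_nonneg _)
      simpa using this
    have hb0 : b = 0 := by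
      have hI : chartForm x (x (u z)) b b = chartForm x (x (u z)) a a := by
        rw [e1, e2]; simp
      have : ‖b‖ ^ 2 = 0 := le_antisymm (by linarith) (sq_nonneg _)
      simpa using this
    rw [ha0, hb0] at hΔ
    have hL : Δ (fun w ↦ x (u w)) z = 0 := by simpa using hΔ
    -- At a branch point the gradient and the Laplacian of y both vanish, so the second-order chain
    -- rule gives Δ(ρ ∘ u) = 0.
    have hcomp : ContDiffAt ℝ 2 (fun y ↦ ρ (x.symm y)) (x (u z)) :=
      contMDiffAt_iff_contDiffAt.1 (hρ.1.contMDiffAt.comp _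
        ((contMDiffAt_symm_of_mem_maximalAtlas hx.mem_atlas (x.map_source hzx)).of_le
          ENat.LEInfty.out))
    have h5 := hy2.hasLap.comp_contDiffAt hcomp
    rw [← ha, ← hb, ha0, hb0, hL] at h5
    have h6 := h5.congr (g := fun w ↦ ρ (u w)) (by
      filter_upwards [hum.continuousAt (x.open_source.mem_nhds hzx)] with w hw
      rw [x.left_inv hw])
    rw [(hs.hasLap.unique h6).2.2, ha0, hb0]
    simp

end Discs

/-! ### Comparison of the Riemannian and coordinate distances. -/

section Distance

variable {n : ℕ} {M : Type*} [EMetricSpace M] [ChartedSpace (EuclideanSpace ℝ (Fin n)) M]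
  [RiemannianBundle (fun p : M ↦ TangentSpace (𝓡 n) p)]
  [IsRiemannianManifold (𝓡 n) M]

/-- The coordinate segment stays in the convex ball of radius R, where the metric is at most 2|v|² ≤
(2|v|)², so its Riemannian length is at most twice its Euclidean length. -/
theorem IsAdaptedChart.edist_le {ρ : M → ℝ}
    {x : OpenPartialHomeomorph M (EuclideanSpace ℝ (Fin n))} {q : M} {R C ε : ℝ}
    (hx : IsAdaptedChart ρ x q R C ε) {p p' : M} (hp : p ∈ x.source) (hp' : p' ∈ x.source)
    (hpR : ‖x p‖ ≤ R) (hpR' : ‖x p'‖ ≤ R) : edist p p' ≤ 2 * edist (x p) (x p') := by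
  rw [IsRiemannianManifold.out (I := 𝓡 n) p p']
  let η := ContinuousAffineMap.lineMap (R := ℝ) (x p) (x p')
  set γ := x.symm ∘ η with hγ
  have hη : ∀ t ∈ Icc (0 : ℝ) 1, η t ∈ closedBall (0 : EuclideanSpace ℝ (Fin n)) R := by
    intro t ht
    refine (convex_closedBall _ _).segment_subset (mem_closedBall_zero_iff.2 hpR)
      (mem_closedBall_zero_iff.2 hpR') ?_
    rw [segment_eq_image_lineMap]
    exact ⟨t, ht, by simp [η, ContinuousAffineMap.coe_lineMap_eq]⟩
  have η_smooth : ContMDiff 𝓘(ℝ, ℝ) (𝓡 n) 1 η := by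
    rw [contMDiff_iff_contDiff]
    exact ContinuousAffineMap.contDiff _
  have h1 : riemannianEDist (𝓡 n) p p' ≤ pathELength (𝓡 n) γ 0 1 := by
    apply riemannianEDist_le_pathELength _ _ _ zero_le_one
    · exact ((contMDiffOn_symm_of_mem_maximalAtlas hx.mem_atlas).of_le (by simp)).comp
        η_smooth.contMDiffOn fun t ht ↦ hx.subset_target (hη t ht)
    · simp [γ, η, ContinuousAffineMap.coe_lineMap_eq, hp]
    · simp [γ, η, ContinuousAffineMap.coe_lineMap_eq, hp']
  refine h1.trans ?_
  rw [← lintegral_fderiv_lineMap_eq_edist, pathELength_eq_lintegral_mfderivWithin_Icc,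
    ← MeasureTheory.lintegral_const_mul' _ _ (by simp)]
  refine MeasureTheory.setLIntegral_mono' measurableSet_Icc fun t ht ↦ ?_
  have h2 : mfderivWithin 𝓘(ℝ, ℝ) (𝓡 n) γ (Icc 0 1) t =
      (mfderiv (𝓡 n) (𝓡 n) x.symm (η t)).comp (mfderivWithin 𝓘(ℝ, ℝ) (𝓡 n) η (Icc 0 1) t) := by
    refine mfderiv_comp_mfderivWithin t
      ((contMDiffAt_symm_of_mem_maximalAtlas hx.mem_atlas
        (hx.subset_target (hη t ht))).mdifferentiableAt (by simp))
      (η_smooth.mdifferentiable (by simp) t).mdifferentiableWithinAt ?_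
    rw [uniqueMDiffWithinAt_iff_uniqueDiffWithinAt]
    exact uniqueDiffOn_Icc zero_lt_one t ht
  have h3 : mfderivWithin 𝓘(ℝ, ℝ) (𝓡 n) γ (Icc 0 1) t 1 =
      mfderiv (𝓡 n) (𝓡 n) x.symm (η t) (mfderivWithin 𝓘(ℝ, ℝ) (𝓡 n) η (Icc 0 1) t 1) :=
    congrArg (fun l ↦ l 1) h2
  have h4 : ∀ v : EuclideanSpace ℝ (Fin n),
      ‖(mfderiv (𝓡 n) (𝓡 n) x.symm (η t) v : TangentSpace (𝓡 n) (x.symm (η t)))‖ ≤ 2 * ‖v‖ := by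
    intro v
    have h5 := (hx.form_bounds _ (hη t ht) v).2
    rw [chartForm_apply, real_inner_self_eq_norm_sq] at h5
    refine le_of_sq_le_sq ?_ (by positivity)
    nlinarith [sq_nonneg ‖v‖]
  rw [h3]
  have h5 : ∀ v : EuclideanSpace ℝ (Fin n),
      ‖(mfderiv (𝓡 n) (𝓡 n) x.symm (η t) v : TangentSpace (𝓡 n) (x.symm (η t)))‖ₑ ≤ 2 * ‖v‖ₑ := by
    intro v
    have := ENNReal.ofReal_le_ofReal (h4 v)
    rw [ENNReal.ofReal_mul (by norm_num), ofReal_norm, ofReal_norm] at this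
    simpa using this
  refine (h5 _).trans_eq ?_
  rw [mfderivWithin_eq_fderivWithin]
  rfl

end Distance

/-! ### Gram matrix estimates for semidefinite forms. -/

section Forms

variable {E : Type*} [NormedAddCommGroup E] [InnerProductSpace ℝ E]

theorem sq_apply_le_of_nonneg (Q : E →L[ℝ] E →L[ℝ] ℝ) (hQ : ∀ v w, Q v w = Q w v)
    (hpos : ∀ v, 0 ≤ Q v v) (v w : E) : Q v w ^ 2 ≤ Q v v * Q w w := by
  have h : ∀ t : ℝ, 0 ≤ Q w w * (t * t) + 2 * Q v w * t + Q v v := fun t ↦ by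
    have := hpos (v + t • w)
    simp only [map_add, map_smul, _root_.add_apply, _root_.smul_apply, smul_eq_mul, hQ w v] at this
    linarith
  have := discrim_le_zero h
  rw [discrim] at this
  nlinarith

/-- Here m bounds the top eigenvalue of the Gram matrix of a, b; Cauchy–Schwarz is applied to Y and
Q(Y,a)a + Q(Y,b)b. For a conformal pair m can be half the trace, and this factor 1/2 is what makes
the logarithm of a squared distance subharmonic. -/
theorem sq_add_sq_apply_le (Q : E →L[ℝ] E →L[ℝ] ℝ) (hQ : ∀ v w, Q v w = Q w v)
    (hpos : ∀ v, 0 ≤ Q v v) (Y a b : E) {m : ℝ} (hm : 0 ≤ m)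
    (hgram : (Q a a + Q b b) / 2 + |Q a a - Q b b| / 2 + |Q a b| ≤ m) :
    Q Y a ^ 2 + Q Y b ^ 2 ≤ Q Y Y * m := by
  set α := Q Y a
  set β := Q Y b
  have h1 := sq_apply_le_of_nonneg Q hQ hpos Y (α • a + β • b)
  simp only [map_add, map_smul, _root_.add_apply, _root_.smul_apply, smul_eq_mul, hQ b a] at h1
  have h2 : α * (α * Q a a + β * Q a b) + β * (α * Q a b + β * Q b b) ≤ (α ^ 2 + β ^ 2) * m := by
    have e1 := le_abs_self (Q a a - Q b b)
    have e2 := neg_abs_le (Q a a - Q b b)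
    have e3 : 2 * α * β * Q a b ≤ (α ^ 2 + β ^ 2) * |Q a b| := by
      have f1 : 2 * α * β * Q a b ≤ |2 * α * β * Q a b| := le_abs_self _
      have f2 : |2 * α * β| ≤ α ^ 2 + β ^ 2 :=
        abs_le.2 ⟨by nlinarith [sq_nonneg (α + β)], by nlinarith [sq_nonneg (α - β)]⟩
      rw [abs_mul] at f1
      exact f1.trans (mul_le_mul_of_nonneg_right f2 (abs_nonneg _))
    have e4 : α ^ 2 * Q a a ≤ α ^ 2 * ((Q a a + Q b b) / 2 + |Q a a - Q b b| / 2) :=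
      mul_le_mul_of_nonneg_left (by linarith) (sq_nonneg _)
    have e5 : β ^ 2 * Q b b ≤ β ^ 2 * ((Q a a + Q b b) / 2 + |Q a a - Q b b| / 2) :=
      mul_le_mul_of_nonneg_left (by linarith) (sq_nonneg _)
    have e6 := mul_le_mul_of_nonneg_left hgram (by positivity : 0 ≤ α ^ 2 + β ^ 2)
    nlinarith
  have h3 : (α ^ 2 + β ^ 2) * (α ^ 2 + β ^ 2) ≤ (α ^ 2 + β ^ 2) * (Q Y Y * m) := by
    calc _ = (α * α + β * β) ^ 2 := by ring
      _ ≤ _ := h1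
      _ ≤ Q Y Y * ((α ^ 2 + β ^ 2) * m) := mul_le_mul_of_nonneg_left h2 (hpos Y)
      _ = _ := by ring
  rcases (by positivity : 0 ≤ α ^ 2 + β ^ 2).eq_or_lt with h0 | h0
  · rw [← h0]; exact mul_nonneg (hpos Y) hm
  · exact le_of_mul_le_mul_left h3 h0

end Forms

/-! ### Planar data and the almost subharmonic logarithm. -/

section Planar

variable {E : Type*} [NormedAddCommGroup E] [InnerProductSpace ℝ E]

/-- A conformal map `y` from an open subset `O` of the unit disc to a Euclidean ball with a
Riemannian metric `G`, whose Laplacian is controlled by its energy density, together with a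
positive function `s` whose Laplacian dominates the energy density of `y`. -/
structure IsPlanarData (O : Set ℂ) (y : ℂ → E) (s : ℂ → ℝ) (G : E → E →L[ℝ] E →L[ℝ] ℝ)
    (R C ε : ℝ) : Prop where
  isOpen : IsOpen O
  subset_ball : O ⊆ ball 0 1
  R_pos : 0 < R
  C_nonneg : 0 ≤ C
  ε_pos : 0 < ε
  norm_lt : ∀ z ∈ O, ‖y z‖ < R
  mem_of_mem_closure : ∀ r < R, ∀ z ∈ ball (0 : ℂ) 1, z ∈ closure {w ∈ O | ‖y w‖ ≤ r} → z ∈ O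
  contDiffAt_y : ∀ z ∈ O, ContDiffAt ℝ 2 y z
  contDiffAt_s : ∀ z ∈ O, ContDiffAt ℝ 2 s z
  s_pos : ∀ z ∈ O, 0 < s z
  form_symm : ∀ p v w, G p v w = G p w v
  form_bounds : ∀ p ∈ closedBall (0 : E) R, ∀ v,
    ‖v‖ ^ 2 / 2 ≤ G p v v ∧ G p v v ≤ 2 * ‖v‖ ^ 2
  form_lipschitz : ∀ p ∈ closedBall (0 : E) R, ∀ q ∈ closedBall (0 : E) R,
    ‖G p - G q‖ ≤ C * ‖p - q‖
  conformal : ∀ z ∈ O, ∃ c : ℝ, ∀ v w : ℂ,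
    G (y z) (fderiv ℝ y z v) (fderiv ℝ y z w) = c * inner ℝ v w
  norm_laplacian_le : ∀ z ∈ O, ‖Δ y z‖ ≤
    C * (‖fderiv ℝ y z 1‖ ^ 2 + ‖fderiv ℝ y z Complex.I‖ ^ 2)
  le_laplacian : ∀ z ∈ O,
    ε * (‖fderiv ℝ y z 1‖ ^ 2 + ‖fderiv ℝ y z Complex.I‖ ^ 2) ≤ Δ s z

theorem HasLap.log_add_sqrt {f : ℂ → ℝ} {z : ℂ} {a₁ a₂ L : ℝ} (h : HasLap f z a₁ a₂ L) (B : ℝ)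
    (hf : 0 < f z) :
    HasLap (fun w ↦ Real.log (f w) + B * √(f w)) z ((1 / f z + B / (2 * √(f z))) * a₁)
      ((1 / f z + B / (2 * √(f z))) * a₂)
      ((-(1 / f z ^ 2) - B / (4 * f z * √(f z))) * (a₁ ^ 2 + a₂ ^ 2) +
        (1 / f z + B / (2 * √(f z))) * L) := by
  refine h.comp_real (φ := fun t ↦ Real.log t + B * √t) (φ' := fun t ↦ 1 / t + B / (2 * √t))
    ?_ ?_
  · filter_upwards [lt_mem_nhds hf] with t ht
    have := (Real.hasDerivAt_log ht.ne').add ((Real.hasDerivAt_sqrt ht.ne').const_mul B)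
    refine this.congr_deriv ?_
    rw [one_div]; ring
  · generalize f z = N at hf
    have hs : 0 < √N := Real.sqrt_pos.2 hf
    have h1 := (Real.hasDerivAt_sqrt hf.ne').const_mul 2
    have h2 := ((hasDerivAt_inv hf.ne').add ((h1.inv (by positivity)).const_mul B))
    have h3 : (fun t ↦ 1 / t + B / (2 * √t)) =
        (fun t : ℝ ↦ t⁻¹) + fun t ↦ B * (2 * √t)⁻¹ := by
      ext t; simp [div_eq_mul_inv]
    rw [h3]
    refine h2.congr_deriv ?_
    have h4 : N = √N ^ 2 := (Real.sq_sqrt hf.le).symm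
    generalize √N = σ at *
    subst h4
    field_simp
    ring

/-- The singular terms 2eQ/σ² of the logarithm cancel exactly. The remaining errors of order C·e/σ
are compensated by the Laplacian of B√N: with B = 48C they combine to (24C/σ)(eQ - e/2) ≥ 0, leaving
only the bounded defect -192C²e. -/
theorem log_barrier_ineq {N σ B C e eQ L g : ℝ} (hσ : 0 < σ) (hN : N = σ ^ 2) (hC : 0 ≤ C)
    (hB : B = 48 * C) (heQ : e / 2 ≤ eQ)
    (hg : g ≤ 4 * (N * (eQ / 2 + 2 * C * σ * e)))
    (hL : 2 * eQ - 4 * C * σ * e ≤ L) :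
    -(192 * C ^ 2) * e ≤ (-(1 / N ^ 2) - B / (4 * N * σ)) * g + (1 / N + B / (2 * σ)) * L := by
  subst hN hB
  have h1 : (1 / (σ ^ 2) ^ 2 + 48 * C / (4 * σ ^ 2 * σ)) * g ≤
      (1 / (σ ^ 2) ^ 2 + 48 * C / (4 * σ ^ 2 * σ)) * (4 * (σ ^ 2 * (eQ / 2 + 2 * C * σ * e))) :=
    mul_le_mul_of_nonneg_left hg (by positivity)
  have h2 : (1 / σ ^ 2 + 48 * C / (2 * σ)) * (2 * eQ - 4 * C * σ * e) ≤
      (1 / σ ^ 2 + 48 * C / (2 * σ)) * L :=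
    mul_le_mul_of_nonneg_left hL (by positivity)
  have h3 : (1 / σ ^ 2 + 48 * C / (2 * σ)) * (2 * eQ - 4 * C * σ * e) -
      (1 / (σ ^ 2) ^ 2 + 48 * C / (4 * σ ^ 2 * σ)) * (4 * (σ ^ 2 * (eQ / 2 + 2 * C * σ * e))) =
      24 * C / σ * (eQ - e / 2) - 192 * C ^ 2 * e := by
    field_simp
    ring
  have h4 : 0 ≤ 24 * C / σ * (eQ - e / 2) := mul_nonneg (by positivity) (by linarith)
  nlinarith

variable {O : Set ℂ} {y : ℂ → E} {s : ℂ → ℝ} {G : E → E →L[ℝ] E →L[ℝ] ℝ} {R C ε : ℝ}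

namespace IsPlanarData

variable (h : IsPlanarData O y s G R C ε)
include h

theorem form_nonneg {p : E} (hp : ‖p‖ ≤ R) (v : E) : 0 ≤ G p v v :=
  le_trans (by positivity) (h.form_bounds p (mem_closedBall_zero_iff.2 hp) v).1

set_option maxHeartbeats 800000 in
/-- The two barrier functions built from the squared distance to `p`, in the metric at `p`. -/
theorem exists_hasLap {p : E} (hp : ‖p‖ ≤ R) {z : ℂ} (hz : z ∈ O) :
    (∃ a₁ a₂ L, HasLap (fun w ↦ G p (y w - p) (y w - p)) z a₁ a₂ L ∧
      L ≤ (4 + 16 * C * R) * (‖fderiv ℝ y z 1‖ ^ 2 + ‖fderiv ℝ y z Complex.I‖ ^ 2)) ∧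
    (y z ≠ p → ∃ a₁ a₂ L, HasLap (fun w ↦ Real.log (G p (y w - p) (y w - p)) +
        48 * C * √(G p (y w - p) (y w - p))) z a₁ a₂ L ∧
      -(192 * C ^ 2) * (‖fderiv ℝ y z 1‖ ^ 2 + ‖fderiv ℝ y z Complex.I‖ ^ 2) ≤ L) := by
  set a := fderiv ℝ y z 1 with ha
  set b := fderiv ℝ y z Complex.I with hb
  set e := ‖a‖ ^ 2 + ‖b‖ ^ 2 with he
  set Q := G p with hQ
  have hC := h.C_nonneg
  have hsym := h.form_symm p
  have hpos := h.form_nonneg hp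
  have hpR := mem_closedBall_zero_iff.2 hp
  have hzR := mem_closedBall_zero_iff.2 (h.norm_lt z hz).le
  set Y := y z - p with hY
  set N := Q Y Y with hN
  set σ := √N with hσ
  have hσ0 : 0 ≤ σ := Real.sqrt_nonneg _
  have hσN : N = σ ^ 2 := (Real.sq_sqrt (hpos Y)).symm
  set eQ := Q a a + Q b b with heQ
  have he0 : 0 ≤ e := by positivity
  have hba := h.form_bounds p hpR a
  have hbb := h.form_bounds p hpR b
  have hbY := h.form_bounds p hpR Y
  have heQ1 : e / 2 ≤ eQ := by linarith
  have heQ2 : eQ ≤ 2 * e := by linarith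
  have hYσ : ‖Y‖ ≤ 2 * σ := by
    refine le_of_sq_le_sq ?_ (by positivity)
    nlinarith [sq_nonneg σ]
  have hσR : σ ≤ 4 * R := by
    have h1 : ‖Y‖ ≤ 2 * R := (norm_sub_le _ _).trans (by linarith [h.norm_lt z hz])
    refine le_of_sq_le_sq ?_ (by linarith [h.R_pos])
    nlinarith [norm_nonneg Y, h.R_pos]
  set L := Δ y z
  have hL := h.norm_laplacian_le z hz
  have hQL : |Q Y L| ≤ 2 * C * σ * e := by
    refine abs_le_of_sq_le_sq ?_ (by positivity)
    have h1 := sq_apply_le_of_nonneg Q hsym hpos Y L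
    have h2 := (h.form_bounds p hpR L).2
    have h3 : ‖L‖ ^ 2 ≤ (C * e) ^ 2 := by gcongr
    have h4 : Q Y Y * Q L L ≤ σ ^ 2 * (2 * (C * e) ^ 2) := by
      rw [← hσN]
      exact mul_le_mul_of_nonneg_left (h2.trans (by linarith)) (hpos Y)
    nlinarith [sq_nonneg (σ * C * e)]
  have hlapN := ((h.contDiffAt_y z hz).hasLap.sub (HasLap.const p z)).bilin Q hsym
  simp only [sub_zero] at hlapN
  have hub : 2 * eQ + 2 * Q Y L ≤ (4 + 16 * C * R) * e := by
    have h1 := (abs_le.1 hQL).2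
    have h2 : 2 * C * σ * e ≤ 2 * C * (4 * R) * e := by gcongr
    nlinarith
  refine ⟨⟨_, _, _, hlapN, hub⟩, fun hne ↦ ?_⟩
  have hYpos : 0 < ‖Y‖ := norm_pos_iff.2 (sub_ne_zero.2 hne)
  have hσpos : 0 < σ := by linarith
  have hNpos : 0 < N := by rw [hσN]; positivity
  obtain ⟨c, hc⟩ := h.conformal z hz
  -- Conformality holds for the metric at y z, not at p. Replacing one metric by the other costs
  -- C‖Y‖, which is what the term 48C√N is there to absorb.
  have hlip := h.form_lipschitz p hpR (y z) hzR
  rw [norm_sub_rev p] at hlip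
  have hdiff : ∀ v w, |Q v w - G (y z) v w| ≤ C * ‖Y‖ * ‖v‖ * ‖w‖ := fun v w ↦ by
    have := (G p - G (y z)).le_opNorm₂ v w
    rw [_root_.sub_apply, _root_.sub_apply, Real.norm_eq_abs] at this
    exact this.trans (by gcongr)
  have d1 := hdiff a a
  have d2 := hdiff b b
  have d3 := hdiff a b
  have c1 : G (y z) a a = c := by rw [ha, hc]; simp
  have c2 : G (y z) b b = c := by rw [hb, hc]; simp
  have c3 : G (y z) a b = 0 := by rw [ha, hb, hc]; simp
  rw [c1] at d1
  rw [c2] at d2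
  rw [c3, sub_zero] at d3
  have d4 : |Q a a - Q b b| ≤ C * ‖Y‖ * e := by
    have : Q a a - Q b b = (Q a a - c) - (Q b b - c) := by ring
    rw [this]
    refine (abs_sub _ _).trans ((add_le_add d1 d2).trans_eq ?_)
    rw [he]; ring
  have d5 : |Q a b| ≤ C * ‖Y‖ * e / 2 := by
    refine d3.trans ?_
    have : 0 ≤ C * ‖Y‖ := by positivity
    have h1 : ‖a‖ * ‖b‖ ≤ e / 2 := by linarith [two_mul_le_add_sq ‖a‖ ‖b‖]
    calc C * ‖Y‖ * ‖a‖ * ‖b‖ = C * ‖Y‖ * (‖a‖ * ‖b‖) := by ring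
      _ ≤ C * ‖Y‖ * (e / 2) := mul_le_mul_of_nonneg_left h1 this
      _ = _ := by ring
  have d6 : C * ‖Y‖ * e ≤ 2 * C * σ * e := by
    have : C * ‖Y‖ * e ≤ C * (2 * σ) * e := by gcongr
    linarith
  have hgrad := sq_add_sq_apply_le Q hsym hpos Y a b (m := eQ / 2 + 2 * C * σ * e)
    (by have : 0 ≤ eQ := by linarith
        positivity) (by linarith)
  have hfin := hlapN.log_add_sqrt (48 * C) hNpos
  have h1 := (abs_le.1 hQL).1
  have hg : (2 * Q Y a) ^ 2 + (2 * Q Y b) ^ 2 ≤ 4 * (N * (eQ / 2 + 2 * C * σ * e)) := by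
    have : (2 * Q Y a) ^ 2 + (2 * Q Y b) ^ 2 = 4 * (Q Y a ^ 2 + Q Y b ^ 2) := by ring
    rw [this]
    exact mul_le_mul_of_nonneg_left hgrad (by norm_num)
  have hL' : 2 * eQ - 4 * C * σ * e ≤ 2 * eQ + 2 * Q Y L := by linarith
  exact ⟨_, _, _, hfin, log_barrier_ineq hσpos hσN hC rfl heQ1 hg hL'⟩

end IsPlanarData

end Planar

/-! ### Linear decay of s at the boundary arc. -/

section Planar

variable {E : Type*} [NormedAddCommGroup E] [InnerProductSpace ℝ E]
variable {O : Set ℂ} {y : ℂ → E} {s : ℂ → ℝ} {G : E → E →L[ℝ] E →L[ℝ] ℝ} {R C ε : ℝ}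

namespace IsPlanarData

variable (h : IsPlanarData O y s G R C ε)
include h

theorem continuousAt_form (p : E) {z : ℂ} (hz : z ∈ O) :
    ContinuousAt (fun w ↦ G p (y w - p) (y w - p)) z := by
  have h1 : ContinuousAt (fun w ↦ y w - p) z :=
    (h.contDiffAt_y z hz).continuousAt.sub continuousAt_const
  exact ((G p).continuous.continuousAt.comp h1).clm_apply h1

set_option maxHeartbeats 1600000 in
/-- A function that is small near the boundary arc decays linearly there. -/
theorem exists_le_mul_boundary_dist {a : ℂ} (ha : ‖a‖ = 1) {δ₁ : ℝ} (hδ₁ : 0 < δ₁)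
    (hb : ∀ b : ℂ, ‖b‖ = 1 → ‖b - a‖ < δ₁ → ∀ η > 0,
      ∀ᶠ z in 𝓝 b, z ∈ O → ‖y z‖ ≤ R / 2 → s z < η) :
    ∃ δ > 0, ∃ K ≥ 0, ∀ z ∈ O, ‖z - a‖ < δ → ‖y z‖ ≤ R / 4 → s z ≤ K * (1 - ‖z‖) := by
  have hR := h.R_pos
  have hC := h.C_nonneg
  have hε := h.ε_pos
  -- Subtracting ε' times the squared distance N then uses up at most half of the lower bound for
  -- Δs.
  set ε' := ε / (8 + 32 * C * R) with hε'
  have hε'0 : 0 < ε' := by positivity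
  have hε'2 : ε' * (4 + 16 * C * R) = ε / 2 := by
    rw [hε']; field_simp; ring
  -- The least value of ε'N when ‖y z‖ = R/2 and ‖p‖ ≤ R/4; s is made smaller than this.
  set η := ε' * R ^ 2 / 32 with hη
  have hη0 : 0 < η := by positivity
  obtain ⟨δ', hδ', hball⟩ := Metric.eventually_nhds_iff_ball.1
    (hb a ha (by simpa using hδ₁) η hη0)
  set δ := min (min (δ' / 2) (δ₁ / 2)) 1 with hδ
  have hδ0 : 0 < δ := by positivity
  have hδa : δ < δ' := (min_le_left _ _).trans_lt ((min_le_left _ _).trans_lt (by linarith))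
  have hδb : δ < δ₁ := (min_le_left _ _).trans_lt ((min_le_right _ _).trans_lt (by linarith))
  have hδ1 : δ ≤ 1 := min_le_right _ _
  -- Chosen so that A|z - ζ|² ≥ η on the circle |z - a| = δ, where |z - ζ| ≥ δ/2.
  set A := 4 * η / δ ^ 2 with hA
  have hA0 : 0 < A := by positivity
  refine ⟨δ / 4, by positivity, 2 * A, by positivity, fun z₀ hz₀ hz₀a hyz₀ ↦ ?_⟩
  have hz₀1 : ‖z₀‖ < 1 := mem_ball_zero_iff.1 (h.subset_ball hz₀)
  have hz₀2 : 1 - δ / 4 < ‖z₀‖ := by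
    have := norm_sub_norm_le a z₀
    rw [ha, norm_sub_rev] at this
    linarith
  have hz₀0 : 0 < ‖z₀‖ := by linarith
  set ζ : ℂ := (‖z₀‖⁻¹ : ℝ) • z₀ with hζ
  have hζ1 : ‖ζ‖ = 1 := by
    rw [hζ, norm_smul, norm_inv, norm_norm, inv_mul_cancel₀ hz₀0.ne']
  have hζz : inner ℝ ζ z₀ = ‖z₀‖ := by
    rw [hζ, real_inner_smul_left, real_inner_self_eq_norm_sq]
    field_simp
  have hζa : ‖ζ - a‖ ≤ δ / 2 := by
    have h1 : ‖ζ - z₀‖ = 1 - ‖z₀‖ := by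
      have : ζ - z₀ = (‖z₀‖⁻¹ - 1 : ℝ) • z₀ := by rw [hζ, sub_smul, one_smul]
      rw [this, norm_smul, Real.norm_of_nonneg (sub_nonneg.2 ((one_le_inv₀ hz₀0).2 hz₀1.le))]
      field_simp
    have h2 := norm_sub_le_norm_sub_add_norm_sub ζ z₀ a
    linarith
  set p := y z₀ with hp
  have hpR : ‖p‖ ≤ R := by linarith
  by_contra! hcon
  -- Half of the assumed excess at z₀: adding κ(|z|² - 1) makes the comparison function strictly
  -- subharmonic while keeping it positive at z₀.
  set κ := (s z₀ - 2 * A * (1 - ‖z₀‖)) / 2 with hκ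
  have hκ0 : 0 < κ := by rw [hκ]; linarith
  let F : ℂ → ℝ := fun z ↦ s z - ε' * G p (y z - p) (y z - p) - 2 * A * (1 - inner ℝ ζ z) +
    (κ * ‖z - 0‖ ^ 2 - κ)
  have hFcont : ∀ z ∈ O, ContinuousAt F z := fun z hz ↦ by
    refine ContinuousAt.add (ContinuousAt.sub (ContinuousAt.sub
      (h.contDiffAt_s z hz).continuousAt (continuousAt_const.mul (h.continuousAt_form p hz)))
      (by fun_prop)) (by fun_prop)
  have hNnn := fun z ↦ h.form_nonneg hpR (y z - p)
  have hhle : ∀ z : ℂ, ‖z‖ ≤ 1 → A * ‖z - ζ‖ ^ 2 ≤ 2 * A * (1 - inner ℝ ζ z) := fun z hz ↦ by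
    have h1 : ‖z - ζ‖ ^ 2 = ‖z‖ ^ 2 - 2 * inner ℝ ζ z + 1 := by
      rw [norm_sub_sq_real, hζ1, real_inner_comm]; ring
    rw [h1]
    have h2 : ‖z‖ ^ 2 ≤ 1 := pow_le_one₀ (norm_nonneg _) hz
    nlinarith
  have hFle : ∀ z : ℂ, ‖z‖ ≤ 1 → F z ≤ s z - ε' * G p (y z - p) (y z - p) - A * ‖z - ζ‖ ^ 2 := by
    intro z hz
    have h1 := hhle z hz
    have h2 : κ * ‖z - 0‖ ^ 2 ≤ κ := by
      rw [sub_zero]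
      exact mul_le_of_le_one_right hκ0.le (pow_le_one₀ (norm_nonneg _) hz)
    simp only [F]
    linarith
  set m := F z₀ with hm
  have hm0 : 0 < m := by
    have h1 : m = s z₀ - 2 * A * (1 - ‖z₀‖) + (κ * ‖z₀‖ ^ 2 - κ) := by
      simp only [hm, F, hζz, ← hp, sub_self, map_zero, sub_zero, mul_zero]
    rw [h1]
    have : 0 ≤ κ * ‖z₀‖ ^ 2 := by positivity
    linarith
  -- Restricting to F ≥ m keeps T away from the unit circle, where s becomes smaller than m; this
  -- makes T compact although O need not be relatively compact in the disc.
  let T : Set ℂ := {z | (z ∈ O ∧ ‖y z‖ ≤ R / 2) ∧ ‖z - a‖ ≤ δ ∧ m ≤ F z}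
  have hTz₀ : z₀ ∈ T := ⟨⟨hz₀, by linarith⟩, by linarith, le_rfl⟩
  have hTcl : IsClosed T := by
    refine isClosed_of_closure_subset fun z hz ↦ ?_
    have hfr := mem_closure_iff_frequently.1 hz
    have hz1 : ‖z‖ ≤ 1 := by
      have : closure T ⊆ closedBall 0 1 := closure_minimal
        (fun w hw ↦ ball_subset_closedBall (h.subset_ball hw.1.1)) isClosed_closedBall
      exact mem_closedBall_zero_iff.1 (this hz)
    have hza : ‖z - a‖ ≤ δ := by
      have : closure T ⊆ closedBall a δ := closure_minimal
        (fun w hw ↦ mem_closedBall_iff_norm.2 hw.2.1) isClosed_closedBall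
      exact mem_closedBall_iff_norm.1 (this hz)
    rcases hz1.eq_or_lt with hz1 | hz1
    · obtain ⟨w, hw, hw'⟩ := (hfr.and_eventually (hb z hz1 (hza.trans_lt hδb) m hm0)).exists
      have h1 := hw' hw.1.1 hw.1.2
      have h2 := hFle w (mem_ball_zero_iff.1 (h.subset_ball hw.1.1)).le
      have h3 := mul_nonneg hε'0.le (hNnn w)
      have h4 : 0 ≤ A * ‖w - ζ‖ ^ 2 := by positivity
      linarith [hw.2.2]
    · have hzO : z ∈ O := h.mem_of_mem_closure (R / 2) (by linarith) z
        (mem_ball_zero_iff.2 hz1) (closure_mono (fun w hw ↦ hw.1) hz)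
      refine ⟨⟨hzO, ?_⟩, hza, ?_⟩
      · by_contra! hlt
        obtain ⟨w, hw, hw'⟩ := (hfr.and_eventually
          ((h.contDiffAt_y z hzO).continuousAt.norm.eventually_const_lt hlt)).exists
        exact absurd hw.1.2 (not_le.2 hw')
      · by_contra! hlt
        obtain ⟨w, hw, hw'⟩ := (hfr.and_eventually
          ((hFcont z hzO).eventually_lt_const hlt)).exists
        exact absurd hw.2.2 (not_le.2 hw')
  have hTc : IsCompact T := Metric.isCompact_of_isClosed_isBounded hTcl
    (isBounded_closedBall.subset fun w hw ↦ mem_closedBall_iff_norm.2 hw.2.1)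
  obtain ⟨z₁, hz₁, hmax⟩ := hTc.exists_isMaxOn ⟨z₀, hTz₀⟩
    (fun z hz ↦ (hFcont z hz.1.1).continuousWithinAt)
  have hz₁O := hz₁.1.1
  have hz₁1 : ‖z₁‖ ≤ 1 := (mem_ball_zero_iff.1 (h.subset_ball hz₁O)).le
  have hF₁ := hFle z₁ hz₁1
  have hmF : m ≤ F z₁ := hz₁.2.2
  have hs₁ : s z₁ < η :=
    hball z₁ (mem_ball_iff_norm.2 (hz₁.2.1.trans_lt hδa)) hz₁O hz₁.1.2
  have hN₁ := mul_nonneg hε'0.le (hNnn z₁)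
  have hy₁ : ‖y z₁‖ < R / 2 := by
    refine hz₁.1.2.lt_of_ne fun heq ↦ ?_
    have h1 : R / 4 ≤ ‖y z₁ - p‖ := by
      have := norm_sub_norm_le (y z₁) p
      linarith
    have h2 := (h.form_bounds p (mem_closedBall_zero_iff.2 hpR) (y z₁ - p)).1
    have h3 : R ^ 2 / 32 ≤ G p (y z₁ - p) (y z₁ - p) := by nlinarith
    have h4 : η ≤ ε' * G p (y z₁ - p) (y z₁ - p) := by
      rw [hη]
      have := mul_le_mul_of_nonneg_left h3 hε'0.le
      linarith
    have h5 : 0 ≤ A * ‖z₁ - ζ‖ ^ 2 := by positivity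
    linarith
  have ha₁ : ‖z₁ - a‖ < δ := by
    refine hz₁.2.1.lt_of_ne fun heq ↦ ?_
    have h1 : δ / 2 ≤ ‖z₁ - ζ‖ := by
      have := norm_sub_le_norm_sub_add_norm_sub z₁ ζ a
      linarith
    have h2 : η ≤ A * ‖z₁ - ζ‖ ^ 2 := by
      calc η = A * (δ / 2) ^ 2 := by rw [hA]; field_simp; ring
        _ ≤ _ := by gcongr
    linarith
  -- Both lateral constraints are strict at z₁, and outside the level set F is below m, so the
  -- constrained maximum is a genuine local one.
  have hloc : IsLocalMax F z₁ := by
    filter_upwards [h.isOpen.mem_nhds hz₁O,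
      (h.contDiffAt_y z₁ hz₁O).continuousAt.norm.eventually_lt_const hy₁,
      (continuousAt_id.sub (continuousAt_const (y := a))).norm.eventually_lt_const ha₁]
      with w hw1 hw2 hw3
    by_cases hw4 : m ≤ F w
    · exact hmax (show w ∈ T from ⟨⟨hw1, hw2.le⟩, (show ‖w - a‖ < δ from hw3).le, hw4⟩)
    · exact (not_le.1 hw4).le.trans hmF
  obtain ⟨⟨n₁, n₂, L, hlapN, hL⟩, -⟩ := h.exists_hasLap hpR hz₁O
  obtain ⟨k₁, k₂, hlapκ⟩ := hasLap_mul_norm_sub_sq κ 0 z₁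
  have hlapF := ((((h.contDiffAt_s z₁ hz₁O).hasLap.sub (hlapN.const_mul ε')).sub
    (((HasLap.const (1 : ℝ) z₁).sub (hasLap_clm (innerSL ℝ ζ) z₁)).const_mul (2 * A))).add
    (hlapκ.sub (HasLap.const κ z₁))).congr (g := F) (Eventually.of_forall fun w ↦ rfl)
  have hneg := hlapF.nonpos_of_isLocalMax hloc
  have hs := h.le_laplacian z₁ hz₁O
  set e := ‖fderiv ℝ y z₁ 1‖ ^ 2 + ‖fderiv ℝ y z₁ Complex.I‖ ^ 2
  have he : 0 ≤ e := by positivity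
  have h1 : ε' * L ≤ ε / 2 * e := by
    calc ε' * L ≤ ε' * ((4 + 16 * C * R) * e) := by gcongr
      _ = _ := by rw [← mul_assoc, hε'2]
  nlinarith

end IsPlanarData

end Planar

/-! ### Gluing of barriers, the logarithmic weight and the gradient estimate. -/

/-- Replaces the maximum of a glued function: the two barriers live on overlapping compact sets, and
the gluing is never formed as a single function. -/
theorem IsCompact.exists_isMaxOn_or {X : Type*} [TopologicalSpace X] {S T : Set X} {f g : X → ℝ}
    (hS : IsCompact S) (hT : IsCompact T) (hf : ContinuousOn f S) (hg : ContinuousOn g T) {m : ℝ}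
    (hm : (∃ z ∈ S, m < f z) ∨ ∃ z ∈ T, m < g z) :
    (∃ z ∈ S, m < f z ∧ (∀ w ∈ S, f w ≤ f z) ∧ ∀ w ∈ T, g w ≤ f z) ∨
      ∃ z ∈ T, m < g z ∧ (∀ w ∈ T, g w ≤ g z) ∧ ∀ w ∈ S, f w ≤ g z := by
  rcases S.eq_empty_or_nonempty with rfl | hSne
  · have hm' : ∃ z ∈ T, m < g z := by simpa using hm
    obtain ⟨z, hz, hmz⟩ := hm'
    obtain ⟨w, hw, hmax⟩ := hT.exists_isMaxOn ⟨z, hz⟩ hg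
    exact Or.inr ⟨w, hw, hmz.trans_le (hmax hz), fun v hv ↦ hmax hv, by simp⟩
  rcases T.eq_empty_or_nonempty with rfl | hTne
  · have hm' : ∃ z ∈ S, m < f z := by simpa using hm
    obtain ⟨z, hz, hmz⟩ := hm'
    obtain ⟨w, hw, hmax⟩ := hS.exists_isMaxOn ⟨z, hz⟩ hf
    exact Or.inl ⟨w, hw, hmz.trans_le (hmax hz), fun v hv ↦ hmax hv, by simp⟩
  obtain ⟨v, hv, hvmax⟩ := hS.exists_isMaxOn hSne hf
  obtain ⟨w, hw, hwmax⟩ := hT.exists_isMaxOn hTne hg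
  have hmm : m < max (f v) (g w) := by
    rcases hm with ⟨z, hz, hmz⟩ | ⟨z, hz, hmz⟩
    · exact lt_max_of_lt_left (hmz.trans_le (hvmax hz))
    · exact lt_max_of_lt_right (hmz.trans_le (hwmax hz))
  rcases le_total (g w) (f v) with hle | hle
  · rw [max_eq_left hle] at hmm
    exact Or.inl ⟨v, hv, hmm, fun z hz ↦ hvmax hz, fun z hz ↦ (hwmax hz).trans hle⟩
  · rw [max_eq_right hle] at hmm
    exact Or.inr ⟨w, hw, hmm, fun z hz ↦ hwmax hz, fun z hz ↦ (hvmax hz).trans hle⟩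

/-- The logarithm of the weight `(r / |z - z₀|) ^ (2 - κ) * exp (κ |z - z₀|²)`. -/
noncomputable def logWeight (z₀ : ℂ) (r κ : ℝ) (z : ℂ) : ℝ :=
  -(2 - κ) * (Real.log ‖z - z₀‖ - Real.log r) + κ * ‖z - z₀‖ ^ 2

theorem continuousAt_logWeight {z₀ z : ℂ} (r κ : ℝ) (hz : z ≠ z₀) :
    ContinuousAt (logWeight z₀ r κ) z := by
  have h1 : ContinuousAt (fun z ↦ Real.log ‖z - z₀‖) z :=
    ContinuousAt.log (by fun_prop) (norm_ne_zero_iff.2 (sub_ne_zero.2 hz))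
  unfold logWeight
  fun_prop

/-- The logarithm is harmonic off its pole. A positive κ serves twice: it makes the weight strictly
subharmonic and leaves the pole weaker than the double zero it has to cancel. -/
theorem hasLap_logWeight {z₀ z : ℂ} (r κ : ℝ) (hz : z ≠ z₀) :
    ∃ a₁ a₂, HasLap (logWeight z₀ r κ) z a₁ a₂ (4 * κ) := by
  obtain ⟨a₁, a₂, h1⟩ := hasLap_log_norm_sub hz
  obtain ⟨b₁, b₂, h2⟩ := hasLap_mul_norm_sub_sq κ z₀ z
  exact ⟨_, _, (((h1.sub (HasLap.const (Real.log r) z)).const_mul (-(2 - κ))).add h2).congr_lap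
    (by ring)⟩

theorem logWeight_eq_of_norm_eq {z₀ z : ℂ} {r : ℝ} (κ : ℝ) (h : ‖z - z₀‖ = r) :
    logWeight z₀ r κ z = κ * r ^ 2 := by
  simp [logWeight, h]

section Planar

variable {E : Type*} [NormedAddCommGroup E] [InnerProductSpace ℝ E]
variable {O : Set ℂ} {y : ℂ → E} {s : ℂ → ℝ} {G : E → E →L[ℝ] E →L[ℝ] ℝ} {R C ε : ℝ}

namespace IsPlanarData

variable (h : IsPlanarData O y s G R C ε)
include h

/-- Near `z₀`, the logarithmic barrier with pole `z₀` is small on small circles. -/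
theorem eventually_barrier_le {z₀ : ℂ} (hz₀ : z₀ ∈ O) {r κ b m : ℝ} (hκ : 0 < κ)
    (hm : 0 < m) : ∀ᶠ σ in 𝓝[>] (0 : ℝ), ∀ z, ‖z - z₀‖ = σ →
      2 * ‖y z - y z₀‖ ^ 2 * Real.exp (b + logWeight z₀ r κ z) ≤ m := by
  obtain ⟨l, hl, hlip⟩ := ((h.contDiffAt_y z₀ hz₀).differentiableAt
    (by simp)).hasFDerivAt.isBigO_sub.exists_pos
  obtain ⟨τ, hτ, hball⟩ := Metric.eventually_nhds_iff_ball.1 hlip.bound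
  set D := Real.log (2 * l ^ 2) + b + (2 - κ) * Real.log r + κ with hD
  have hlog : ∀ᶠ σ in 𝓝[>] (0 : ℝ), Real.log σ < (Real.log m - D) / κ :=
    Real.tendsto_log_nhdsGT_zero.eventually_lt_atBot _
  filter_upwards [hlog, self_mem_nhdsWithin, Ioo_mem_nhdsGT (lt_min hτ one_pos)]
    with σ hσ hσ0 hσ1 z hz
  have hσ0' : 0 < σ := hσ0
  have hσ1' : σ < 1 := hσ1.2.trans_le (min_le_right _ _)
  have h1 := hball z (mem_ball_iff_norm.2 (hz.trans_lt (hσ1.2.trans_le (min_le_left _ _))))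
  rw [hz] at h1
  have h2 : 2 * ‖y z - y z₀‖ ^ 2 ≤ 2 * l ^ 2 * σ ^ 2 := by
    have : ‖y z - y z₀‖ ^ 2 ≤ (l * σ) ^ 2 := by gcongr
    linarith
  have h3 : 2 * l ^ 2 * σ ^ 2 = Real.exp (Real.log (2 * l ^ 2) + 2 * Real.log σ) := by
    rw [Real.exp_add, Real.exp_log (by positivity), two_mul (Real.log σ), Real.exp_add,
      Real.exp_log hσ0', pow_two σ]
  refine (mul_le_mul_of_nonneg_right h2 (Real.exp_pos _).le).trans ?_
  rw [h3, ← Real.exp_add, ← Real.le_log_iff_exp_le hm, logWeight, hz]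
  have h4 : κ * Real.log σ ≤ Real.log m - D := by
    rw [lt_div_iff₀ hκ] at hσ
    linarith
  have h5 : κ * σ ^ 2 ≤ κ := mul_le_of_le_one_right hκ.le (pow_le_one₀ hσ0'.le hσ1'.le)
  rw [hD] at h4
  linarith

end IsPlanarData

end Planar

section Planar

variable {E : Type*} [NormedAddCommGroup E] [InnerProductSpace ℝ E]

/-- The exponent of the barrier function around `z₀`. -/
noncomputable def barrierExp (y : ℂ → E) (s : ℂ → ℝ) (G : E → E →L[ℝ] E →L[ℝ] ℝ) (C A ε' : ℝ)
    (z₀ : ℂ) (κ : ℝ) (z : ℂ) : ℝ :=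
  48 * C * √(G (y z₀) (y z - y z₀) (y z - y z₀)) +
    A / (1 - ‖z₀‖) * (s z - ε' * G (y z₀) (y z - y z₀) (y z - y z₀)) +
    logWeight z₀ ((1 - ‖z₀‖) / 2) κ z

variable {O : Set ℂ} {y : ℂ → E} {s : ℂ → ℝ} {G : E → E →L[ℝ] E →L[ℝ] ℝ} {R C ε : ℝ}

namespace IsPlanarData

variable (h : IsPlanarData O y s G R C ε)
include h

theorem continuousAt_barrierExp {A ε' : ℝ} {z₀ : ℂ} {κ : ℝ} {z : ℂ} (hz : z ∈ O) (hne : z ≠ z₀) :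
    ContinuousAt (barrierExp y s G C A ε' z₀ κ) z := by
  have h1 := h.continuousAt_form (y z₀) hz
  have h2 := (h.contDiffAt_s z hz).continuousAt
  have h3 := continuousAt_logWeight (z₀ := z₀) ((1 - ‖z₀‖) / 2) κ hne
  unfold barrierExp
  exact ((continuousAt_const.mul h1.sqrt).add
    (continuousAt_const.mul (h2.sub (continuousAt_const.mul h1)))).add h3

theorem isOpen_form_lt (p : E) (t : ℝ) :
    IsOpen {z | z ∈ O ∧ G p (y z - p) (y z - p) < t} := by
  refine isOpen_iff_mem_nhds.2 fun z hz ↦ ?_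
  filter_upwards [h.isOpen.mem_nhds hz.1, (h.continuousAt_form p hz.1).eventually_lt_const hz.2]
    with w hw1 hw2
  exact ⟨hw1, hw2⟩

theorem mem_of_mem_closure_form_le {p : E} {t r : ℝ} (hr : r < R)
    (hle : ∀ z ∈ O, G p (y z - p) (y z - p) ≤ t → ‖y z‖ ≤ r) {z : ℂ} (hz1 : z ∈ ball (0 : ℂ) 1)
    (hz : z ∈ closure {z | z ∈ O ∧ G p (y z - p) (y z - p) ≤ t}) :
    z ∈ O ∧ G p (y z - p) (y z - p) ≤ t := by
  have hzO : z ∈ O := h.mem_of_mem_closure r hr z hz1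
    (closure_mono (t := {w ∈ O | ‖y w‖ ≤ r}) (fun w hw ↦ ⟨hw.1, hle w hw.1 hw.2⟩) hz)
  refine ⟨hzO, ?_⟩
  by_contra! hlt
  obtain ⟨w, hw, hw'⟩ := ((mem_closure_iff_frequently.1 hz).and_eventually
    ((h.continuousAt_form p hzO).eventually_const_lt hlt)).exists
  exact absurd hw.2 (not_le.2 hw')

/-- The logarithm of the barrier function has no interior local maxima where it is finite. -/
theorem not_isLocalMax_log_barrier {z₀ z : ℂ} (hz : z ∈ O) (hz₀ : z₀ ∈ O) (hne : y z ≠ y z₀)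
    {A ε' κ : ℝ} (hA : 0 < A) (hκ : 0 < κ) (hε' : 0 ≤ ε')
    (hε'2 : ε' * (4 + 16 * C * R) ≤ ε / 2) (hAC : 384 * C ^ 2 ≤ A * ε) :
    ¬ IsLocalMax (fun w ↦ G (y z₀) (y w - y z₀) (y w - y z₀) *
      Real.exp (barrierExp y s G C A ε' z₀ κ w)) z := by
  intro hmax
  have hd1 : 1 - ‖z₀‖ ≤ 1 := by linarith [norm_nonneg z₀]
  have hd0 : 0 < 1 - ‖z₀‖ := by linarith [mem_ball_zero_iff.1 (h.subset_ball hz₀)]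
  set d := 1 - ‖z₀‖ with hd
  have hzz : z ≠ z₀ := fun heq ↦ hne (by rw [heq])
  have hp := (h.norm_lt z₀ hz₀).le
  obtain ⟨⟨n₁, n₂, LN, hlapN, hLN⟩, hlog⟩ := h.exists_hasLap hp hz
  obtain ⟨l₁, l₂, Ll, hlapl, hLl⟩ := hlog hne
  obtain ⟨w₁, w₂, hlapw⟩ := hasLap_logWeight (d / 2) κ hzz
  have hsum := (hlapl.add (((h.contDiffAt_s z hz).hasLap.sub (hlapN.const_mul ε')).const_mul
    (A / d))).add hlapw
  have hNpos : 0 < G (y z₀) (y z - y z₀) (y z - y z₀) := by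
    have h1 := (h.form_bounds _ (mem_closedBall_zero_iff.2 hp) (y z - y z₀)).1
    have h2 : 0 < ‖y z - y z₀‖ := norm_pos_iff.2 (sub_ne_zero.2 hne)
    exact lt_of_lt_of_le (by positivity) h1
  have hmax' : IsLocalMax (fun w ↦ Real.log (G (y z₀) (y w - y z₀) (y w - y z₀)) +
      48 * C * √(G (y z₀) (y w - y z₀) (y w - y z₀)) +
      A / d * (s w - ε' * G (y z₀) (y w - y z₀) (y w - y z₀)) + logWeight z₀ (d / 2) κ w) z := by
    filter_upwards [hmax, (h.continuousAt_form (y z₀) hz).eventually_const_lt hNpos]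
      with w hw hNw
    have h1 := Real.log_le_log (by positivity) hw
    rw [Real.log_mul hNw.ne' (Real.exp_pos _).ne', Real.log_mul hNpos.ne' (Real.exp_pos _).ne',
      Real.log_exp, Real.log_exp] at h1
    simp only [barrierExp, ← hd] at h1
    linarith
  have hneg := hsum.nonpos_of_isLocalMax hmax'
  have hs := h.le_laplacian z hz
  set e := ‖fderiv ℝ y z 1‖ ^ 2 + ‖fderiv ℝ y z Complex.I‖ ^ 2
  have he : 0 ≤ e := by positivity
  have h1 : ε' * LN ≤ ε / 2 * e := by
    calc ε' * LN ≤ ε' * ((4 + 16 * C * R) * e) := by gcongr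
      _ = ε' * (4 + 16 * C * R) * e := by ring
      _ ≤ _ := by gcongr
  have h2 : ε / 2 * e ≤ Δ s z - ε' * LN := by linarith
  have h3 : A * (ε / 2 * e) ≤ A / d * (Δ s z - ε' * LN) := by
    have hε := h.ε_pos
    calc A * (ε / 2 * e) ≤ A / d * (ε / 2 * e) := by
          refine mul_le_mul_of_nonneg_right ?_ (by positivity)
          rw [le_div_iff₀ hd0]
          nlinarith
      _ ≤ _ := by gcongr
  nlinarith

set_option maxHeartbeats 1600000 in
/-- The two-sided barrier estimate around `z₀`. -/
theorem barrier_estimate {z₀ : ℂ} (hz₀ : z₀ ∈ O) {A ε' κ K₁ K : ℝ}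
    (hA : 0 < A) (hκ : 0 < κ) (hε' : 0 < ε')
    (hε'2 : ε' * (4 + 16 * C * R) ≤ ε / 2) (hAC : 384 * C ^ 2 ≤ A * ε)
    (hy₀ : ‖y z₀‖ ≤ R / 16) (hK : 1 ≤ K) (hKd : K * (1 - ‖z₀‖) ≤ 1)
    (hKR : 128 * (K * (1 - ‖z₀‖)) ≤ R ^ 2)
    (hs : ∀ z ∈ O, ‖z - z₀‖ ≤ (1 - ‖z₀‖) / 2 → ‖y z‖ ≤ R / 4 → s z ≤ 2 * K₁ * (1 - ‖z₀‖))
    (hK₁ : Real.log K + 48 * C + 2 * A * K₁ + A * ε' < A * ε' * K)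
    {z : ℂ} (hzz₀ : z ≠ z₀) (hz : ‖z - z₀‖ ≤ (1 - ‖z₀‖) / 2) :
    (z ∈ O → G (y z₀) (y z - y z₀) (y z - y z₀) ≤ K * (1 - ‖z₀‖) →
      G (y z₀) (y z - y z₀) (y z - y z₀) * Real.exp (barrierExp y s G C A ε' z₀ κ z) ≤
        (1 - ‖z₀‖) * K * Real.exp (48 * C + 2 * A * K₁ + κ)) ∧
    (¬ (z ∈ O ∧ G (y z₀) (y z - y z₀) (y z - y z₀) < 1 - ‖z₀‖) →
      (1 - ‖z₀‖) * Real.exp (-(A * ε') + logWeight z₀ ((1 - ‖z₀‖) / 2) κ z) ≤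
        (1 - ‖z₀‖) * K * Real.exp (48 * C + 2 * A * K₁ + κ)) := by
  have hR := h.R_pos
  have hC := h.C_nonneg
  have hd1 : 1 - ‖z₀‖ ≤ 1 := by linarith [norm_nonneg z₀]
  have hd0 : 0 < 1 - ‖z₀‖ := by linarith [mem_ball_zero_iff.1 (h.subset_ball hz₀)]
  have hcball : closedBall z₀ ((1 - ‖z₀‖) / 2) ⊆ ball 0 1 := fun w hw ↦ by
    rw [mem_ball_zero_iff]
    have h1 := mem_closedBall_iff_norm.1 hw
    have h2 := norm_le_norm_add_norm_sub' w z₀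
    linarith
  have hbexp : ∀ w, barrierExp y s G C A ε' z₀ κ w =
      48 * C * √(G (y z₀) (y w - y z₀) (y w - y z₀)) +
      A / (1 - ‖z₀‖) * (s w - ε' * G (y z₀) (y w - y z₀) (y w - y z₀)) +
      logWeight z₀ ((1 - ‖z₀‖) / 2) κ w := fun w ↦ rfl
  set d := 1 - ‖z₀‖ with hd
  set p := y z₀ with hp
  have hpR : ‖p‖ ≤ R := by linarith
  let N : ℂ → ℝ := fun w ↦ G p (y w - p) (y w - p)
  have hNnn : ∀ w, 0 ≤ N w := fun w ↦ h.form_nonneg hpR _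
  have hNle : ∀ w ∈ O, N w ≤ K * d → ‖y w‖ ≤ R / 4 := fun w hw hNw ↦ by
    have h1 := (h.form_bounds p (mem_closedBall_zero_iff.2 hpR) (y w - p)).1
    have h2 : ‖y w - p‖ ≤ R / 8 := by
      refine le_of_sq_le_sq ?_ (by positivity)
      have : ‖y w - p‖ ^ 2 ≤ 2 * N w := by simp only [N]; linarith
      nlinarith
    have h3 := norm_le_norm_add_norm_sub' (y w) p
    linarith
  have hsd : ∀ w ∈ O, ‖w - z₀‖ ≤ d / 2 → N w ≤ K * d →
      A / d * (s w - ε' * N w) ≤ 2 * A * K₁ - A * ε' * N w / d := fun w hw hwz hNw ↦ by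
    have h1 := hs w hw hwz (hNle w hw hNw)
    have h2 : A / d * s w ≤ A / d * (2 * K₁ * d) := by gcongr
    have h3 : A / d * (2 * K₁ * d) = 2 * A * K₁ := by field_simp
    have h4 : A / d * (s w - ε' * N w) = A / d * s w - A * ε' * N w / d := by ring
    linarith
  have hsqrt : ∀ w, N w ≤ K * d → 48 * C * √(N w) ≤ 48 * C := fun w hNw ↦ by
    have : √(N w) ≤ 1 := Real.sqrt_le_one.2 (hNw.trans hKd)
    exact mul_le_of_le_one_right (by positivity) this
  have hsmall : ∀ w ∈ O, ‖w - z₀‖ ≤ d / 2 → N w ≤ K * d →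
      barrierExp y s G C A ε' z₀ κ w ≤ 48 * C + 2 * A * K₁ + logWeight z₀ (d / 2) κ w := by
    intro w hw hwz hNw
    have h1 := hsd w hw hwz hNw
    have h2 := hsqrt w hNw
    have h3 : 0 ≤ A * ε' * N w / d := by have := hNnn w; positivity
    have h4 := hbexp w
    simp only [N] at h1 h2 h3
    linarith
  have hMd : (0 : ℝ) < d * K * Real.exp (48 * C + 2 * A * K₁ + κ) := by positivity
  set m := d * K * Real.exp (48 * C + 2 * A * K₁ + κ) with hm
  set W : Set ℂ := {w | w ∈ O ∧ N w < d} with hW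
  set Z : Set ℂ := {w | w ∈ O ∧ N w ≤ K * d} with hZ
  have hdK : d ≤ K * d := by nlinarith
  have hWZ : W ⊆ Z := fun w hw ↦ ⟨hw.1, hw.2.le.trans hdK⟩
  have hWopen : IsOpen W := h.isOpen_form_lt p d
  have hNz₀ : N z₀ = 0 := by simp [N, hp]
  have hz₀W : z₀ ∈ W := ⟨hz₀, by rw [hNz₀]; exact hd0⟩
  -- Two competitors: f makes sense only inside the chart and is used where N ≤ Kd, while g is
  -- defined off z₀ whether or not u is in the chart, and is used where N < d fails. On the overlap
  -- both count, so the glued function is f near z₀ and g far away.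
  let f : ℂ → ℝ := fun w ↦ N w * Real.exp (barrierExp y s G C A ε' z₀ κ w)
  let g : ℂ → ℝ := fun w ↦ d * Real.exp (-(A * ε') + logWeight z₀ (d / 2) κ w)
  have hκd : κ * (d / 2) ^ 2 ≤ κ :=
    mul_le_of_le_one_right hκ.le (pow_le_one₀ (by linarith) (by linarith))
  by_contra hcon
  have hev1 := h.eventually_barrier_le (r := d / 2) (b := 48 * C + 2 * A * K₁) hz₀ hκ hMd
  have hev2 : ∀ᶠ σ in 𝓝[>] (0 : ℝ), σ ∈ Ioo 0 ‖z - z₀‖ :=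
    Ioo_mem_nhdsGT (norm_pos_iff.2 (sub_ne_zero.2 hzz₀))
  have hev3 : ∀ᶠ σ in 𝓝[>] (0 : ℝ), ∀ w, ‖w - z₀‖ = σ → w ∈ W := by
    obtain ⟨τ, hτ, hball⟩ := Metric.isOpen_iff.1 hWopen z₀ hz₀W
    filter_upwards [mem_nhdsWithin_of_mem_nhds (gt_mem_nhds hτ)] with σ hσ w hw
    exact hball (mem_ball_iff_norm.2 (hw.trans_lt hσ))
  -- A small disc around the pole is removed. On its boundary circle f ≤ m and g does not compete,
  -- so an offending maximum cannot lie there.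
  obtain ⟨σ, hσ1, ⟨hσ0, hσz⟩, hσW⟩ := (hev1.and (hev2.and hev3)).exists
  set An : Set ℂ := {w | σ ≤ ‖w - z₀‖ ∧ ‖w - z₀‖ ≤ d / 2} with hAn
  have hcn : Continuous fun w : ℂ ↦ ‖w - z₀‖ := by fun_prop
  have hAnc : IsClosed An :=
    (isClosed_le continuous_const hcn).inter (isClosed_le hcn continuous_const)
  have hAnb : An ⊆ closedBall z₀ (d / 2) := fun w hw ↦ mem_closedBall_iff_norm.2 hw.2
  have hAnne : ∀ w ∈ An, w ≠ z₀ := fun w hw heq ↦ by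
    have := hw.1
    rw [heq, sub_self, norm_zero] at this
    linarith
  have hZcl : ∀ w ∈ ball (0 : ℂ) 1, w ∈ closure Z → w ∈ Z := fun w hw hwZ ↦
    h.mem_of_mem_closure_form_le (r := R / 4) (by linarith) hNle hw hwZ
  have hZ'cl : ∀ w ∈ ball (0 : ℂ) 1, w ∈ closure {w | w ∈ O ∧ N w ≤ d} → w ∈ O ∧ N w ≤ d :=
    fun w hw hwZ ↦ h.mem_of_mem_closure_form_le (r := R / 4) (by linarith)
      (fun v hv hvN ↦ hNle v hv (le_trans hvN hdK)) hw hwZ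
  have hT1 : IsCompact (An ∩ Z) := by
    refine Metric.isCompact_of_isClosed_isBounded (isClosed_of_closure_subset fun w hw ↦ ?_)
      (isBounded_closedBall.subset (inter_subset_left.trans hAnb))
    have hwA : w ∈ An := hAnc.closure_subset (closure_mono inter_subset_left hw)
    exact ⟨hwA, hZcl w (hcball (hAnb hwA)) (closure_mono inter_subset_right hw)⟩
  have hT2 : IsCompact (An ∩ Wᶜ) := Metric.isCompact_of_isClosed_isBounded
    (hAnc.inter hWopen.isClosed_compl) (isBounded_closedBall.subset (inter_subset_left.trans hAnb))
  have hfc : ContinuousOn f (An ∩ Z) := fun w hw ↦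
    ((h.continuousAt_form p hw.2.1).mul
      (h.continuousAt_barrierExp hw.2.1 (hAnne w hw.1)).rexp).continuousWithinAt
  have hgc : ContinuousOn g (An ∩ Wᶜ) := fun w hw ↦
    (continuousAt_const.mul (continuousAt_const.add
      (continuousAt_logWeight _ _ (hAnne w hw.1))).rexp).continuousWithinAt
  have hzA : z ∈ An := ⟨hσz.le, hz⟩
  have hbad : (∃ w ∈ An ∩ Z, m < f w) ∨ ∃ w ∈ An ∩ Wᶜ, m < g w := by
    by_contra! hall
    exact hcon ⟨fun hzO hzN ↦ hall.1 z ⟨hzA, hzO, hzN⟩, fun hzW ↦ hall.2 z ⟨hzA, hzW⟩⟩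
  have hAnnhds : ∀ w, σ < ‖w - z₀‖ → ‖w - z₀‖ < d / 2 → An ∈ 𝓝 w := fun w h1 h2 ↦ by
    have hc : ContinuousAt (fun w ↦ ‖w - z₀‖) w := by fun_prop
    filter_upwards [hc.eventually_const_lt h1, hc.eventually_lt_const h2] with v h3 h4
    exact ⟨h3.le, h4.le⟩
  rcases hT1.exists_isMaxOn_or hT2 hfc hgc hbad with ⟨w, hw, hmw, hmax, hmax'⟩ |
    ⟨w, hw, hmw, hmax, hmax'⟩
  · obtain ⟨hwA, hwO, hwN⟩ := hw
    have hexp := hsmall w hwO hwA.2 hwN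
    have hNpos : 0 < N w := by
      refine (hNnn w).lt_of_ne fun h0 ↦ ?_
      have : f w = 0 := by simp only [f, ← h0, zero_mul]
      linarith
    have h1 : ‖w - z₀‖ < d / 2 := by
      refine hwA.2.lt_of_ne fun heq ↦ ?_
      rw [logWeight_eq_of_norm_eq κ heq] at hexp
      have : f w ≤ m := by
        calc f w ≤ (K * d) * Real.exp (48 * C + 2 * A * K₁ + κ) := by
              simp only [f]
              gcongr
              linarith
          _ = m := by rw [hm]; ring
      linarith
    have h2 : σ < ‖w - z₀‖ := by
      refine hwA.1.lt_of_ne fun heq ↦ ?_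
      have h3 := hσ1 w heq.symm
      have h4 := (h.form_bounds p (mem_closedBall_zero_iff.2 hpR) (y w - p)).2
      have : f w ≤ 2 * ‖y w - p‖ ^ 2 *
          Real.exp (48 * C + 2 * A * K₁ + logWeight z₀ (d / 2) κ w) :=
        mul_le_mul h4 (Real.exp_le_exp.2 hexp) (Real.exp_pos _).le (by positivity)
      linarith
    -- On the outer interface N = Kd the term -Aε'N/d beats log K by the choice of K, so f < g there
    -- and f cannot carry the maximum.
    have h3 : N w < K * d := by
      refine hwN.lt_of_ne fun heq ↦ ?_
      have hwW : w ∈ Wᶜ := fun hwW ↦ by linarith [hwW.2]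
      have h4 := hmax' w ⟨hwA, hwW⟩
      have h5 := hsd w hwO hwA.2 hwN
      have h6 := hsqrt w hwN
      have h7 : A * ε' * N w / d = A * ε' * K := by rw [heq]; field_simp
      have h8 := hbexp w
      have h9 : f w < g w := by
        have e1 : f w = d * Real.exp (Real.log K + barrierExp y s G C A ε' z₀ κ w) := by
          simp only [f]
          rw [heq, Real.exp_add, Real.exp_log (by linarith)]; ring
        rw [e1]
        simp only [g]
        refine mul_lt_mul_of_pos_left (Real.exp_lt_exp.2 ?_) hd0
        simp only [N] at h5 h6 h7
        linarith
      linarith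
    refine h.not_isLocalMax_log_barrier hwO hz₀ (z := w) (A := A) (ε' := ε') (κ := κ) ?_
      hA hκ hε'.le hε'2 hAC ?_
    · intro heq
      have : N w = 0 := by simp [N, heq, hp]
      linarith
    · filter_upwards [hAnnhds w h2 h1, (h.isOpen_form_lt p (K * d)).mem_nhds ⟨hwO, h3⟩]
        with v hv1 hv2
      exact hmax v ⟨hv1, hv2.1, hv2.2.le⟩
  · obtain ⟨hwA, hwW⟩ := hw
    have h1 : ‖w - z₀‖ < d / 2 := by
      refine hwA.2.lt_of_ne fun heq ↦ ?_
      have : g w ≤ m := by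
        simp only [g]
        rw [logWeight_eq_of_norm_eq κ heq, hm, mul_assoc]
        refine mul_le_mul_of_nonneg_left ?_ hd0.le
        rw [show Real.exp (-(A * ε') + κ * (d / 2) ^ 2) =
          1 * Real.exp (-(A * ε') + κ * (d / 2) ^ 2) from (one_mul _).symm]
        refine mul_le_mul hK (Real.exp_le_exp.2 ?_) (Real.exp_pos _).le (by linarith)
        have h2 := hs z₀ hz₀ (by simp; linarith) (by rw [← hp]; linarith)
        have h3 := h.s_pos z₀ hz₀
        have h4 : 0 ≤ K₁ := by
          by_contra! hneg
          nlinarith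
        have : 0 ≤ A * K₁ := by positivity
        have : 0 ≤ A * ε' := by positivity
        linarith
      linarith
    have h2 : σ < ‖w - z₀‖ := hwA.1.lt_of_ne fun heq ↦ hwW (hσW w heq.symm)
    -- On the inner interface N = d positivity of s gives g < f, so g cannot carry the maximum. Off
    -- that closed set g competes in a full neighbourhood, where strict subharmonicity of the weight
    -- excludes it.
    have h3 : ¬ (w ∈ O ∧ N w ≤ d) := by
      rintro ⟨hwO, hwN⟩
      have heq : N w = d := hwN.antisymm (not_lt.1 fun hlt ↦ hwW ⟨hwO, hlt⟩)
      have h4 := hmax' w ⟨hwA, hwO, hwN.trans hdK⟩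
      have h5 : g w < f w := by
        simp only [f, g]
        rw [heq]
        refine mul_lt_mul_of_pos_left (Real.exp_lt_exp.2 ?_) hd0
        have h6 := hbexp w
        have h7 : 0 ≤ 48 * C * √(N w) := by positivity
        have h8 : A / d * (s w - ε' * N w) = A / d * s w - A * ε' := by
          rw [heq]; field_simp
        have h9 : 0 < A / d * s w := by
          have := h.s_pos w hwO
          positivity
        simp only [N] at h7 h8
        linarith
      linarith
    have hnhds : ∀ᶠ v in 𝓝 w, ¬ (v ∈ O ∧ N v ≤ d) := by
      by_contra hfr
      rw [not_eventually] at hfr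
      simp only [not_not] at hfr
      exact h3 (hZ'cl w (hcball (hAnb hwA)) (mem_closure_iff_frequently.2 hfr))
    have hloc : IsLocalMax (logWeight z₀ (d / 2) κ) w := by
      filter_upwards [hAnnhds w h2 h1, hnhds] with v hv1 hv2
      have h4 := hmax v ⟨hv1, fun hvW ↦ hv2 ⟨hvW.1, hvW.2.le⟩⟩
      simp only [g] at h4
      have h5 := Real.exp_le_exp.1 (le_of_mul_le_mul_left h4 hd0)
      linarith
    obtain ⟨a₁, a₂, hl⟩ := hasLap_logWeight (d / 2) κ (hAnne w hwA)
    have := hl.nonpos_of_isLocalMax hloc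
    linarith

end IsPlanarData

end Planar

/-- The logarithm is sublinear. This supplies the ratio K between the two interfaces of the glued
barrier. -/
theorem exists_log_add_lt_mul {α : ℝ} (hα : 0 < α) (β : ℝ) :
    ∃ K : ℝ, 1 ≤ K ∧ Real.log K + β < α * K := by
  have h1 : ∀ᶠ K : ℝ in atTop, Real.log K ≤ α / 2 * K := by
    have := Real.isLittleO_log_id_atTop.def (c := α / 2) (by positivity)
    filter_upwards [this, eventually_ge_atTop 0] with K hK hK0
    have h2 := (le_abs_self _).trans hK
    rwa [id, Real.norm_of_nonneg hK0] at h2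
  have h2 : ∀ᶠ K : ℝ in atTop, β < α / 2 * K :=
    (tendsto_id.const_mul_atTop (by positivity : 0 < α / 2)).eventually_gt_atTop β
  obtain ⟨K, hK1, hK2, hK3⟩ := (h1.and (h2.and (eventually_ge_atTop 1))).exists
  exact ⟨K, hK3, by linarith⟩

theorem exp_logWeight_zero {z₀ z : ℂ} {r : ℝ} (hr : 0 < r) (hz : z ≠ z₀) :
    Real.exp (-logWeight z₀ r 0 z) = ‖z - z₀‖ ^ 2 / r ^ 2 := by
  have h0 : 0 < ‖z - z₀‖ := norm_pos_iff.2 (sub_ne_zero.2 hz)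
  have h1 : -logWeight z₀ r 0 z = (Real.log ‖z - z₀‖ - Real.log r) +
      (Real.log ‖z - z₀‖ - Real.log r) := by
    simp only [logWeight]; ring
  rw [h1, Real.exp_add, Real.exp_sub, Real.exp_log h0, Real.exp_log hr]
  ring

theorem continuous_logWeight_param (z₀ z : ℂ) (r : ℝ) :
    Continuous fun κ ↦ logWeight z₀ r κ z := by
  unfold logWeight
  fun_prop

section Planar

variable {E : Type*} [NormedAddCommGroup E] [InnerProductSpace ℝ E]
variable {O : Set ℂ} {y : ℂ → E} {s : ℂ → ℝ} {G : E → E →L[ℝ] E →L[ℝ] ℝ} {R C ε : ℝ}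

namespace IsPlanarData

variable (h : IsPlanarData O y s G R C ε)
include h

/-- The limit κ → 0 of the two barrier bounds, divided by the weight, which becomes exactly (r/|z -
z₀|)² with r half the distance to the circle. -/
theorem barrier_estimate_zero {z₀ : ℂ} (hz₀ : z₀ ∈ O) {A ε' K₁ K : ℝ}
    (hA : 0 < A) (hε' : 0 < ε')
    (hε'2 : ε' * (4 + 16 * C * R) ≤ ε / 2) (hAC : 384 * C ^ 2 ≤ A * ε)
    (hy₀ : ‖y z₀‖ ≤ R / 16) (hK : 1 ≤ K) (hKd : K * (1 - ‖z₀‖) ≤ 1)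
    (hKR : 128 * (K * (1 - ‖z₀‖)) ≤ R ^ 2)
    (hs : ∀ z ∈ O, ‖z - z₀‖ ≤ (1 - ‖z₀‖) / 2 → ‖y z‖ ≤ R / 4 → s z ≤ 2 * K₁ * (1 - ‖z₀‖))
    (hK₁ : Real.log K + 48 * C + 2 * A * K₁ + A * ε' < A * ε' * K)
    {z : ℂ} (hzz₀ : z ≠ z₀) (hz : ‖z - z₀‖ ≤ (1 - ‖z₀‖) / 2) :
    (z ∈ O → G (y z₀) (y z - y z₀) (y z - y z₀) ≤ K * (1 - ‖z₀‖) →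
      G (y z₀) (y z - y z₀) (y z - y z₀) * (1 - ‖z₀‖) ≤
        4 * K * Real.exp (48 * C + 2 * A * K₁ + A * ε' * K) * ‖z - z₀‖ ^ 2) ∧
    (¬ (z ∈ O ∧ G (y z₀) (y z - y z₀) (y z - y z₀) < 1 - ‖z₀‖) →
      (1 - ‖z₀‖) ^ 2 ≤
        4 * K * Real.exp (48 * C + 2 * A * K₁ + A * ε') * ‖z - z₀‖ ^ 2) := by
  have hest := fun κ (hκ : κ ∈ Ioi (0 : ℝ)) ↦ h.barrier_estimate hz₀ hA (mem_Ioi.1 hκ) hε' hε'2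
    hAC hy₀ hK hKd hKR hs hK₁ hzz₀ hz
  have hd0 : 0 < 1 - ‖z₀‖ := by linarith [mem_ball_zero_iff.1 (h.subset_ball hz₀)]
  have hwt := exp_logWeight_zero (r := (1 - ‖z₀‖) / 2) (by positivity) hzz₀
  have hcont := continuous_logWeight_param z₀ z ((1 - ‖z₀‖) / 2)
  have hbexp : ∀ κ, barrierExp y s G C A ε' z₀ κ z =
      48 * C * √(G (y z₀) (y z - y z₀) (y z - y z₀)) +
      A / (1 - ‖z₀‖) * (s z - ε' * G (y z₀) (y z - y z₀) (y z - y z₀)) +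
      logWeight z₀ ((1 - ‖z₀‖) / 2) κ z := fun w ↦ rfl
  have hN := h.form_nonneg (h.norm_lt z₀ hz₀).le (y z - y z₀)
  set d := 1 - ‖z₀‖ with hd
  set N := G (y z₀) (y z - y z₀) (y z - y z₀) with hNdef
  have hC := h.C_nonneg
  constructor
  · intro hzO hNK
    have h1 : N * Real.exp (barrierExp y s G C A ε' z₀ 0 z) ≤
        d * K * Real.exp (48 * C + 2 * A * K₁ + 0) := by
      have hl : Continuous fun κ ↦ N * Real.exp (barrierExp y s G C A ε' z₀ κ z) := by
        simp only [hbexp]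
        fun_prop
      have hr : Continuous fun κ : ℝ ↦ d * K * Real.exp (48 * C + 2 * A * K₁ + κ) := by fun_prop
      refine le_of_tendsto_of_tendsto (hl.continuousWithinAt (s := Ioi 0) (x := 0))
        (hr.continuousWithinAt (s := Ioi 0) (x := 0)) ?_
      filter_upwards [self_mem_nhdsWithin] with κ hκ
      exact (hest κ hκ).1 hzO hNK
    have h2 : -(A * ε' * K) + logWeight z₀ (d / 2) 0 z ≤ barrierExp y s G C A ε' z₀ 0 z := by
      rw [hbexp]
      have h3 : A / d * (s z - ε' * N) = A / d * s z - A * ε' * (N / d) := by ring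
      have h4 : 0 < A / d * s z := by have := h.s_pos z hzO; positivity
      have h5 : A * ε' * (N / d) ≤ A * ε' * K := by
        have : N / d ≤ K := by rwa [div_le_iff₀ hd0]
        gcongr
      have h6 : 0 ≤ 48 * C * √N := by positivity
      linarith
    have h3 : N * Real.exp (-(A * ε' * K) + logWeight z₀ (d / 2) 0 z) ≤
        d * K * Real.exp (48 * C + 2 * A * K₁) := by
      rw [add_zero] at h1
      exact (mul_le_mul_of_nonneg_left (Real.exp_le_exp.2 h2) hN).trans h1
    have h4 := mul_le_mul_of_nonneg_right h3
      (Real.exp_pos (A * ε' * K + -logWeight z₀ (d / 2) 0 z)).le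
    rw [mul_assoc, ← Real.exp_add] at h4
    have h5 : -(A * ε' * K) + logWeight z₀ (d / 2) 0 z +
      (A * ε' * K + -logWeight z₀ (d / 2) 0 z) = 0 := by ring
    rw [h5, Real.exp_zero, mul_one, Real.exp_add (A * ε' * K), hwt] at h4
    rw [Real.exp_add _ (A * ε' * K)]
    calc N * d ≤ _ := mul_le_mul_of_nonneg_right h4 hd0.le
      _ = _ := by field_simp; ring
  · intro hzW
    have h1 : d * Real.exp (-(A * ε') + logWeight z₀ (d / 2) 0 z) ≤
        d * K * Real.exp (48 * C + 2 * A * K₁ + 0) := by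
      have hl : Continuous fun κ ↦ d * Real.exp (-(A * ε') + logWeight z₀ (d / 2) κ z) := by
        fun_prop
      have hr : Continuous fun κ : ℝ ↦ d * K * Real.exp (48 * C + 2 * A * K₁ + κ) := by fun_prop
      refine le_of_tendsto_of_tendsto (hl.continuousWithinAt (s := Ioi 0) (x := 0))
        (hr.continuousWithinAt (s := Ioi 0) (x := 0)) ?_
      filter_upwards [self_mem_nhdsWithin] with κ hκ
      exact (hest κ hκ).2 hzW
    rw [add_zero] at h1
    have h4 := mul_le_mul_of_nonneg_right h1
      (Real.exp_pos (A * ε' + -logWeight z₀ (d / 2) 0 z)).le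
    rw [mul_assoc, ← Real.exp_add] at h4
    have h5 : -(A * ε') + logWeight z₀ (d / 2) 0 z +
      (A * ε' + -logWeight z₀ (d / 2) 0 z) = 0 := by ring
    rw [h5, Real.exp_zero, mul_one, Real.exp_add (A * ε'), hwt] at h4
    rw [Real.exp_add _ (A * ε')]
    calc d ^ 2 = d * d := by ring
      _ ≤ _ := mul_le_mul_of_nonneg_right h4 hd0.le
      _ = _ := by field_simp; ring

set_option maxHeartbeats 800000 in
/-- Near the boundary arc, `y` is Lipschitz with constant `K / √(1 - |z₀|)` on the disc of radius
`c (1 - |z₀|)` around `z₀`. -/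
theorem exists_norm_sub_sq_le {a : ℂ} (ha : ‖a‖ = 1) {δ₁ : ℝ} (hδ₁ : 0 < δ₁)
    (hb : ∀ b : ℂ, ‖b‖ = 1 → ‖b - a‖ < δ₁ → ∀ η > 0,
      ∀ᶠ z in 𝓝 b, z ∈ O → ‖y z‖ ≤ R / 2 → s z < η) :
    ∃ δ > 0, ∃ c > 0, ∃ K ≥ 0, ∀ z₀ ∈ O, ‖z₀ - a‖ < δ → ‖y z₀‖ ≤ R / 16 →
      ∀ z, ‖z - z₀‖ < c * (1 - ‖z₀‖) →
        z ∈ O ∧ ‖y z - y z₀‖ ^ 2 * (1 - ‖z₀‖) ≤ K * ‖z - z₀‖ ^ 2 := by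
  obtain ⟨δ₀, hδ₀, K₁, hK₁, hs⟩ := h.exists_le_mul_boundary_dist ha hδ₁ hb
  have hR := h.R_pos
  have hC := h.C_nonneg
  have hε := h.ε_pos
  set ε' := ε / (8 + 32 * C * R) with hε'
  have hε'0 : 0 < ε' := by positivity
  have hε'2 : ε' * (4 + 16 * C * R) = ε / 2 := by
    rw [hε']; field_simp; ring
  -- Makes (A/d) · (ε/2)e dominate the defect 192C²e of the logarithm, as d ≤ 1.
  set A := 384 * C ^ 2 / ε + 1 with hA
  have hA0 : 0 < A := by positivity
  have hAC : 384 * C ^ 2 ≤ A * ε := by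
    have : A * ε = 384 * C ^ 2 + ε := by rw [hA]; field_simp
    linarith
  obtain ⟨K, hK, hKlog⟩ := exists_log_add_lt_mul (α := A * ε') (by positivity)
    (48 * C + 2 * A * K₁ + A * ε')
  have hK0 : 0 < K := by linarith
  set D := 4 * K * Real.exp (48 * C + 2 * A * K₁ + A * ε') with hD
  have hD1 : 4 ≤ D := by
    have : 1 ≤ Real.exp (48 * C + 2 * A * K₁ + A * ε') := Real.one_le_exp (by positivity)
    rw [hD]
    nlinarith
  set δ := min (min (δ₀ / 2) (1 / K)) (R ^ 2 / (128 * K)) with hδ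
  have hδ0 : 0 < δ := by positivity
  refine ⟨δ, hδ0, 1 / D, by positivity,
    2 * (4 * K * Real.exp (48 * C + 2 * A * K₁ + A * ε' * K)), by positivity,
    fun z₀ hz₀ hz₀a hyz₀ z hz ↦ ?_⟩
  have hz₀1 : ‖z₀‖ < 1 := mem_ball_zero_iff.1 (h.subset_ball hz₀)
  have hd0 : 0 < 1 - ‖z₀‖ := by linarith
  have hda : 1 - ‖z₀‖ ≤ ‖z₀ - a‖ := by
    have := norm_sub_norm_le a z₀
    rwa [ha, norm_sub_rev] at this
  have hdδ : 1 - ‖z₀‖ ≤ δ := by linarith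
  have e1 : δ ≤ δ₀ / 2 := (min_le_left _ _).trans (min_le_left _ _)
  have e2 : δ ≤ 1 / K := (min_le_left _ _).trans (min_le_right _ _)
  have e3 : δ ≤ R ^ 2 / (128 * K) := min_le_right _ _
  have hKd : K * (1 - ‖z₀‖) ≤ 1 := by
    have := hdδ.trans e2
    rw [le_div_iff₀ hK0] at this
    linarith
  have hKR : 128 * (K * (1 - ‖z₀‖)) ≤ R ^ 2 := by
    have := hdδ.trans e3
    rw [le_div_iff₀ (by positivity)] at this
    linarith
  have hs' : ∀ z ∈ O, ‖z - z₀‖ ≤ (1 - ‖z₀‖) / 2 → ‖y z‖ ≤ R / 4 →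
      s z ≤ 2 * K₁ * (1 - ‖z₀‖) := by
    intro z hz hzz hyz
    have h1 := norm_sub_le_norm_sub_add_norm_sub z z₀ a
    have h2 := hs z hz (by linarith) hyz
    have h3 : 1 - ‖z‖ ≤ 2 * (1 - ‖z₀‖) := by
      have := norm_sub_norm_le z₀ z
      rw [norm_sub_rev] at this
      linarith
    calc s z ≤ K₁ * (1 - ‖z‖) := h2
      _ ≤ K₁ * (2 * (1 - ‖z₀‖)) := by gcongr
      _ = _ := by ring
  rcases eq_or_ne z z₀ with rfl | hne
  · exact ⟨hz₀, by simp⟩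
  have hrd : ‖z - z₀‖ ≤ (1 - ‖z₀‖) / 2 := by
    refine hz.le.trans ?_
    have : 1 / D ≤ 1 / 2 := one_div_le_one_div_of_le (by norm_num) (by linarith)
    nlinarith
  obtain ⟨hin, hout⟩ := h.barrier_estimate_zero hz₀ hA0 hε'0 hε'2.le hAC hyz₀ hK hKd hKR hs'
    (by linarith) hne hrd
  -- Outside this set the second alternative forces |z - z₀|² ≥ d²/D, impossible for |z - z₀| < d/D.
  -- This is where points near z₀ are shown to stay in the chart.
  have hW : z ∈ O ∧ G (y z₀) (y z - y z₀) (y z - y z₀) < 1 - ‖z₀‖ := by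
    by_contra hW
    have h1 := hout hW
    rw [← hD] at h1
    have h2 : ‖z - z₀‖ ^ 2 < (1 / D * (1 - ‖z₀‖)) ^ 2 := by gcongr
    have h3 : D * (1 / D * (1 - ‖z₀‖)) ^ 2 = 1 / D * (1 - ‖z₀‖) ^ 2 := by
      field_simp
    have h4 : 1 / D * (1 - ‖z₀‖) ^ 2 ≤ (1 - ‖z₀‖) ^ 2 := by
      refine mul_le_of_le_one_left (sq_nonneg _) ?_
      rw [div_le_one (by linarith)]
      linarith
    nlinarith
  refine ⟨hW.1, ?_⟩
  have h1 := hin hW.1 (hW.2.le.trans (by nlinarith))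
  have h2 := (h.form_bounds _ (mem_closedBall_zero_iff.2 (h.norm_lt z₀ hz₀).le) (y z - y z₀)).1
  nlinarith

end IsPlanarData

end Planar

/-! ### Integration of the gradient bound along paths. -/

section Planar

variable {E : Type*} [NormedAddCommGroup E] [InnerProductSpace ℝ E]
variable {O : Set ℂ} {y : ℂ → E} {s : ℂ → ℝ} {G : E → E →L[ℝ] E →L[ℝ] ℝ} {R C ε : ℝ}

/-- A finite-difference form of dx = 2√x d(√x) for increasing x. The bound x' ≤ 4x gives √x' + √x ≤
3√x, hence the 9; for decreasing x no such restriction is needed. -/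
theorem sq_le_sqrt_sub_sqrt_sq {x x' : ℝ} (hx : 0 < x) (hxx : x ≤ x') (hx4 : x' ≤ 4 * x) :
    (x' - x) ^ 2 ≤ 9 * (√x' - √x) ^ 2 * x := by
  have h1 : √x' ≤ 2 * √x := by
    rw [Real.sqrt_le_left (by positivity), mul_pow, Real.sq_sqrt hx.le]
    linarith
  have h2 : √x ≤ √x' := Real.sqrt_le_sqrt hxx
  have h3 : x' - x = (√x' - √x) * (√x' + √x) := by
    have e1 := Real.sq_sqrt hx.le
    have e2 := Real.sq_sqrt (hx.le.trans hxx)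
    linear_combination e1 - e2
  have h4 := Real.sqrt_nonneg x
  calc (x' - x) ^ 2 = (√x' - √x) ^ 2 * (√x' + √x) ^ 2 := by rw [h3]; ring
    _ ≤ (√x' - √x) ^ 2 * (3 * √x) ^ 2 := by gcongr; linarith
    _ = 9 * (√x' - √x) ^ 2 * √x ^ 2 := by ring
    _ = _ := by rw [Real.sq_sqrt hx.le]

theorem sq_le_sqrt_sub_sqrt_sq' {x x' : ℝ} (hx' : 0 ≤ x') (hxx : x' ≤ x) :
    (x - x') ^ 2 ≤ 9 * (√x - √x') ^ 2 * x := by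
  have hx := hx'.trans hxx
  have h2 : √x' ≤ √x := Real.sqrt_le_sqrt hxx
  have h3 : x - x' = (√x - √x') * (√x + √x') := by
    have e1 := Real.sq_sqrt hx
    have e2 := Real.sq_sqrt hx'
    linear_combination e2 - e1
  have h4 := Real.sqrt_nonneg x
  have h5 := Real.sqrt_nonneg x'
  calc (x - x') ^ 2 = (√x - √x') ^ 2 * (√x + √x') ^ 2 := by rw [h3]; ring
    _ ≤ (√x - √x') ^ 2 * (3 * √x) ^ 2 := by gcongr; linarith
    _ = 9 * (√x - √x') ^ 2 * √x ^ 2 := by ring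
    _ = _ := by rw [Real.sq_sqrt hx]

theorem sqrt_add_sub_sqrt_le {x t : ℝ} (hx : 0 ≤ x) (ht : 0 ≤ t) : √(x + t) - √x ≤ √t := by
  have h1 := Real.sqrt_nonneg x
  have h2 := Real.sqrt_nonneg t
  rw [sub_le_iff_le_add, Real.sqrt_le_left (by positivity), add_sq, Real.sq_sqrt hx,
    Real.sq_sqrt ht]
  have := mul_nonneg h2 h1
  linarith

namespace IsPlanarData

variable (h : IsPlanarData O y s G R C ε)
include h

/-- Propagation of the local Lipschitz estimate along a path on which its constant is controlled
by the increments of `B`. -/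
theorem propagate {a : ℂ} {δ c K : ℝ} (hc : 0 < c)
    (hest : ∀ z₀ ∈ O, ‖z₀ - a‖ < δ → ‖y z₀‖ ≤ R / 16 → ∀ z, ‖z - z₀‖ < c * (1 - ‖z₀‖) →
      z ∈ O ∧ ‖y z - y z₀‖ ^ 2 * (1 - ‖z₀‖) ≤ K * ‖z - z₀‖ ^ 2)
    {σ : ℝ → ℂ} {B : ℝ → ℝ} (hσ : Continuous σ) (hB : Continuous B) {L : ℝ} (hL : 0 ≤ L)
    (hσ1 : ∀ t ∈ Icc 0 L, ‖σ t‖ < 1) (hσa : ∀ t ∈ Icc 0 L, ‖σ t - a‖ < δ)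
    (h0 : σ 0 ∈ O) (hBR : ∀ t ∈ Icc 0 L, ‖y (σ 0)‖ + (B t - B 0) ≤ R / 16)
    (hstep : ∀ t ∈ Ico 0 L, ∀ᶠ τ in 𝓝[>] t, B t ≤ B τ ∧
      K * ‖σ τ - σ t‖ ^ 2 ≤ (B τ - B t) ^ 2 * (1 - ‖σ t‖)) :
    σ L ∈ O ∧ ‖y (σ L) - y (σ 0)‖ ≤ B L - B 0 := by
  have hR := h.R_pos
  let S : Set ℝ := {t | σ t ∈ O ∧ ‖y (σ t) - y (σ 0)‖ ≤ B t - B 0}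
  have hSR : ∀ t ∈ S ∩ Icc 0 L, ‖y (σ t)‖ ≤ R / 16 := fun t ht ↦ by
    have h1 := norm_le_norm_add_norm_sub' (y (σ t)) (y (σ 0))
    have h2 := ht.1.2
    have h3 := hBR t ht.2
    linarith
  have hcl : IsClosed (S ∩ Icc 0 L) := by
    refine isClosed_of_closure_subset fun t ht ↦ ?_
    have htI : t ∈ Icc 0 L := isClosed_Icc.closure_subset (closure_mono inter_subset_right ht)
    have hfr := mem_closure_iff_frequently.1 ht
    have hO : σ t ∈ O := by
      refine h.mem_of_mem_closure (R / 16) (by linarith) _ (mem_ball_zero_iff.2 (hσ1 t htI)) ?_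
      refine mem_closure_iff_frequently.2 (hσ.continuousAt.frequently ?_)
      exact hfr.mono fun τ hτ ↦ ⟨hτ.1.1, hSR τ hτ⟩
    refine ⟨⟨hO, ?_⟩, htI⟩
    by_contra! hlt
    have hc1 : ContinuousAt (fun t ↦ B t - B 0) t := by fun_prop
    have hc2 : ContinuousAt (fun t ↦ ‖y (σ t) - y (σ 0)‖) t :=
      ((ContinuousAt.comp (g := y) (h.contDiffAt_y _ hO).continuousAt hσ.continuousAt).sub
        continuousAt_const).norm
    obtain ⟨τ, hτ, hτ'⟩ := (hfr.and_eventually (hc1.eventually_lt hc2 hlt)).exists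
    exact absurd hτ.1.2 (not_le.2 hτ')
  -- Continuous induction: the set of good times is closed because small values of y cannot escape O
  -- in a limit, and it extends to the right by the local estimate, whose hypothesis is kept alive
  -- by the bound on B.
  have hsub := hcl.Icc_subset_of_forall_exists_gt (a := 0) (b := L) ⟨h0, by simp⟩ ?_
  · exact hsub (right_mem_Icc.2 hL)
  intro t ht τ₀ hτ₀
  have htI : t ∈ Icc 0 L := Ico_subset_Icc_self ht.2
  have hd : 0 < 1 - ‖σ t‖ := by linarith [hσ1 t htI]
  have hnear : ∀ᶠ τ in 𝓝[>] t, ‖σ τ - σ t‖ < c * (1 - ‖σ t‖) := by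
    have hc1 : ContinuousAt (fun τ ↦ ‖σ τ - σ t‖) t := by fun_prop
    refine mem_nhdsWithin_of_mem_nhds (hc1.eventually_lt_const ?_)
    simpa using mul_pos hc hd
  have hlt : ∀ᶠ τ in 𝓝[>] t, τ ∈ Ioc t τ₀ := Ioc_mem_nhdsGT hτ₀
  obtain ⟨τ, hτ1, ⟨hτ2, hτ3⟩, hτ4⟩ := (hnear.and ((hstep t ht.2).and hlt)).exists
  obtain ⟨hτO, hτy⟩ := hest _ ht.1.1 (hσa t htI) (hSR t ⟨ht.1, htI⟩) _ hτ1
  refine ⟨τ, ⟨hτO, ?_⟩, hτ4⟩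
  have h1 : ‖y (σ τ) - y (σ t)‖ ≤ B τ - B t := by
    refine le_of_sq_le_sq ?_ (by linarith)
    exact le_of_mul_le_mul_right (hτy.trans hτ3) hd
  have h2 := norm_sub_le_norm_sub_add_norm_sub (y (σ τ)) (y (σ t)) (y (σ 0))
  have h3 := ht.1.2
  linarith

set_option maxHeartbeats 1600000 in
/-- The Hölder estimate obtained by joining two points through the interior. -/
theorem holder_of_local {a : ℂ} (ha : ‖a‖ = 1) {δ c K : ℝ} (hδ1 : δ ≤ 1 / 2) (hc : 0 < c)
    (hK : 0 ≤ K)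
    (hest : ∀ z₀ ∈ O, ‖z₀ - a‖ < δ → ‖y z₀‖ ≤ R / 16 → ∀ z, ‖z - z₀‖ < c * (1 - ‖z₀‖) →
      z ∈ O ∧ ‖y z - y z₀‖ ^ 2 * (1 - ‖z₀‖) ≤ K * ‖z - z₀‖ ^ 2)
    {z w : ℂ} (hz : z ∈ O) (hw : ‖w‖ < 1) (hza : ‖z - a‖ < δ / 3) (hwa : ‖w - a‖ < δ / 3)
    (hsmall : ‖y z‖ + 18 * √K * √‖z - w‖ ≤ R / 16) :
    w ∈ O ∧ ‖y w - y z‖ ≤ 18 * √K * √‖z - w‖ := by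
  have hz1 : ‖z‖ < 1 := mem_ball_zero_iff.1 (h.subset_ball hz)
  have hhalf : ∀ v : ℂ, ‖v - a‖ < δ / 3 → 1 / 2 ≤ ‖v‖ := fun v hv ↦ by
    have := norm_sub_norm_le a v
    rw [ha, norm_sub_rev] at this
    linarith
  have hz2 := hhalf z hza
  have hw2 := hhalf w hwa
  set L := ‖z - w‖ with hLdef
  have hL0 : 0 ≤ L := norm_nonneg _
  have hL : L ≤ 2 * δ / 3 := by
    have := norm_sub_le_norm_sub_add_norm_sub z a w
    rw [norm_sub_rev a w] at this
    linarith
  have hL1 : L ≤ 1 / 2 := by linarith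
  -- κ² = 36K = 4 · 9 · K: the 4 comes from the speed 1/2 at which the depth bound changes along a
  -- radius (|z| ≥ 1/2), the 9 from the square root increments. Each of the three legs costs at most
  -- κ√L, so the total is 18√K√L.
  set κ := 6 * √K with hκ
  have hκ0 : 0 ≤ κ := by positivity
  have hκ2 : κ ^ 2 = 36 * K := by rw [hκ, mul_pow, Real.sq_sqrt hK]; norm_num
  have hL2 : √(L / 2) ≤ √L := Real.sqrt_le_sqrt (by linarith)
  have hκL : 0 ≤ κ * √L := by positivity
  have hsmall' : ‖y z‖ + 3 * (κ * √L) ≤ R / 16 := by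
    rw [hκ]; linarith
  have hscale : ∀ v : ℂ, ‖v‖ < 1 → ‖v - a‖ < δ / 3 → ∀ t ∈ Icc 0 L,
      ‖(1 - t) • v - a‖ < δ ∧ ‖(1 - t) • v‖ < 1 := by
    intro v hv hva t ht
    have h1 : ‖(1 - t) • v‖ = (1 - t) * ‖v‖ := by
      rw [norm_smul, Real.norm_of_nonneg (by linarith [ht.2])]
    refine ⟨?_, ?_⟩
    · have h2 : (1 - t) • v - a = (v - a) - t • v := by rw [sub_smul, one_smul]; abel
      have h3 : ‖t • v‖ ≤ L := by
        rw [norm_smul, Real.norm_of_nonneg ht.1]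
        nlinarith [ht.2, ht.1, norm_nonneg v]
      rw [h2]
      have := norm_sub_le (v - a) (t • v)
      linarith
    · rw [h1]
      nlinarith [ht.1, ht.2, norm_nonneg v]
  have hnorm : ∀ (v : ℂ) (t : ℝ), t ≤ L → ‖(1 - t) • v‖ = (1 - t) * ‖v‖ := fun v t ht ↦ by
    rw [norm_smul, Real.norm_of_nonneg (by linarith)]
  -- Move from `z` radially inward to depth comparable with `‖z - w‖`.
  have hinward := h.propagate (a := a) hc hest (σ := fun t ↦ (1 - t) • z)
    (B := fun t ↦ κ * √((1 - ‖z‖) + t / 2)) (by fun_prop) (by fun_prop) hL0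
    (fun t ht ↦ (hscale z hz1 hza t ht).2) (fun t ht ↦ (hscale z hz1 hza t ht).1)
    (by simpa using hz) ?_ ?_
  rotate_left
  · intro t ht
    have h1 := sqrt_add_sub_sqrt_le (x := 1 - ‖z‖) (t := t / 2) (by linarith) (by linarith [ht.1])
    have h2 : √(t / 2) ≤ √L := Real.sqrt_le_sqrt (by linarith [ht.1, ht.2])
    have h3 : κ * (√(1 - ‖z‖ + t / 2) - √(1 - ‖z‖)) ≤ κ * √L :=
      mul_le_mul_of_nonneg_left (h1.trans h2) hκ0
    simp only [sub_zero, one_smul, zero_div, add_zero]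
    linarith
  · intro t ht
    have hx : 0 < 1 - ‖z‖ + t / 2 := by linarith [ht.1]
    filter_upwards [Ioo_mem_nhdsGT (show t < t + 6 * (1 - ‖z‖ + t / 2) by linarith)] with τ hτ
    have hxx : 1 - ‖z‖ + t / 2 ≤ 1 - ‖z‖ + τ / 2 := by linarith [hτ.1]
    refine ⟨mul_le_mul_of_nonneg_left (Real.sqrt_le_sqrt hxx) hκ0, ?_⟩
    have h1 := sq_le_sqrt_sub_sqrt_sq hx hxx (by linarith [hτ.2])
    have h2 : ‖(1 - τ) • z - (1 - t) • z‖ ≤ τ - t := by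
      rw [← sub_smul, norm_smul, Real.norm_eq_abs, abs_of_nonpos (by linarith [hτ.1])]
      nlinarith [hτ.1]
    have h3 : 1 - ‖z‖ + t / 2 ≤ 1 - ‖(1 - t) • z‖ := by
      rw [hnorm z t ht.2.le]
      nlinarith [ht.1]
    calc K * ‖(1 - τ) • z - (1 - t) • z‖ ^ 2 ≤ K * (τ - t) ^ 2 := by gcongr
      _ = 4 * K * ((1 - ‖z‖ + τ / 2) - (1 - ‖z‖ + t / 2)) ^ 2 := by ring
      _ ≤ 4 * K * (9 * (√(1 - ‖z‖ + τ / 2) - √(1 - ‖z‖ + t / 2)) ^ 2 *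
          (1 - ‖z‖ + t / 2)) := by gcongr
      _ = (κ * √(1 - ‖z‖ + τ / 2) - κ * √(1 - ‖z‖ + t / 2)) ^ 2 * (1 - ‖z‖ + t / 2) := by
          rw [← mul_sub, mul_pow, hκ2]; ring
      _ ≤ _ := by gcongr
  obtain ⟨hO1, hy1⟩ := hinward
  have hy1' : ‖y ((1 - L) • z) - y z‖ ≤ κ * √L := by
    have h1 := sqrt_add_sub_sqrt_le (x := 1 - ‖z‖) (t := L / 2) (by linarith) (by linarith)
    have h3 : κ * (√(1 - ‖z‖ + L / 2) - √(1 - ‖z‖)) ≤ κ * √L :=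
      mul_le_mul_of_nonneg_left (h1.trans hL2) hκ0
    simp only [sub_zero, one_smul, zero_div, add_zero] at hy1
    linarith
  have hy1n : ‖y ((1 - L) • z)‖ ≤ ‖y z‖ + κ * √L := by
    have := norm_le_norm_add_norm_sub' (y ((1 - L) • z)) (y z)
    linarith
  -- Join the two radii at that depth.
  have hLI : L ∈ Icc 0 L := ⟨hL0, le_rfl⟩
  have hseg : ∀ t ∈ Icc (0 : ℝ) 1, ‖(1 - L) • z + t • ((1 - L) • w - (1 - L) • z)‖ ≤ 1 - L ∧
      ‖(1 - L) • z + t • ((1 - L) • w - (1 - L) • z) - a‖ < δ := by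
    intro t ht
    have hseg' : (1 - L) • z + t • ((1 - L) • w - (1 - L) • z) ∈
        segment ℝ ((1 - L) • z) ((1 - L) • w) := by
      rw [segment_eq_image']
      exact ⟨t, ht, rfl⟩
    constructor
    · have h1 : ∀ v : ℂ, ‖v‖ < 1 → (1 - L) • v ∈ closedBall (0 : ℂ) (1 - L) := fun v hv ↦ by
        rw [mem_closedBall_zero_iff, hnorm v L le_rfl]
        nlinarith
      exact mem_closedBall_zero_iff.1
        ((convex_closedBall (0 : ℂ) (1 - L)).segment_subset (h1 z hz1) (h1 w hw) hseg')
    · exact mem_ball_iff_norm.1 ((convex_ball a δ).segment_subset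
        (mem_ball_iff_norm.2 (hscale z hz1 hza L hLI).1)
        (mem_ball_iff_norm.2 (hscale w hw hwa L hLI).1) hseg')
  -- The crossing lies at depth at least L, which keeps it inside the open disc only when L > 0.
  rcases hL0.eq_or_lt with hLz | hLpos
  · have : z = w := by
      rw [← sub_eq_zero, ← norm_eq_zero, ← hLdef, ← hLz]
    subst this
    exact ⟨hz, by rw [sub_self, norm_zero]; positivity⟩
  have hacross := h.propagate (a := a) hc hest
    (σ := fun t ↦ (1 - L) • z + t • ((1 - L) • w - (1 - L) • z))
    (B := fun t ↦ κ * √L * t) (by fun_prop) (by fun_prop) zero_le_one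
    (fun t ht ↦ (hseg t ht).1.trans_lt (by linarith)) (fun t ht ↦ (hseg t ht).2)
    (by simpa using hO1) ?_ ?_
  rotate_left
  · intro t ht
    simp only [zero_smul, add_zero, mul_zero, sub_zero]
    have : κ * √L * t ≤ κ * √L := mul_le_of_le_one_right hκL ht.2
    linarith
  · intro t ht
    filter_upwards [self_mem_nhdsWithin] with τ hτ
    have hτ' : t < τ := hτ
    refine ⟨by gcongr, ?_⟩
    have h1 : ‖((1 - L) • z + τ • ((1 - L) • w - (1 - L) • z)) -
        ((1 - L) • z + t • ((1 - L) • w - (1 - L) • z))‖ ≤ (τ - t) * L := by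
      have e : ((1 - L) • z + τ • ((1 - L) • w - (1 - L) • z)) -
        ((1 - L) • z + t • ((1 - L) • w - (1 - L) • z)) = (τ - t) • (1 - L) • (w - z) := by
        module
      rw [e, norm_smul, norm_smul, Real.norm_of_nonneg (by linarith),
        Real.norm_of_nonneg (by linarith), norm_sub_rev, ← hLdef]
      have h2 : (1 - L) * L ≤ L := by nlinarith
      gcongr
    have h2 := (hseg t (Ico_subset_Icc_self ht)).1
    have h3 : √L ^ 2 = L := Real.sq_sqrt hL0
    calc _ ≤ K * ((τ - t) * L) ^ 2 := by gcongr
      _ ≤ 36 * K * ((τ - t) * L) ^ 2 := by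
          have : 0 ≤ K * ((τ - t) * L) ^ 2 := by positivity
          linarith
      _ = κ ^ 2 * √L ^ 2 * (τ - t) ^ 2 * L := by rw [hκ2, h3]; ring
      _ = (κ * √L * τ - κ * √L * t) ^ 2 * L := by ring
      _ ≤ _ := by gcongr; linarith
  obtain ⟨hO2, hy2⟩ := hacross
  have hend : (1 - L) • z + (1 : ℝ) • ((1 - L) • w - (1 - L) • z) = (1 - L) • w := by module
  simp only [hend] at hO2 hy2
  simp only [zero_smul, add_zero, mul_zero, sub_zero, mul_one] at hy2
  have hy2n : ‖y ((1 - L) • w)‖ ≤ ‖y z‖ + 2 * (κ * √L) := by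
    have := norm_le_norm_add_norm_sub' (y ((1 - L) • w)) (y ((1 - L) • z))
    linarith
  -- Move radially outward to `w`.
  have hrev : ∀ t ∈ Icc 0 L, L - t ∈ Icc 0 L := fun t ht ↦ ⟨by linarith [ht.2], by linarith [ht.1]⟩
  have houtward := h.propagate (a := a) hc hest (σ := fun t ↦ (1 - (L - t)) • w)
    (B := fun t ↦ -(κ * √((1 - ‖w‖) + (L - t) / 2))) (by fun_prop) (by fun_prop) hL0
    (fun t ht ↦ (hscale w hw hwa _ (hrev t ht)).2) (fun t ht ↦ (hscale w hw hwa _ (hrev t ht)).1)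
    (by simpa using hO2) ?_ ?_
  rotate_left
  · intro t ht
    have h1 := sqrt_add_sub_sqrt_le (x := 1 - ‖w‖) (t := L / 2) (by linarith) (by linarith)
    have h2 : √(1 - ‖w‖) ≤ √(1 - ‖w‖ + (L - t) / 2) := Real.sqrt_le_sqrt (by linarith [ht.2])
    have h3 : κ * (√(1 - ‖w‖ + L / 2) - √(1 - ‖w‖ + (L - t) / 2)) ≤ κ * √L :=
      mul_le_mul_of_nonneg_left (by linarith) hκ0
    simp only [sub_zero]
    linarith
  · intro t ht
    filter_upwards [Ioo_mem_nhdsGT ht.2] with τ hτ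
    have hxx : 1 - ‖w‖ + (L - τ) / 2 ≤ 1 - ‖w‖ + (L - t) / 2 := by linarith [hτ.1]
    refine ⟨neg_le_neg (mul_le_mul_of_nonneg_left (Real.sqrt_le_sqrt hxx) hκ0), ?_⟩
    have h1 := sq_le_sqrt_sub_sqrt_sq' (by linarith [hτ.2] : 0 ≤ 1 - ‖w‖ + (L - τ) / 2) hxx
    have h2 : ‖(1 - (L - τ)) • w - (1 - (L - t)) • w‖ ≤ τ - t := by
      rw [← sub_smul, norm_smul, Real.norm_eq_abs, abs_of_nonneg (by linarith [hτ.1])]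
      nlinarith [hτ.1]
    have h3 : 1 - ‖w‖ + (L - t) / 2 ≤ 1 - ‖(1 - (L - t)) • w‖ := by
      rw [hnorm w (L - t) (by linarith [ht.1])]
      nlinarith [ht.2]
    calc K * ‖(1 - (L - τ)) • w - (1 - (L - t)) • w‖ ^ 2 ≤ K * (τ - t) ^ 2 := by gcongr
      _ = 4 * K * ((1 - ‖w‖ + (L - t) / 2) - (1 - ‖w‖ + (L - τ) / 2)) ^ 2 := by ring
      _ ≤ 4 * K * (9 * (√(1 - ‖w‖ + (L - t) / 2) - √(1 - ‖w‖ + (L - τ) / 2)) ^ 2 *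
          (1 - ‖w‖ + (L - t) / 2)) := by gcongr
      _ = (-(κ * √(1 - ‖w‖ + (L - τ) / 2)) - -(κ * √(1 - ‖w‖ + (L - t) / 2))) ^ 2 *
          (1 - ‖w‖ + (L - t) / 2) := by
          have : (-(κ * √(1 - ‖w‖ + (L - τ) / 2)) - -(κ * √(1 - ‖w‖ + (L - t) / 2))) =
            κ * (√(1 - ‖w‖ + (L - t) / 2) - √(1 - ‖w‖ + (L - τ) / 2)) := by ring
          rw [this, mul_pow, hκ2]; ring
      _ ≤ _ := by gcongr
  obtain ⟨hO3, hy3⟩ := houtward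
  simp only [sub_self, sub_zero, one_smul, zero_div, add_zero] at hO3 hy3
  refine ⟨hO3, ?_⟩
  have h1 := sqrt_add_sub_sqrt_le (x := 1 - ‖w‖) (t := L / 2) (by linarith) (by linarith)
  have h2 : κ * (√(1 - ‖w‖ + L / 2) - √(1 - ‖w‖)) ≤ κ * √L :=
    mul_le_mul_of_nonneg_left (h1.trans hL2) hκ0
  have h3 := norm_sub_le_norm_sub_add_norm_sub (y w) (y ((1 - L) • w)) (y z)
  have h4 := norm_sub_le_norm_sub_add_norm_sub (y ((1 - L) • w)) (y ((1 - L) • z)) (y z)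
  have h5 : 18 * √K * √L = 3 * (κ * √L) := by rw [hκ]; ring
  linarith

/-- If `y` takes small values at points arbitrarily close to `a`, then it is Hölder continuous
with exponent `1 / 2` near `a`. -/
theorem exists_holder {a : ℂ} (ha : ‖a‖ = 1) {δ₁ : ℝ} (hδ₁ : 0 < δ₁)
    (hb : ∀ b : ℂ, ‖b‖ = 1 → ‖b - a‖ < δ₁ → ∀ η > 0,
      ∀ᶠ z in 𝓝 b, z ∈ O → ‖y z‖ ≤ R / 2 → s z < η)
    (hfreq : ∃ᶠ z in 𝓝 a, z ∈ O ∧ ‖y z‖ < R / 64) :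
    ∃ δ > 0, ∃ K ≥ 0, (∀ z ∈ ball (0 : ℂ) 1, ‖z - a‖ < δ → z ∈ O ∧ ‖y z‖ ≤ R / 16) ∧
      ∀ z ∈ ball (0 : ℂ) 1, ∀ w ∈ ball (0 : ℂ) 1, ‖z - a‖ < δ → ‖w - a‖ < δ →
        ‖y z - y w‖ ≤ K * √‖z - w‖ := by
  have hR := h.R_pos
  obtain ⟨δ₀, hδ₀, c, hc, K, hK, hest⟩ := h.exists_norm_sub_sq_le ha hδ₁ hb
  set δ := min δ₀ (1 / 2) with hδ
  have hδ0 : 0 < δ := by positivity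
  have hhol : ∀ z ∈ O, ∀ w ∈ ball (0 : ℂ) 1, ‖z - a‖ < δ / 3 → ‖w - a‖ < δ / 3 →
      ‖y z‖ + 18 * √K * √‖z - w‖ ≤ R / 16 → w ∈ O ∧ ‖y w - y z‖ ≤ 18 * √K * √‖z - w‖ :=
    fun z hz w hw hza hwa hsm ↦ h.holder_of_local ha (min_le_right _ _) hc hK
      (fun z₀ hz₀ hz₀a ↦ hest z₀ hz₀ (hz₀a.trans_le (min_le_left _ _))) hz
      (mem_ball_zero_iff.1 hw) hza hwa hsm
  obtain ⟨τ, hτ, hτ'⟩ : ∃ τ > 0, ∀ t, 0 ≤ t → t < τ → 18 * √K * √t ≤ R / 64 := by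
    have hcont : ContinuousAt (fun t ↦ 18 * √K * √t) 0 := by fun_prop
    have hev := hcont.eventually_lt_const (show 18 * √K * √0 < R / 64 by simpa using hR)
    obtain ⟨τ, hτ, hball⟩ := Metric.eventually_nhds_iff_ball.1 hev
    exact ⟨τ, hτ, fun t h0 ht ↦ (hball t (by
      rw [mem_ball_zero_iff, Real.norm_of_nonneg h0]; exact ht)).le⟩
  -- Within this radius any Hölder increment is at most R/64. One point with ‖y‖ < R/64 thus forces
  -- ‖y‖ ≤ R/32 throughout, and any point may then serve as a start without exceeding R/16.
  set δ' := min (δ / 3) (τ / 2) with hδ'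
  have hδ'0 : 0 < δ' := by positivity
  have e1 : δ' ≤ δ / 3 := min_le_left _ _
  have e2 : δ' ≤ τ / 2 := min_le_right _ _
  have hdist : ∀ z w : ℂ, ‖z - a‖ < δ' → ‖w - a‖ < δ' → 18 * √K * √‖z - w‖ ≤ R / 64 :=
    fun z w hz hw ↦ by
      refine hτ' _ (norm_nonneg _) ?_
      have := norm_sub_le_norm_sub_add_norm_sub z a w
      rw [norm_sub_rev a w] at this
      linarith
  obtain ⟨z₀, ⟨hz₀, hyz₀⟩, hz₀a⟩ := (hfreq.and_eventually (ball_mem_nhds a hδ'0)).exists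
  have hz₀a' : ‖z₀ - a‖ < δ' := mem_ball_iff_norm.1 hz₀a
  have hall : ∀ w ∈ ball (0 : ℂ) 1, ‖w - a‖ < δ' → w ∈ O ∧ ‖y w‖ ≤ R / 32 := fun w hw hwa ↦ by
    have h1 := hdist z₀ w hz₀a' hwa
    obtain ⟨hwO, hyw⟩ := hhol z₀ hz₀ w hw (by linarith) (by linarith) (by linarith)
    refine ⟨hwO, ?_⟩
    have := norm_le_norm_add_norm_sub' (y w) (y z₀)
    linarith
  refine ⟨δ', hδ'0, 18 * √K, by positivity, fun z hz hza ↦ ?_, fun z hz w hw hza hwa ↦ ?_⟩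
  · obtain ⟨h1, h2⟩ := hall z hz hza
    exact ⟨h1, by linarith⟩
  · have h1 := hdist z w hza hwa
    have h2 := hall z hz hza
    rw [norm_sub_rev]
    exact (hhol z h2.1 w hw (by linarith) (by linarith) (by linarith)).2

end IsPlanarData

end Planar

/-! ### Extension and globalization of Hölder bounds. -/

section Holder

variable {X Y : Type*} [PseudoEMetricSpace X] [EMetricSpace Y]

/-- A Hölder estimate extends to the limit values. -/
theorem HolderOnWith.of_subset_closure {C r : ℝ≥0} {f : X → Y} {A B : Set X}
    (hf : HolderOnWith C r f A) (hAB : A ⊆ B) (hB : B ⊆ closure A) (hc : ContinuousOn f B) :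
    HolderOnWith C r f B := by
  intro z hz w hw
  have hmem : (z, w) ∈ closure (A ×ˢ A) := by
    rw [closure_prod_eq]
    exact ⟨hB hz, hB hw⟩
  have h1 : ContinuousWithinAt (fun p : X × X ↦ f p.1) (A ×ˢ A) (z, w) :=
    ContinuousWithinAt.comp (t := B) (hc z hz) continuousWithinAt_fst fun p hp ↦ hAB hp.1
  have h2 : ContinuousWithinAt (fun p : X × X ↦ f p.2) (A ×ˢ A) (z, w) :=
    ContinuousWithinAt.comp (t := B) (hc w hw) continuousWithinAt_snd fun p hp ↦ hAB hp.2
  refine ContinuousWithinAt.closure_le (f := fun p : X × X ↦ edist (f p.1) (f p.2))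
    (g := fun p : X × X ↦ (C : ℝ≥0∞) * edist p.1 p.2 ^ (r : ℝ)) hmem (h1.edist h2) ?_
    fun p hp ↦ hf p.1 hp.1 p.2 hp.2
  refine Continuous.continuousWithinAt ?_
  exact (ENNReal.continuous_const_mul ENNReal.coe_ne_top).comp
    (ENNReal.continuous_rpow_const.comp continuous_edist)

/-- A locally Hölder continuous map with finite distances between its values is Hölder continuous
on compact sets. -/
theorem IsCompact.exists_holderOnWith {X : Type*} [EMetricSpace X] {f : X → Y} {K : Set X}
    {r : ℝ≥0} (hK : IsCompact K) (hf : ContinuousOn f K)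
    (hfin : ∀ z ∈ K, ∀ w ∈ K, edist (f z) (f w) ≠ ⊤)
    (hloc : ∀ a ∈ K, ∃ s ∈ 𝓝[K] a, ∃ C, HolderOnWith C r f s) : ∃ C, HolderOnWith C r f K := by
  have key : ∃ C : ℝ≥0, ∀ p ∈ K ×ˢ K, edist (f p.1) (f p.2) ≤ C * edist p.1 p.2 ^ (r : ℝ) := by
    refine (hK.prod hK).induction_on
      (p := fun S ↦ ∃ C : ℝ≥0, ∀ p ∈ S, edist (f p.1) (f p.2) ≤ C * edist p.1 p.2 ^ (r : ℝ))
      ⟨0, by simp⟩ (fun S T hST ⟨C, hC⟩ ↦ ⟨C, fun p hp ↦ hC p (hST hp)⟩)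
      (fun S T ⟨C, hC⟩ ⟨D, hD⟩ ↦ ⟨max C D, ?_⟩) ?_
    · rintro p (hp | hp)
      · exact (hC p hp).trans (by gcongr; exact le_max_left _ _)
      · exact (hD p hp).trans (by gcongr; exact le_max_right _ _)
    rintro ⟨a, b⟩ ⟨ha, hb⟩
    -- Near the diagonal of K × K the local constants apply; away from it the distance quotient is
    -- finite, hence locally bounded by continuity.
    rcases eq_or_ne a b with rfl | hab
    · obtain ⟨s, hs, C, hC⟩ := hloc a ha
      refine ⟨s ×ˢ s, ?_, C, fun p hp ↦ hC p.1 hp.1 p.2 hp.2⟩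
      rw [nhdsWithin_prod_eq]
      exact prod_mem_prod hs hs
    · have hpos : edist a b ^ (r : ℝ) ≠ 0 :=
        (ENNReal.rpow_pos_of_nonneg (edist_pos.2 hab) r.2).ne'
      obtain ⟨N, hN⟩ := ENNReal.exists_nat_mul_gt hpos (hfin a ha b hb)
      have h1 : ContinuousWithinAt (fun p : X × X ↦ f p.1) (K ×ˢ K) (a, b) :=
        ContinuousWithinAt.comp (t := K) (hf a ha) continuousWithinAt_fst fun p hp ↦ hp.1
      have h2 : ContinuousWithinAt (fun p : X × X ↦ f p.2) (K ×ˢ K) (a, b) :=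
        ContinuousWithinAt.comp (t := K) (hf b hb) continuousWithinAt_snd fun p hp ↦ hp.2
      have h3 : ContinuousWithinAt (fun p : X × X ↦ (N : ℝ≥0∞) * edist p.1 p.2 ^ (r : ℝ))
          (K ×ˢ K) (a, b) :=
        Continuous.continuousWithinAt <|
          (ENNReal.continuous_const_mul (ENNReal.natCast_ne_top N)).comp
            (ENNReal.continuous_rpow_const.comp continuous_edist)
      refine ⟨_, (h1.edist h2).eventually_lt h3 hN, N, fun p hp ↦ ?_⟩
      simpa using (show _ < _ from hp).le
  obtain ⟨C, hC⟩ := key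
  exact ⟨C, fun z hz w hw ↦ hC (z, w) ⟨hz, hw⟩⟩

/-- The extended distance may be infinite between components of M, but the points at finite distance
from p form a clopen set. -/
theorem IsPreconnected.edist_ne_top {s : Set Y} (hs : IsPreconnected s) {p q : Y} (hp : p ∈ s)
    (hq : q ∈ s) : edist p q ≠ ⊤ := by
  have h1 : IsClopen (eball p ⊤) := ⟨isClosed_eball_top, isOpen_eball⟩
  have h2 := hs.subset_isClopen h1 ⟨p, hp, mem_eball_self (by simp)⟩ hq
  rw [edist_comm]
  exact (mem_eball.1 h2).ne

/-- A map on `A` with limits at the points of `B` which is locally Hölder continuous up to `B`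
extends to a map on `B` which is Hölder continuous on compact sets. -/
theorem exists_extension_holderOnWith {X : Type*} [EMetricSpace X] {u : X → Y} {A B : Set X}
    {r : ℝ≥0} (hA : IsPreconnected A) (hAB : A ⊆ B) (hB : B ⊆ closure A) (hu : ContinuousOn u A)
    (hlim : ∀ a ∈ B, ∃ q, Tendsto u (𝓝[A] a) (𝓝 q))
    (hloc : ∀ a ∈ B, ∃ U, IsOpen U ∧ a ∈ U ∧ ∃ C, HolderOnWith C r u (A ∩ U)) :
    ∃ v : X → Y, EqOn v u A ∧ ContinuousOn v B ∧
      ∀ K ⊆ B, IsCompact K → ∃ C : ℝ≥0, HolderOnWith C r v K := by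
  have heq : EqOn (extendFrom A u) u A := fun z hz ↦ extendFrom_eq (subset_closure hz) (hu z hz)
  have hcont : ContinuousOn (extendFrom A u) B := continuousOn_extendFrom hB hlim
  refine ⟨_, heq, hcont, fun K hKB hK ↦
    hK.exists_holderOnWith (hcont.mono hKB) (fun z hz w hw ↦ ?_) fun a ha ↦ ?_⟩
  · exact ((hA.subset_closure hAB hB).image _ hcont).edist_ne_top
      (mem_image_of_mem _ (hKB hz)) (mem_image_of_mem _ (hKB hw))
  · obtain ⟨U, hU, haU, C, hC⟩ := hloc a (hKB ha)
    have h1 : HolderOnWith C r (extendFrom A u) (A ∩ U) := fun z hz w hw ↦ by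
      rw [heq hz.1, heq hw.1]
      exact hC z hz w hw
    have h2 : HolderOnWith C r (extendFrom A u) (B ∩ U) := by
      refine h1.of_subset_closure (inter_subset_inter_left _ hAB) ?_
        (hcont.mono inter_subset_left)
      intro z hz
      have := hU.inter_closure (s := U) (t := A) ⟨hz.2, hB hz.1⟩
      rwa [inter_comm] at this
    refine ⟨K ∩ U, ?_, C, h2.mono (inter_subset_inter_left _ hKB)⟩
    exact inter_mem self_mem_nhdsWithin (mem_nhdsWithin_of_mem_nhds (hU.mem_nhds haU))

end Holder

/-! ### Boundary arcs. -/

theorem norm_eq_one_of_mem_openArc {α β : ℝ} {a : ℂ} (ha : a ∈ openArc α β) : ‖a‖ = 1 := by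
  obtain ⟨θ, -, rfl⟩ := ha
  exact Complex.norm_exp_ofReal_mul_I θ

/-- Near a, the angle of b is that of a plus the argument of b/a, which is continuous there since
b/a is near 1. -/
theorem exists_forall_mem_openArc {α β : ℝ} {a : ℂ} (ha : a ∈ openArc α β) :
    ∃ δ > 0, ∀ b : ℂ, ‖b‖ = 1 → ‖b - a‖ < δ → b ∈ openArc α β := by
  have ha1 := norm_eq_one_of_mem_openArc ha
  have ha0 : a ≠ 0 := by
    rintro rfl
    simp at ha1
  obtain ⟨θ, hθ, hθa⟩ := ha
  have hc : ContinuousAt (fun b : ℂ ↦ θ + (b / a).arg) a := by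
    refine continuousAt_const.add (ContinuousAt.comp (g := Complex.arg) ?_ (by fun_prop))
    refine Complex.continuousAt_arg ?_
    rw [div_self ha0]
    exact Complex.one_mem_slitPlane
  have hmem : Ioo α β ∈ 𝓝 (θ + (a / a).arg) := by
    rw [div_self ha0, Complex.arg_one, add_zero]
    exact Ioo_mem_nhds hθ.1 hθ.2
  obtain ⟨δ, hδ, hball⟩ := Metric.mem_nhds_iff.1 (hc.preimage_mem_nhds hmem)
  refine ⟨δ, hδ, fun b hb hba ↦ ⟨_, hball (mem_ball_iff_norm.2 hba), ?_⟩⟩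
  have h1 := Complex.norm_mul_exp_arg_mul_I (b / a)
  rw [norm_div, hb, ha1, div_one, Complex.ofReal_one, one_mul] at h1
  simp only at hθa
  simp only [Complex.ofReal_add, add_mul, Complex.exp_add]
  rw [hθa, h1, mul_div_cancel₀ _ ha0]

theorem OpenPartialHomeomorph.mem_symm_image_closedBall {M E : Type*} [TopologicalSpace M]
    [SeminormedAddCommGroup E] {x : OpenPartialHomeomorph M E} {r : ℝ} {p : M}
    (hp : p ∈ x.source) (hpr : ‖x p‖ ≤ r) : p ∈ x.symm '' closedBall 0 r :=
  ⟨x p, mem_closedBall_zero_iff.2 hpr, x.left_inv hp⟩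

/-! ### From the chart to planar data, and back to the manifold. -/

section Chart

variable {n : ℕ} {M : Type*} [EMetricSpace M] [ChartedSpace (EuclideanSpace ℝ (Fin n)) M]
  [RiemannianBundle (fun p : M ↦ TangentSpace (𝓡 n) p)]
  {ρ : M → ℝ} {x : OpenPartialHomeomorph M (EuclideanSpace ℝ (Fin n))} {q : M} {R C ε : ℝ}

namespace IsAdaptedChart

variable (hx : IsAdaptedChart ρ x q R C ε)
include hx

theorem isCompact_image {r : ℝ} (hr : r ≤ R) : IsCompact (x.symm '' closedBall 0 r) :=
  (isCompact_closedBall _ _).image_of_continuousOn (x.continuousOn_symm.mono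
    ((closedBall_subset_closedBall hr).trans hx.subset_target))

theorem of_mem_image {r : ℝ} (hr : r ≤ R) {p : M} (hp : p ∈ x.symm '' closedBall 0 r) :
    p ∈ x.source ∧ ‖x p‖ ≤ r := by
  obtain ⟨y, hy, rfl⟩ := hp
  have hyt := hx.subset_target (closedBall_subset_closedBall hr hy)
  refine ⟨x.map_target hyt, ?_⟩
  rw [x.right_inv hyt]
  exact mem_closedBall_zero_iff.1 hy

/-- A bound for the coordinates of a disc holds also for its cluster points. -/
theorem eventually_lt (hρ : Continuous ρ) {u : ℂ → M} {b : ℂ} (hcl : clusterSet u b ⊆ {q | ρ q = 0})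
    {r : ℝ} (hr : r ≤ R) {η : ℝ} (hη : 0 < η) :
    ∀ᶠ z in 𝓝 b, z ∈ ball (0 : ℂ) 1 → u z ∈ x.source → ‖x (u z)‖ ≤ r → ρ (u z) < η := by
  by_contra hnot
  have hfr : ∃ᶠ z in 𝓝 b, z ∈ ball (0 : ℂ) 1 ∧ u z ∈ x.symm '' closedBall 0 r ∧ η ≤ ρ (u z) := by
    refine (not_eventually.1 hnot).mono fun z hz ↦ ?_
    push Not at hz
    exact ⟨hz.1, x.mem_symm_image_closedBall hz.2.1 hz.2.2.1, hz.2.2.2⟩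
  obtain ⟨z, hz, hzP⟩ := exists_seq_forall_of_frequently hfr
  -- Compactness of the coordinate ball turns values with ρ ≥ η into a cluster point of u at b,
  -- where ρ must vanish.
  obtain ⟨p, -, φ, hφ, hp⟩ := (hx.isCompact_image hr).tendsto_subseq fun k ↦ (hzP k).2.1
  have h1 : ρ p = 0 := hcl ⟨z ∘ φ, fun k ↦ (hzP _).1, hz.comp hφ.tendsto_atTop, hp⟩
  have h2 : η ≤ ρ p := ge_of_tendsto' ((hρ.tendsto p).comp hp) fun k ↦ (hzP _).2.2
  linarith

theorem holderOnWith_of_norm_sub_le [IsRiemannianManifold (𝓡 n) M] {u : ℂ → M} {A : Set ℂ} {K : ℝ}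
    (hK : 0 ≤ K) (hA : ∀ z ∈ A, u z ∈ x.source ∧ ‖x (u z)‖ ≤ R)
    (h : ∀ z ∈ A, ∀ w ∈ A, ‖x (u z) - x (u w)‖ ≤ K * √‖z - w‖) :
    HolderOnWith (2 * K.toNNReal) (1 / 2) u A := by
  intro z hz w hw
  obtain ⟨h1, h2⟩ := hA z hz
  obtain ⟨h3, h4⟩ := hA w hw
  refine (hx.edist_le h1 h3 h2 h4).trans ?_
  rw [ENNReal.coe_mul, mul_assoc]
  refine mul_le_mul_right ?_ _
  rw [edist_dist, edist_dist, dist_eq_norm, dist_eq_norm,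
    ENNReal.ofReal_rpow_of_nonneg (norm_nonneg _) (by positivity)]
  change _ ≤ ENNReal.ofReal K * _
  rw [← ENNReal.ofReal_mul hK]
  refine ENNReal.ofReal_le_ofReal ((h z hz w hw).trans_eq ?_)
  rw [Real.sqrt_eq_rpow]
  simp

theorem isPlanarData (hρ : IsStrictlyMPSH n ρ) {u : ℂ → M}
    (hu : IsConformalHarmonicDisc (n := n) u) (hpos : ∀ z ∈ ball (0 : ℂ) 1, 0 < ρ (u z)) :
    IsPlanarData {z | z ∈ ball (0 : ℂ) 1 ∧ u z ∈ x.source ∧ ‖x (u z)‖ < R} (fun z ↦ x (u z))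
      (fun z ↦ ρ (u z)) (chartForm x) R C ε where
  isOpen := by
    have h1 : IsOpen (x.source ∩ x ⁻¹' ball 0 R) := x.isOpen_inter_preimage isOpen_ball
    convert (hu.1.1.continuousOn.isOpen_inter_preimage isOpen_ball h1) using 1
    ext z
    simp
  subset_ball := fun z hz ↦ hz.1
  R_pos := hx.R_pos
  C_nonneg := hx.C_nonneg
  ε_pos := hx.ε_pos
  norm_lt := fun z hz ↦ hz.2.2
  mem_of_mem_closure := fun r hr z hz hzc ↦ by
    have hcont : ContinuousAt u z := (hu.1.contMDiffAt hz).continuousAt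
    -- The image of a closed coordinate ball is compact, hence closed in M, so a limit inside the
    -- disc cannot slip out of the chart.
    have hmem : u z ∈ closure (x.symm '' closedBall 0 r) := by
      refine mem_closure_iff_frequently.2 (hcont.frequently ?_)
      exact (mem_closure_iff_frequently.1 hzc).mono fun w hw ↦ x.mem_symm_image_closedBall hw.1.2.1 hw.2
    rw [(hx.isCompact_image hr.le).isClosed.closure_eq] at hmem
    obtain ⟨h1, h2⟩ := hx.of_mem_image hr.le hmem
    exact ⟨hz, h1, h2.trans_lt hr⟩
  contDiffAt_y := fun z hz ↦
    (ContMDiffAt.comp_chart hx.mem_atlas (hu.1.contMDiffAt hz.1) hz.2.1).of_le ENat.LEInfty.out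
  contDiffAt_s := fun z hz ↦ hρ.contDiffAt_comp (hu.1.contMDiffAt hz.1)
  s_pos := fun z hz ↦ hpos z hz.1
  form_symm := chartForm_symm x
  form_bounds := hx.form_bounds
  form_lipschitz := hx.form_lipschitz
  conformal := fun z hz ↦ hx.conformal u hu z hz.1 hz.2.1
  norm_laplacian_le := fun z hz ↦ hx.norm_laplacian_le u hu z hz.1 hz.2.1 hz.2.2.le
  le_laplacian := fun z hz ↦ hx.le_laplacian u hu z hz.1 hz.2.1 hz.2.2

end IsAdaptedChart

variable [IsManifold (𝓡 n) ∞ M]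
  [IsContMDiffRiemannianBundle (𝓡 n) ∞ (EuclideanSpace ℝ (Fin n))
    (fun p : M ↦ TangentSpace (𝓡 n) p)]
  [IsRiemannianManifold (𝓡 n) M]

theorem IsStrictlyMPSH.exists_holderOnWith_interior (hρ : IsStrictlyMPSH n ρ) {u : ℂ → M}
    (hu : IsConformalHarmonicDisc (n := n) u) {a : ℂ} (ha : a ∈ ball (0 : ℂ) 1) :
    ∃ U, IsOpen U ∧ a ∈ U ∧ ∃ C, HolderOnWith C (1 / 2) u (ball 0 1 ∩ U) := by
  obtain ⟨x, R, C, ε, hx⟩ := hρ.exists_isAdaptedChart (u a)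
  have hua := hu.1.contMDiffAt ha
  have hy := ContMDiffAt.comp_chart hx.mem_atlas hua hx.mem_source
  obtain ⟨K, t, ht, hK⟩ := (ContDiffAt.of_le (m := 1) hy (by simp)).exists_lipschitzOnWith
  have h1 : ∀ᶠ z in 𝓝 a, u z ∈ x.source :=
    hua.continuousAt.eventually_mem (x.open_source.mem_nhds hx.mem_source)
  have h2 : ∀ᶠ z in 𝓝 a, ‖x (u z)‖ < R :=
    hy.continuousAt.norm.eventually_lt_const (by simpa [hx.map_center] using hx.R_pos)
  obtain ⟨δ, hδ, hball⟩ := Metric.eventually_nhds_iff_ball.1 ((h1.and h2).and ht)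
  -- On a set of diameter at most 1 a Lipschitz bound implies a Hölder-1/2 bound.
  refine ⟨ball a (min δ (1 / 2)), isOpen_ball, mem_ball_self (by positivity), _,
    hx.holderOnWith_of_norm_sub_le K.2 (fun z hz ↦ ?_) fun z hz w hw ↦ ?_⟩
  · have := (hball z (ball_subset_ball (min_le_left _ _) hz.2)).1
    exact ⟨this.1, this.2.le⟩
  · have h3 := hK.norm_sub_le (hball z (ball_subset_ball (min_le_left _ _) hz.2)).2
      (hball w (ball_subset_ball (min_le_left _ _) hw.2)).2
    refine h3.trans (mul_le_mul_of_nonneg_left ?_ K.2)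
    refine Real.le_sqrt_of_sq_le ?_
    have h4 := mem_ball_iff_norm.1 (ball_subset_ball (min_le_right _ _) hz.2)
    have h5 := mem_ball_iff_norm.1 (ball_subset_ball (min_le_right _ _) hw.2)
    have h6 := norm_sub_le_norm_sub_add_norm_sub z a w
    rw [norm_sub_rev a w] at h6
    exact pow_le_of_le_one (norm_nonneg _) (by linarith) two_ne_zero

/-- Nonemptiness of the cluster set is used once, to choose the chart and the starting point in it.
The limit is taken in coordinates, where Cauchy filters converge, so M need not be complete. -/
theorem IsStrictlyMPSH.exists_holderOnWith_boundary (hρ : IsStrictlyMPSH n ρ) {u : ℂ → M}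
    (hu : IsConformalHarmonicDisc (n := n) u) (hpos : ∀ z ∈ ball (0 : ℂ) 1, 0 < ρ (u z))
    {a : ℂ} (ha : ‖a‖ = 1) {δ₁ : ℝ} (hδ₁ : 0 < δ₁)
    (hcl : ∀ b : ℂ, ‖b‖ = 1 → ‖b - a‖ < δ₁ → clusterSet u b ⊆ {q | ρ q = 0})
    (hne : (clusterSet u a).Nonempty) :
    (∃ q, Tendsto u (𝓝[ball 0 1] a) (𝓝 q)) ∧
      ∃ U, IsOpen U ∧ a ∈ U ∧ ∃ C, HolderOnWith C (1 / 2) u (ball 0 1 ∩ U) := by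
  obtain ⟨q, ζ, hζ, hζa, hζq⟩ := hne
  obtain ⟨x, R, C, ε, hx⟩ := hρ.exists_isAdaptedChart q
  have hR := hx.R_pos
  have hdata := hx.isPlanarData hρ hu hpos
  have hfreq : ∃ᶠ z in 𝓝 a, z ∈ {z | z ∈ ball (0 : ℂ) 1 ∧ u z ∈ x.source ∧ ‖x (u z)‖ < R} ∧
      ‖x (u z)‖ < R / 64 := by
    have h1 : ∀ᶠ k in atTop, u (ζ k) ∈ x.source :=
      hζq.eventually_mem (x.open_source.mem_nhds hx.mem_source)
    have h2 : ∀ᶠ k in atTop, ‖x (u (ζ k))‖ < R / 64 := by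
      have h3 := ((x.continuousAt hx.mem_source).tendsto.comp hζq).norm
      rw [hx.map_center, norm_zero] at h3
      exact h3.eventually_lt_const (by positivity)
    refine hζa.frequently ((h1.and h2).mono fun k hk ↦ ?_).frequently
    exact ⟨⟨hζ k, hk.1, by linarith [hk.2]⟩, hk.2⟩
  obtain ⟨δ, hδ, K, hK, hO, hhol⟩ := hdata.exists_holder ha hδ₁ (fun b hb hba η hη ↦ by
    filter_upwards [hx.eventually_lt hρ.1.continuous (hcl b hb hba)
      (show R / 2 ≤ R by linarith) hη] with z hz hzO
    exact hz hzO.1 hzO.2.1) hfreq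
  have hsub : ∀ z ∈ ball (0 : ℂ) 1 ∩ ball a δ, u z ∈ x.source ∧ ‖x (u z)‖ ≤ R := fun z hz ↦ by
    have := hO z hz.1 (mem_ball_iff_norm.1 hz.2)
    exact ⟨this.1.2.1, this.1.2.2.le⟩
  refine ⟨?_, ball a δ, isOpen_ball, mem_ball_self hδ, _,
    hx.holderOnWith_of_norm_sub_le hK hsub fun z hz w hw ↦
      hhol z hz.1 w hw.1 (mem_ball_iff_norm.1 hz.2) (mem_ball_iff_norm.1 hw.2)⟩
  have hnw : 𝓝[ball 0 1 ∩ ball a δ] a = 𝓝[ball 0 1] a := by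
    exact nhdsWithin_inter_of_mem' (mem_nhdsWithin_of_mem_nhds (ball_mem_nhds a hδ))
  have hbot : (𝓝[ball 0 1 ∩ ball a δ] a).NeBot := by
    rw [hnw, ← mem_closure_iff_nhdsWithin_neBot, closure_ball _ one_ne_zero]
    exact mem_closedBall_zero_iff.2 ha.le
  have huc : UniformContinuousOn (fun z ↦ x (u z)) (ball 0 1 ∩ ball a δ) := by
    rw [Metric.uniformContinuousOn_iff]
    intro η hη
    have hcont : ContinuousAt (fun t ↦ K * √t) 0 := by fun_prop
    have hev := hcont.eventually_lt_const (show K * √0 < η by simpa using hη)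
    obtain ⟨τ, hτ, hball⟩ := Metric.eventually_nhds_iff_ball.1 hev
    refine ⟨τ, hτ, fun z hz w hw hzw ↦ ?_⟩
    rw [dist_eq_norm] at hzw ⊢
    refine (hhol z hz.1 w hw.1 (mem_ball_iff_norm.1 hz.2) (mem_ball_iff_norm.1 hw.2)).trans_lt ?_
    exact hball _ (by rwa [mem_ball_zero_iff, norm_norm])
  obtain ⟨y₀, hy₀⟩ := cauchy_map_iff_exists_tendsto.1
    (((cauchy_nhds (a := a)).mono nhdsWithin_le_nhds).map_of_le huc
      (le_principal_iff.2 self_mem_nhdsWithin))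
  have hmem : ∀ᶠ z in 𝓝[ball 0 1 ∩ ball a δ] a, z ∈ ball (0 : ℂ) 1 ∩ ball a δ :=
    self_mem_nhdsWithin
  have hy₀R : y₀ ∈ closedBall 0 R :=
    isClosed_closedBall.mem_of_tendsto hy₀
      (hmem.mono fun z hz ↦ mem_closedBall_zero_iff.2 (hsub z hz).2)
  refine ⟨x.symm y₀, ?_⟩
  rw [← hnw]
  refine ((x.continuousAt_symm (hx.subset_target hy₀R)).tendsto.comp hy₀).congr' ?_
  exact hmem.mono fun z hz ↦ x.left_inv (hsub z hz).1

end Chart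

theorem mainTheorem4 (n : ℕ) (hn : 2 ≤ n)
    {M : Type*} [EMetricSpace M] [ChartedSpace (EuclideanSpace ℝ (Fin n)) M]
    [IsManifold (𝓡 n) ∞ M]
    [RiemannianBundle (fun p : M ↦ TangentSpace (𝓡 n) p)]
    [IsContMDiffRiemannianBundle (𝓡 n) ∞ (EuclideanSpace ℝ (Fin n))
      (fun p : M ↦ TangentSpace (𝓡 n) p)]
    [IsRiemannianManifold (𝓡 n) M]
    (ρ : M → ℝ) (hρ : IsStrictlyMPSH n ρ)
    (u : ℂ → M) (hu : IsConformalHarmonicDisc (n := n) u)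
    (hpos : ∀ z ∈ ball (0 : ℂ) 1, 0 < ρ (u z))
    (α β : ℝ) (hαβ : α < β)
    (hne : ∀ a ∈ openArc α β, (clusterSet u a).Nonempty)
    (hcl : ∀ a ∈ openArc α β, clusterSet u a ⊆ {q | ρ q = 0}) :
    ∃ v : ℂ → M, EqOn v u (ball 0 1) ∧ ContinuousOn v (ball 0 1 ∪ openArc α β) ∧
      ∀ K ⊆ ball 0 1 ∪ openArc α β, IsCompact K →
        ∃ C : ℝ≥0, HolderOnWith C (1 / 2) v K := by
  have hcont : ContinuousOn u (ball 0 1) := hu.1.1.continuousOn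
  have hbdry : ∀ a ∈ openArc α β, (∃ q, Tendsto u (𝓝[ball 0 1] a) (𝓝 q)) ∧
      ∃ U, IsOpen U ∧ a ∈ U ∧ ∃ C, HolderOnWith C (1 / 2) u (ball 0 1 ∩ U) := fun a ha ↦ by
    obtain ⟨δ₁, hδ₁, harc⟩ := exists_forall_mem_openArc ha
    exact hρ.exists_holderOnWith_boundary hu hpos (norm_eq_one_of_mem_openArc ha) hδ₁
      (fun b hb hba ↦ hcl b (harc b hb hba)) (hne a ha)
  refine exists_extension_holderOnWith (convex_ball (0 : ℂ) 1).isPreconnected subset_union_left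
    ?_ hcont ?_ ?_
  · rintro a (ha | ha)
    · exact subset_closure ha
    · rw [closure_ball _ one_ne_zero]
      exact mem_closedBall_zero_iff.2 (norm_eq_one_of_mem_openArc ha).le
  · rintro a (ha | ha)
    · exact ⟨u a, hcont a ha⟩
    · exact (hbdry a ha).1
  · rintro a (ha | ha)
    · exact hρ.exists_holderOnWith_interior hu ha
    · exact (hbdry a ha).2
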